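/- **Theorem (maximal matching in dynamic hypergraphs in $O(t\cdot r^3)$ time).** A hypergraph of rank at most $r$ on a fixed vertex set $V$, $|V|=n$, undergoes insertions and deletions of hyperedges, starting with no hyperedges. Hyperedges carry names from $\{0,\dots,m-1\}$. An insertion presents an unused name and the list of the at least one and at most $r$ vertices of the new hyperedge; a deletion presents the name of a hyperedge that is present. Updates arrive online, one at a time, and the sequence of updates is fixed in advance, independently of the random bits of the algorithm (oblivious adversary). The model is a random access machine with zero-initialized memory, unit-cost arithmetic and unit-cost uniform sampling from $\{0,\dots,k\}$. There are a randomized algorithm (one program, which is given $n,m,r$) and an absolute constant $C$ such that the following holds for every integer $r>1$, all $n,m$ and every legal sequence of $t$ updates. For all outcomes of the random choices, the algorithm terminates, after each update its memory holds the characteristic vector of a maximal matching of the current hypergraph, and all numbers that it writes are at most $C(n+m+r+t)^C$ (so words of $O(\log(n+m+r+t))$ bits suffice). Let $T$ be the total number of steps over the $t$ updates, and $H\le t$ the maximum number of hyperedges that are present at the same time. Then: 1. (in expectation) $\mathbb{E}[T]\le C\cdot t\cdot r^3$; 2. (with high probability) $\Pr[T> C\cdot t\cdot r^3]\le e^{-t/H}$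 (for $t\ge 1$), and, more generally, $\Pr[T> C\,(t+\lambda H)\, r^3]\le e^{-\lambda}$ for every real $\lambda\ge 0$. In particular, with $N=n+H$: for every $c>0$, $T=O(r^3\,(t+c\,H\log N))$ with probability at least $1-N^{-c}$, and $T\le C\cdot t\cdot r^3$ with probability at least $1-N^{-c}$ whenever $t\ge c\,H\ln N$. -/

import Mathlib

open scoped ENNReal

/-! ## A randomized random access machine with a step count

Programs of a small imperative language over natural numbers, with random access arrays.  Every
assignment, array write, random draw and test costs one step; a program text is fixed once and for
all, so the expressions in it have constant size.  The state also records the largest number ever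
written, so that one can demand that all numbers fit into words of logarithmic length. -/

namespace DynMatch

/-- Expressions: constants, registers, array reads `A_a[e]` and the usual word operations
(`sub` is truncated at `0`; `lt`, `eq` return `0` or `1`). -/
inductive Expr : Type
  | const (k : ℕ)
  | reg (x : ℕ)
  | read (a : ℕ) (e : Expr)
  | add (e₁ e₂ : Expr)
  | sub (e₁ e₂ : Expr)
  | mul (e₁ e₂ : Expr)
  | div (e₁ e₂ : Expr)
  | mod (e₁ e₂ : Expr)
  | lt (e₁ e₂ : Expr)
  | eq (e₁ e₂ : Expr)

/-- Programs. `rand x e` draws a uniformly random element of `{0, …, e}` into register `x`. -/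
inductive Cmd : Type
  | skip
  | set (x : ℕ) (e : Expr)
  | write (a : ℕ) (i e : Expr)
  | rand (x : ℕ) (e : Expr)
  | seq (c₁ c₂ : Cmd)
  | ite (e : Expr) (c₁ c₂ : Cmd)
  | while (e : Expr) (c : Cmd)

/-- Machine states: contents of the registers and of the arrays, the number of steps made so far,
and the largest number written so far. -/
structure State : Type where
  reg : ℕ → ℕ
  arr : ℕ → ℕ → ℕ
  time : ℕ
  peak : ℕ

namespace Expr

/-- The value of an expression. -/
def eval (s : State) : Expr → ℕ
  | const k => k
  | reg x => s.reg x
  | read a e => s.arr a (e.eval s)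
  | add e₁ e₂ => e₁.eval s + e₂.eval s
  | sub e₁ e₂ => e₁.eval s - e₂.eval s
  | mul e₁ e₂ => e₁.eval s * e₂.eval s
  | div e₁ e₂ => e₁.eval s / e₂.eval s
  | mod e₁ e₂ => e₁.eval s % e₂.eval s
  | lt e₁ e₂ => if e₁.eval s < e₂.eval s then 1 else 0
  | eq e₁ e₂ => if e₁.eval s = e₂.eval s then 1 else 0

end Expr

namespace State

/-- One unit of time passes. -/
def tick (s : State) : State :=
  { s with time := s.time + 1 }

/-- Put `v` into register `x`, in one step. -/
def setReg (s : State) (x v : ℕ) : State :=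
  { reg := Function.update s.reg x v
    arr := s.arr
    time := s.time + 1
    peak := max s.peak v }

/-- Put `v` into cell `i` of array `a`, in one step. -/
def setArr (s : State) (a i v : ℕ) : State :=
  { reg := s.reg
    arr := Function.update s.arr a (Function.update (s.arr a) i v)
    time := s.time + 1
    peak := max s.peak v }

end State

/-- Big-step semantics: `c.Run s μ` says that `c`, started in the state `s`, terminates for all
outcomes of its random draws, and that `μ` is the distribution of its final state. -/
inductive Cmd.Run : Cmd → State → PMF State → Prop
  | skip (s : State) : Cmd.Run Cmd.skip s (PMF.pure s)
  | set (x : ℕ) (e : Expr) (s : State) :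
      Cmd.Run (Cmd.set x e) s (PMF.pure (s.setReg x (e.eval s)))
  | write (a : ℕ) (i e : Expr) (s : State) :
      Cmd.Run (Cmd.write a i e) s (PMF.pure (s.setArr a (i.eval s) (e.eval s)))
  | rand (x : ℕ) (e : Expr) (s : State) :
      Cmd.Run (Cmd.rand x e) s
        ((PMF.uniformOfFintype (Fin (e.eval s + 1))).map fun k => s.setReg x k)
  | seq (c₁ c₂ : Cmd) (s : State) (μ : PMF State) (ν : State → PMF State) :
      Cmd.Run c₁ s μ → (∀ s' ∈ μ.support, Cmd.Run c₂ s' (ν s')) →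
      Cmd.Run (Cmd.seq c₁ c₂) s (μ.bind ν)
  | ite_true (e : Expr) (c₁ c₂ : Cmd) (s : State) (μ : PMF State) :
      e.eval s ≠ 0 → Cmd.Run c₁ s.tick μ → Cmd.Run (Cmd.ite e c₁ c₂) s μ
  | ite_false (e : Expr) (c₁ c₂ : Cmd) (s : State) (μ : PMF State) :
      e.eval s = 0 → Cmd.Run c₂ s.tick μ → Cmd.Run (Cmd.ite e c₁ c₂) s μ
  | while_true (e : Expr) (c : Cmd) (s : State) (μ : PMF State) (ν : State → PMF State) :
      e.eval s ≠ 0 → Cmd.Run c s.tick μ →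
      (∀ s' ∈ μ.support, Cmd.Run (Cmd.while e c) s' (ν s')) →
      Cmd.Run (Cmd.while e c) s (μ.bind ν)
  | while_false (e : Expr) (c : Cmd) (s : State) :
      e.eval s = 0 → Cmd.Run (Cmd.while e c) s (PMF.pure s.tick)

theorem bind_congr_support {α β : Type*} (μ : PMF α) (f g : α → PMF β)
    (h : ∀ a ∈ μ.support, f a = g a) : μ.bind f = μ.bind g := by
  ext b
  simp only [PMF.bind_apply]
  refine tsum_congr fun a => ?_
  by_cases ha : a ∈ μ.support
  · rw [h a ha]
  · rw [(PMF.apply_eq_zero_iff μ a).2 ha]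
    simp

/-- The semantics is deterministic: the distribution of the final state is determined by the
program and the initial state. -/
theorem Cmd.Run.unique {c : Cmd} {s : State} {μ μ' : PMF State}
    (h : c.Run s μ) (h' : c.Run s μ') : μ = μ' := by
  induction h generalizing μ' with
  | skip | set | write | rand => cases h'; rfl
  | seq c₁ c₂ s μ ν _ _ ih₁ ih₂ =>
    cases h' with
    | seq _ _ _ μ₂ ν₂ k₁ k₂ =>
      obtain rfl := ih₁ k₁
      exact bind_congr_support _ _ _ fun a ha => ih₂ a ha (k₂ a ha)
  | ite_true e c₁ c₂ s μ he _ ih =>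
    cases h' with
    | ite_true _ _ _ _ _ _ k => exact ih k
    | ite_false _ _ _ _ _ k _ => exact absurd k he
  | ite_false e c₁ c₂ s μ he _ ih =>
    cases h' with
    | ite_true _ _ _ _ _ k _ => exact absurd he k
    | ite_false _ _ _ _ _ _ k => exact ih k
  | while_true e c s μ ν he _ _ ih₁ ih₂ =>
    cases h' with
    | while_true _ _ _ μ₂ ν₂ _ k₁ k₂ =>
      obtain rfl := ih₁ k₁
      exact bind_congr_support _ _ _ fun a ha => ih₂ a ha (k₂ a ha)
    | while_false _ _ _ k => exact absurd k he
  | while_false e c s he =>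
    cases h' with
    | while_true _ _ _ _ _ k _ _ => exact absurd he k
    | while_false => rfl

/-! ## Dynamic hypergraphs and maximal matchings -/

/-- A hypergraph on the vertex set `Fin n`, whose hyperedges have names in `Fin m`:
`G i = some e` if the hyperedge named `i` is present and has vertex set `e`, and `G i = none` if
no hyperedge named `i` is present.  Parallel hyperedges are allowed. -/
abbrev Hypergraph (n m : ℕ) : Type :=
  Fin m → Option (Finset (Fin n))

/-- An update inserts a hyperedge `e` under the name `i`, or deletes the hyperedge named `i`. -/
inductive Update (n m : ℕ) : Type
  | insert (i : Fin m) (e : Finset (Fin n))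
  | delete (i : Fin m)

namespace Hypergraph

variable {n m : ℕ}

/-- The hypergraph without hyperedges. -/
def empty (n m : ℕ) : Hypergraph n m := fun _ => none

/-- The hypergraph after an update. -/
def apply (G : Hypergraph n m) : Update n m → Hypergraph n m
  | .insert i e => Function.update G i (some e)
  | .delete i => Function.update G i none

/-- An update is legal for rank `r` if it inserts a hyperedge with at least one and at most `r`
vertices under an unused name, or deletes a hyperedge that is present. -/
def Legal (r : ℕ) (G : Hypergraph n m) : Update n m → Prop
  | .insert i e => G i = none ∧ e.Nonempty ∧ e.card ≤ r
  | .delete i => G i ≠ none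

/-- All updates of a sequence, applied one after the other starting with `G`, are legal. -/
def LegalSeq (r : ℕ) : Hypergraph n m → List (Update n m) → Prop
  | _, [] => True
  | G, u :: us => Legal r G u ∧ LegalSeq r (G.apply u) us

/-- The hypergraph obtained from the empty one by a sequence of updates. -/
def after (us : List (Update n m)) : Hypergraph n m :=
  us.foldl apply (empty n m)

/-- The number of hyperedges. -/
def numEdges (G : Hypergraph n m) : ℕ :=
  (Finset.univ.filter fun i => (G i).isSome).card

/-- The largest number of hyperedges that are present at the same time while a sequence of updates
is applied to the empty hypergraph. -/
def maxEdges (us : List (Update n m)) : ℕ :=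
  (Finset.range (us.length + 1)).sup fun k => (after (us.take k)).numEdges

/-- `M` is a maximal matching of `G`: it consists of hyperedges of `G`, these are pairwise
vertex-disjoint, and every hyperedge of `G` outside `M` meets a hyperedge in `M`. -/
def IsMaximalMatching (G : Hypergraph n m) (M : Set (Fin m)) : Prop :=
  (∀ i ∈ M, G i ≠ none) ∧
  (∀ i ∈ M, ∀ j ∈ M, i ≠ j → ∀ e f, G i = some e → G j = some f → Disjoint e f) ∧
  (∀ j ∉ M, ∀ f, G j = some f → ∃ i ∈ M, ∃ e, G i = some e ∧ ¬ Disjoint e f)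

end Hypergraph

/-! ## Serving a sequence of updates -/

/-- The initial state: registers `3`, `4`, `5` hold the number of vertices, the number of possible
names and the rank; everything else is zero. -/
def initState (n m r : ℕ) : State where
  reg := fun x => if x = 3 then n else if x = 4 then m else if x = 5 then r else 0
  arr := fun _ _ => 0
  time := 0
  peak := 0

/-- Presenting an update to the machine.  Register `0` says whether it is an insertion (`1`) or a
deletion (`0`), and register `1` holds the name of the hyperedge.  At an insertion, register `2`
holds the number of vertices, and array `1` their list in increasing order. -/
def State.load {n m : ℕ} (s : State) : Update n m → State
  | .insert i e =>
    { s with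
      reg := Function.update (Function.update (Function.update s.reg 0 1) 1 i) 2 e.card
      arr := Function.update s.arr 1 fun j =>
        ((e.sort (· ≤ ·)).map fun v : Fin n => (v : ℕ)).getD j 0 }
  | .delete i =>
    { s with reg := Function.update (Function.update s.reg 0 0) 1 i }

/-- The program `P` serves the updates online, one after the other, starting in the state `s`: each
update is presented, and then `P` is run before the next update is presented.  It terminates for
all outcomes of the random draws, and `μ` is the distribution of the state after the last update. -/
inductive Serves {n m : ℕ} (P : Cmd) : List (Update n m) → State → PMF State → Prop
  | nil (s : State) : Serves P [] s (PMF.pure s)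
  | cons (u : Update n m) (us : List (Update n m)) (s : State) (μ : PMF State)
      (ν : State → PMF State) :
      P.Run (s.load u) μ → (∀ s' ∈ μ.support, Serves P us s' (ν s')) →
      Serves P (u :: us) s (μ.bind ν)

/-- The output: array `0` is the characteristic vector of a set of names. -/
def State.output (m : ℕ) (s : State) : Set (Fin m) :=
  {i | s.arr 0 i ≠ 0}

/-- The expected number of steps. -/
noncomputable def expectedTime (μ : PMF State) : ℝ≥0∞ :=
  ∑' s, μ s * (s.time : ℝ≥0∞)

/-- The probability that more than `b` steps are made. -/
noncomputable def probTimeGT (μ : PMF State) (b : ℝ) : ℝ≥0∞ :=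
  μ.toOuterMeasure {s | b < (s.time : ℝ)}

end DynMatch

/-! Every hyperedge has a location: `2` is the limbo of hyperedges still to be treated, `3 * c` is
level `c`, and `3 * e + 1` is the sample frozen with the matched hyperedge `e`. Vertices have levels
`lvl r k`, growing by more than a factor `8 r`; unmatched vertices have level 0. A hyperedge that is
neither in the limbo nor frozen sits at the maximum level of its vertices, and level `c` holds at
most `c` hyperedges at each vertex (`Conf.Cap`). So level 0 is empty, and when the limbo is empty
too, every hyperedge has a matched vertex or is frozen with a matched hyperedge that it meets. This
is maximality (`Tidy.isMaximalMatching`).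

The limbo is emptied one hyperedge at a time. If this overloads level `c = lvl r k` at a vertex,
there are `s = c + 1` hyperedges there. A uniformly random one, `e`, is matched, all `s` are frozen
as its sample, the matched hyperedges that meet `e` are kicked out, and the vertices of `e` rise to
level `8 r s`. Hyperedges that lose their place return to the limbo. Falling levels pay for what
they send there (`Conf.unmatch_potential`), so everything is charged to rising levels: `O(r ^ 2 s)`
moves of `O(r)` steps per matching (`Conf.fix_spec`).

Randomness pays for this. The adversary is oblivious, so the deletion times `d` are fixed. A
hyperedge is late unless it lies in the sample of one that is deleted no earlier. A random choice of
`e` makes on average at least `s / 2` hyperedges of its sample cease to be late, whereas the kicked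
samples make at most `s / 8` late again. An update creates at most one late hyperedge, since a
matched hyperedge that is deleted next exposes only itself (`Conf.unmatch_late_first`). Hence the
potential `Conf.pot` gives amortized expected cost `O(r ^ 3)`.

For the tail, `exp (θ * (time + pot))` is a supermartingale while the limbo is emptied, if `θ * r ^
3` times the number of hyperedges is small (`pop_spec`, by `sum_exp_rank_le`). With `θ = 1 / (64000
r ^ 3 H)` this yields `E exp (θ T) ≤ exp (17000 θ r ^ 3 t)` (`serves_spec`). Markov's inequality
gives the tail (`probTimeGT_le`), and `1 + x ≤ exp x` the expectation (`expectedTime_le`).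

The rest is refinement: the memory represents an abstract `Conf` (`SetRep`, `Good`), and each
subroutine realizes an operation on `Conf` within a time bound (`Cmd.Det`). Only the draw in `pop`
needs the probabilistic triples `Cmd.Exp`. Termination for all outcomes holds because each round
raises the level sum or else shrinks the limbo. -/

namespace DynMatch

/-! ## Deterministic runs -/

/-- The program terminates without making use of randomness, in a state that satisfies `Q`. -/
def Cmd.Det (c : Cmd) (s : State) (Q : State → Prop) : Prop :=
  ∃ s', c.Run s (PMF.pure s') ∧ Q s'

namespace Cmd.Det

variable {c c₁ c₂ : Cmd} {s : State} {Q Q' : State → Prop}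

theorem mono (h : c.Det s Q) (hQ : ∀ s', Q s' → Q' s') : c.Det s Q' :=
  let ⟨s', h₁, h₂⟩ := h
  ⟨s', h₁, hQ _ h₂⟩

theorem skip (h : Q s) : Cmd.skip.Det s Q := ⟨s, .skip s, h⟩

theorem set {x : ℕ} {e : Expr} (h : Q (s.setReg x (e.eval s))) : (Cmd.set x e).Det s Q :=
  ⟨_, .set x e s, h⟩

theorem write {a : ℕ} {i e : Expr} (h : Q (s.setArr a (i.eval s) (e.eval s))) :
    (Cmd.write a i e).Det s Q :=
  ⟨_, .write a i e s, h⟩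

theorem seq (h : c₁.Det s fun s₁ => c₂.Det s₁ Q) : (Cmd.seq c₁ c₂).Det s Q := by
  obtain ⟨s₁, h₁, s₂, h₂, hQ⟩ := h
  refine ⟨s₂, ?_, hQ⟩
  have := Run.seq c₁ c₂ s (PMF.pure s₁) (fun _ => PMF.pure s₂) h₁ (by
    intro s' hs'
    rw [PMF.support_pure, Set.mem_singleton_iff] at hs'
    rwa [hs'])
  rwa [PMF.pure_bind] at this

theorem ite_true {e : Expr} (he : e.eval s ≠ 0) (h : c₁.Det s.tick Q) :
    (Cmd.ite e c₁ c₂).Det s Q :=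
  let ⟨s', h₁, h₂⟩ := h
  ⟨s', .ite_true e c₁ c₂ s _ he h₁, h₂⟩

theorem ite_false {e : Expr} (he : e.eval s = 0) (h : c₂.Det s.tick Q) :
    (Cmd.ite e c₁ c₂).Det s Q :=
  let ⟨s', h₁, h₂⟩ := h
  ⟨s', .ite_false e c₁ c₂ s _ he h₁, h₂⟩

theorem while_true {e : Expr} (he : e.eval s ≠ 0)
    (h : c.Det s.tick fun s₁ => (Cmd.while e c).Det s₁ Q) : (Cmd.while e c).Det s Q := by
  obtain ⟨s₁, h₁, s₂, h₂, hQ⟩ := h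
  refine ⟨s₂, ?_, hQ⟩
  have := Run.while_true e c s (PMF.pure s₁) (fun _ => PMF.pure s₂) he h₁ (by
    intro s' hs'
    rw [PMF.support_pure, Set.mem_singleton_iff] at hs'
    rwa [hs'])
  rwa [PMF.pure_bind] at this

theorem while_false {e : Expr} (he : e.eval s = 0) (h : Q s.tick) : (Cmd.while e c).Det s Q :=
  ⟨_, .while_false e c s he, h⟩

/-- A loop with an invariant `I`, indexed by the number of the rounds that are left. -/
theorem while_inv {e : Expr} (I : ℕ → State → Prop) (N : ℕ) (h₀ : I N s)
    (h₁ : ∀ k s, I (k + 1) s → e.eval s ≠ 0 ∧ c.Det s.tick (I k))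
    (h₂ : ∀ s, I 0 s → e.eval s = 0 ∧ Q s.tick) : (Cmd.while e c).Det s Q := by
  induction N generalizing s with
  | zero => exact while_false (h₂ s h₀).1 (h₂ s h₀).2
  | succ N ih => exact while_true (h₁ N s h₀).1 ((h₁ N s h₀).2.mono fun s' hs' => ih hs')

/-- A loop that counts the register `x` up to the value of `e`. -/
theorem for_loop {x : ℕ} {e : Expr} (N : ℕ) (I : ℕ → State → Prop) {a : ℕ} (ha : a ≤ N)
    (h₀ : I a s) (hI : ∀ k s, I k s → s.reg x = k ∧ e.eval s = N)
    (h₁ : ∀ k s, a ≤ k → k < N → I k s →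
      c.Det s.tick fun s' => s'.reg x = k ∧ I (k + 1) (s'.setReg x (k + 1)))
    (h₂ : ∀ s, I N s → Q s.tick) :
    (Cmd.while (.lt (.reg x) e) (.seq c (.set x (.add (.reg x) (.const 1))))).Det s Q := by
  refine while_inv (fun j s => j ≤ N - a ∧ I (N - j) s) (N - a) ?_ ?_ ?_
  · exact ⟨le_rfl, by rwa [Nat.sub_sub_self ha]⟩
  · rintro j s ⟨hj, hs⟩
    obtain ⟨hx, he⟩ := hI _ _ hs
    refine ⟨?_, seq ((h₁ _ s (by omega) (by omega) hs).mono ?_)⟩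
    · simp only [Expr.eval, hx, he]
      rw [if_pos (by omega)]
      exact one_ne_zero
    · rintro s' ⟨hx', hs'⟩
      refine set ⟨by omega, ?_⟩
      simp only [Expr.eval, hx']
      rwa [show N - (j + 1) + 1 = N - j by omega] at hs' ⊢
  · rintro s ⟨-, hs⟩
    obtain ⟨hx, he⟩ := hI _ _ hs
    refine ⟨?_, h₂ s hs⟩
    simp only [Expr.eval, hx, he]
    simp

end Cmd.Det

/-! ## Families of finite sets in arrays -/

/-- Uniqueness of division with remainder: cells in different blocks of length `m` never collide.
All separation between lists rests on this. -/
theorem mul_add_eq_iff {m a b p q : ℕ} (hp : p < m) (hq : q < m) :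
    a * m + p = b * m + q ↔ a = b ∧ p = q := by
  constructor
  · intro h
    have hm : 0 < m := by omega
    have h1 : (a * m + p) / m = a := by
      rw [mul_comm, Nat.mul_add_div hm, Nat.div_eq_of_lt hp, add_zero]
    have h2 : (b * m + q) / m = b := by
      rw [mul_comm, Nat.mul_add_div hm, Nat.div_eq_of_lt hq, add_zero]
    have hab : a = b := by rw [← h1, ← h2, h]
    subst hab
    exact ⟨rfl, by omega⟩
  · rintro ⟨rfl, rfl⟩
    rfl

/-- The arrays `c`, `it`, `po` hold, at the index `d`, the size of the set `X ⊆ {0, …, m - 1}`, a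
list of its elements and the positions of the elements in the list. -/
structure SetRep (m : ℕ) (c it po : ℕ → ℕ) (d : ℕ) (X : Finset ℕ) : Prop where
  card : c d = X.card
  pos : ∀ f ∈ X, f < m ∧ po (d * m + f) < X.card ∧ it (d * m + po (d * m + f)) = f
  item : ∀ q < X.card, it (d * m + q) ∈ X ∧ po (d * m + it (d * m + q)) = q

namespace SetRep

variable {m : ℕ} {c it po : ℕ → ℕ} {d d' f : ℕ} {X Y : Finset ℕ}

theorem card_le (h : SetRep m c it po d X) : X.card ≤ m := by
  have : X ⊆ Finset.range m := fun f hf => Finset.mem_range.2 (h.pos f hf).1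
  simpa using Finset.card_le_card this

theorem card_lt (h : SetRep m c it po d X) (hf : f ∉ X) (hm : f < m) : X.card < m := by
  have : insert f X ⊆ Finset.range m := fun g hg => by
    rcases Finset.mem_insert.1 hg with rfl | hg
    · exact Finset.mem_range.2 hm
    · exact Finset.mem_range.2 (h.pos g hg).1
  have := Finset.card_le_card this
  rw [Finset.card_insert_of_notMem hf, Finset.card_range] at this
  omega

theorem insert (h : SetRep m c it po d X) (hf : f ∉ X) (hm : f < m) :
    SetRep m (Function.update c d (c d + 1)) (Function.update it (d * m + c d) f)
      (Function.update po (d * m + f) (c d)) d (insert f X) := by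
  have hc := h.card_lt hf hm
  have hd := h.card
  constructor
  · simp [Finset.card_insert_of_notMem hf, h.card]
  · intro g hg
    rw [Finset.card_insert_of_notMem hf]
    rcases Finset.mem_insert.1 hg with rfl | hg
    · refine ⟨hm, ?_, ?_⟩ <;> simp [hd]
    · obtain ⟨h1, h2, h3⟩ := h.pos g hg
      have hgf : g ≠ f := fun e => hf (e ▸ hg)
      refine ⟨h1, ?_, ?_⟩
      · rw [Function.update_of_ne (by omega)]
        omega
      · rw [Function.update_of_ne (a := d * m + g) (by omega), Function.update_of_ne (by omega), h3]
  · intro q hq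
    rw [Finset.card_insert_of_notMem hf] at hq
    rcases Nat.lt_succ_iff_lt_or_eq.1 hq with hq | hq
    · obtain ⟨h1, h2⟩ := h.item q hq
      rw [Function.update_of_ne (a := d * m + q) (by omega)]
      refine ⟨Finset.mem_insert_of_mem h1, ?_⟩
      have hgf : it (d * m + q) ≠ f := fun e => hf (e ▸ h1)
      rw [Function.update_of_ne (by omega), h2]
    · rw [hq, ← hd]
      simp

/-- The slot `c d` lies inside the block of `d`, because a set of names that misses `f` has fewer
than `m` elements. -/
theorem insert_of_ne (h : SetRep m c it po d X) (hf : f ∉ X) (hm : f < m) (hd : d' ≠ d)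
    (h' : SetRep m c it po d' Y) :
    SetRep m (Function.update c d (c d + 1)) (Function.update it (d * m + c d) f)
      (Function.update po (d * m + f) (c d)) d' Y := by
  have hc : c d < m := h.card ▸ h.card_lt hf hm
  have hY := h'.card_le
  have key : ∀ {p q}, p < m → q < m → d' * m + p ≠ d * m + q := fun hp hq e =>
    hd ((mul_add_eq_iff hp hq).1 e).1
  constructor
  · rw [Function.update_of_ne hd, h'.card]
  · intro g hg
    obtain ⟨h1, h2, h3⟩ := h'.pos g hg
    rw [Function.update_of_ne (key h1 hm), Function.update_of_ne (key (by omega) hc)]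
    exact ⟨h1, h2, h3⟩
  · intro q hq
    obtain ⟨h1, h2⟩ := h'.item q hq
    rw [Function.update_of_ne (key (by omega) hc), Function.update_of_ne
      (key (h'.pos _ h1).1 hm)]
    exact ⟨h1, h2⟩

/-- Constant-time deletion: the last item takes the slot of `f`. The position is written at the item
read from the already modified array `it'`, as in `unlinkAt`. -/
theorem erase (h : SetRep m c it po d X) (hf : f ∈ X) {it' : ℕ → ℕ}
    (hit : it' = Function.update it (d * m + po (d * m + f)) (it (d * m + (c d - 1)))) :
    SetRep m (Function.update c d (c d - 1)) it'
      (Function.update po (d * m + it' (d * m + (c d - 1))) (po (d * m + f))) d (X.erase f) := by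
  have hc := h.card
  have hpos : 0 < X.card := Finset.card_pos.2 ⟨f, hf⟩
  obtain ⟨f1, f2, f3⟩ := h.pos f hf
  obtain ⟨l1, l2⟩ := h.item (X.card - 1) (by omega)
  -- If `f` is the last item, the slot that is read again has been overwritten, but with its own old
  -- value.
  have hl : it' (d * m + (c d - 1)) = it (d * m + (c d - 1)) := by
    rw [hit, Function.update_apply]
    split_ifs <;> rfl
  rw [hl, hc]
  constructor
  · simp [Finset.card_erase_of_mem hf]
  · intro g hg
    rw [Finset.card_erase_of_mem hf]
    obtain ⟨hgf, hg⟩ := Finset.mem_erase.1 hg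
    obtain ⟨h1, h2, h3⟩ := h.pos g hg
    refine ⟨h1, ?_⟩
    by_cases e : g = it (d * m + (X.card - 1))
    · rw [← e] at l2 ⊢
      rw [Function.update_self, hit, Function.update_self, hc]
      refine ⟨?_, e.symm⟩
      by_contra hcon
      have : po (d * m + f) = X.card - 1 := by omega
      rw [this, ← e] at f3
      exact hgf f3
    · rw [Function.update_of_ne (by omega), hit, Function.update_of_ne, h3]
      · refine ⟨?_, rfl⟩
        by_contra hcon
        exact e (by rw [← h3]; congr 2; omega)
      · intro hcon
        apply hgf
        rw [← h3, ← f3]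
        congr 1
  · intro q hq
    rw [Finset.card_erase_of_mem hf] at hq
    obtain ⟨h1, h2⟩ := h.item q (by omega)
    by_cases e : q = po (d * m + f)
    · rw [e, hit, Function.update_self, hc, Function.update_self]
      refine ⟨Finset.mem_erase.2 ⟨?_, l1⟩, rfl⟩
      intro hcon
      rw [hcon] at l2
      omega
    · rw [hit, Function.update_of_ne (a := d * m + q) (by omega)]
      refine ⟨Finset.mem_erase.2 ⟨?_, h1⟩, ?_⟩
      · intro hcon
        rw [hcon] at h2
        omega
      · rw [Function.update_of_ne, h2]
        intro hcon
        have : it (d * m + q) = it (d * m + (X.card - 1)) := by omega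
        rw [this] at h2
        omega

theorem erase_of_ne (h : SetRep m c it po d X) (hf : f ∈ X) {it' : ℕ → ℕ}
    (hit : it' = Function.update it (d * m + po (d * m + f)) (it (d * m + (c d - 1))))
    (hd : d' ≠ d) (h' : SetRep m c it po d' Y) :
    SetRep m (Function.update c d (c d - 1)) it'
      (Function.update po (d * m + it' (d * m + (c d - 1))) (po (d * m + f))) d' Y := by
  have hc := h.card
  have hX := h.card_le
  have hpos : 0 < X.card := Finset.card_pos.2 ⟨f, hf⟩
  have hY := h'.card_le
  obtain ⟨f1, f2, f3⟩ := h.pos f hf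
  obtain ⟨l1, l2⟩ := h.item (X.card - 1) (by omega)
  have hl : it' (d * m + (c d - 1)) = it (d * m + (c d - 1)) := by
    rw [hit, Function.update_apply]
    split_ifs <;> rfl
  have key : ∀ {p q}, p < m → q < m → d' * m + p ≠ d * m + q := fun hp hq e =>
    hd ((mul_add_eq_iff hp hq).1 e).1
  rw [hl, hc]
  constructor
  · rw [Function.update_of_ne hd, h'.card]
  · intro g hg
    obtain ⟨h1, h2, h3⟩ := h'.pos g hg
    rw [Function.update_of_ne (key h1 (h.pos _ l1).1), hit,
      Function.update_of_ne (key (by omega) (by omega))]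
    exact ⟨h1, h2, h3⟩
  · intro q hq
    obtain ⟨h1, h2⟩ := h'.item q hq
    rw [hit, Function.update_of_ne (key (by omega) (by omega)), Function.update_of_ne
      (key (h'.pos _ h1).1 (h.pos _ l1).1)]
    exact ⟨h1, h2⟩

end SetRep

end DynMatch

namespace DynMatch

/-! ## The memory layout -/

/-- The numbers of vertices and of names, and the rank. -/
structure Params where
  n : ℕ
  m : ℕ
  r : ℕ

/-- A bound on all the numbers that are written. -/
def Params.P (p : Params) : ℕ := 24 * p.r * p.m + 3 * p.m + p.n + p.r + 5

/-- The hyperedge `f` has the vertex list `V f`, which starts with the dummy vertex `n`; the list is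
empty if `f` is absent. -/
def WF (p : Params) (V : ℕ → List ℕ) : Prop :=
  ∀ f < p.m, V f = [] ∨
    ∃ t, V f = p.n :: t ∧ t ≠ [] ∧ t.Nodup ∧ (∀ x ∈ t, x < p.n) ∧ t.length ≤ p.r

/-- The set of the hyperedges at the location `κ` which contain the vertex `u`. -/
def lst (p : Params) (V : ℕ → List ℕ) (loc : ℕ → ℕ) (κ u : ℕ) : Finset ℕ :=
  (Finset.range p.m).filter fun f => loc f = κ ∧ u ∈ V f

/-- The registers `3`, `4`, `5` and the arrays `2`, `3` hold the parameters and the hypergraph. -/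
structure Ctx (p : Params) (V : ℕ → List ℕ) (s : State) : Prop where
  n : s.reg 3 = p.n
  m : s.reg 4 = p.m
  r : s.reg 5 = p.r
  peak : s.peak ≤ p.P
  deg : ∀ f < p.m, s.arr 2 f = (V f).length
  vtx : ∀ f < p.m, ∀ k (h : k < (V f).length), s.arr 3 (k * p.m + f) = (V f)[k]

/-- The arrays `7`, `8`, `9` hold the sets `X κ u`. -/
def Lists (p : Params) (s : State) (X : ℕ → ℕ → Finset ℕ) : Prop :=
  ∀ κ, ∀ u ≤ p.n, SetRep p.m (s.arr 7) (s.arr 8) (s.arr 9) (κ * (p.n + 1) + u) (X κ u)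

/-- The memory represents the hypergraph `V` and the sets of hyperedges that belong to the locations
in array `4`. -/
structure Good (p : Params) (V : ℕ → List ℕ) (s : State) : Prop extends Ctx p V s where
  lists : Lists p s (lst p V (s.arr 4))

/-- The registers below `k` are the same in both states. -/
def Frame (k : ℕ) (s s' : State) : Prop := ∀ x < k, s'.reg x = s.reg x

theorem Frame.refl (k : ℕ) (s : State) : Frame k s s := fun _ _ => rfl

theorem Frame.trans {k : ℕ} {s₁ s₂ s₃ : State} (h : Frame k s₁ s₂) (h' : Frame k s₂ s₃) :
    Frame k s₁ s₃ := fun x hx => (h' x hx).trans (h x hx)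

theorem Frame.mono {k l : ℕ} {s₁ s₂ : State} (h : Frame k s₁ s₂) (hl : l ≤ k) : Frame l s₁ s₂ :=
  fun x hx => h x (hx.trans_le hl)

theorem Frame.setReg {k : ℕ} {s₁ s₂ : State} (h : Frame k s₁ s₂) {x v : ℕ} (hx : k ≤ x) :
    Frame k s₁ (s₂.setReg x v) := fun y hy => by
  rw [← h y hy]
  exact Function.update_of_ne (by omega) _ _

theorem mem_lst {p : Params} {V : ℕ → List ℕ} {loc : ℕ → ℕ} {κ u f : ℕ} :
    f ∈ lst p V loc κ u ↔ f < p.m ∧ loc f = κ ∧ u ∈ V f := by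
  simp [lst]

namespace State

@[simp] theorem tick_reg (s : State) : s.tick.reg = s.reg := rfl
@[simp] theorem tick_arr (s : State) : s.tick.arr = s.arr := rfl
@[simp] theorem tick_time (s : State) : s.tick.time = s.time + 1 := rfl
@[simp] theorem setReg_arr (s : State) (x v : ℕ) : (s.setReg x v).arr = s.arr := rfl
@[simp] theorem setReg_time (s : State) (x v : ℕ) : (s.setReg x v).time = s.time + 1 := rfl
@[simp] theorem setReg_reg (s : State) (x v y : ℕ) :
    (s.setReg x v).reg y = if y = x then v else s.reg y := by
  simp [setReg, Function.update_apply]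
@[simp] theorem setArr_reg (s : State) (a i v : ℕ) : (s.setArr a i v).reg = s.reg := rfl
@[simp] theorem setArr_time (s : State) (a i v : ℕ) : (s.setArr a i v).time = s.time + 1 := rfl
@[simp] theorem setArr_arr_self (s : State) (a i v : ℕ) :
    (s.setArr a i v).arr a = Function.update (s.arr a) i v := by
  simp [setArr]
theorem setArr_arr_of_ne (s : State) {a b : ℕ} (i v : ℕ) (h : b ≠ a) :
    (s.setArr a i v).arr b = s.arr b := by
  simp [setArr, h]
@[simp] theorem setArr_arr (s : State) (a i v b : ℕ) :
    (s.setArr a i v).arr b = if b = a then Function.update (s.arr a) i v else s.arr b := by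
  simp only [setArr, Function.update_apply]

end State

namespace WF

variable {p : Params} {V : ℕ → List ℕ} {f x : ℕ}

theorem le (h : WF p V) (hf : f < p.m) (hx : x ∈ V f) : x ≤ p.n := by
  rcases h f hf with h | ⟨t, h, -, -, ht, -⟩
  · simp [h] at hx
  · rw [h] at hx
    rcases List.mem_cons.1 hx with rfl | hx
    · exact le_rfl
    · exact (ht x hx).le

theorem nodup (h : WF p V) (hf : f < p.m) : (V f).Nodup := by
  rcases h f hf with h | ⟨t, h, -, h', ht, -⟩
  · simp [h]
  · rw [h, List.nodup_cons]
    exact ⟨fun hn => (ht _ hn).false, h'⟩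

theorem length_le (h : WF p V) (hf : f < p.m) : (V f).length ≤ p.r + 1 := by
  rcases h f hf with h | ⟨t, h, -, h', ht, h''⟩
  · simp [h]
  · rw [h, List.length_cons]
    omega

theorem tail_lt (h : WF p V) (hf : f < p.m) (hx : x ∈ (V f).tail) : x < p.n := by
  rcases h f hf with h | ⟨t, h, -, -, ht, -⟩
  · simp [h] at hx
  · rw [h] at hx
    exact ht x hx

theorem mem_tail (h : WF p V) (hf : f < p.m) (hx : x ∈ V f) (hn : x < p.n) : x ∈ (V f).tail := by
  rcases h f hf with h | ⟨t, h, -, -, ht, -⟩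
  · simp [h] at hx
  · rw [h] at hx ⊢
    rcases List.mem_cons.1 hx with rfl | hx
    · omega
    · exact hx

/-- The purpose of the dummy vertex: its list at a location enumerates all hyperedges there. -/
theorem dummy_mem (h : WF p V) (hf : f < p.m) (hx : V f ≠ []) : p.n ∈ V f := by
  rcases h f hf with h | ⟨t, h, -⟩
  · exact absurd h hx
  · simp [h]

theorem tail_ne_nil (h : WF p V) (hf : f < p.m) (hx : V f ≠ []) : (V f).tail ≠ [] := by
  rcases h f hf with h | ⟨t, h, h', -⟩
  · exact absurd h hx
  · simp [h, h']

theorem tail_nodup (h : WF p V) (hf : f < p.m) : (V f).tail.Nodup := (h.nodup hf).tail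

theorem length_tail_le (h : WF p V) (hf : f < p.m) : (V f).tail.length ≤ p.r := by
  have := h.length_le hf
  rw [List.length_tail]
  omega

end WF

namespace Ctx

variable {p : Params} {V : ℕ → List ℕ} {s : State}

theorem tick (h : Ctx p V s) : Ctx p V s.tick := ⟨h.1, h.2, h.3, h.4, h.5, h.6⟩

theorem setReg (h : Ctx p V s) {x v : ℕ} (hx : 5 < x) (hv : v ≤ p.P) : Ctx p V (s.setReg x v) := by
  refine ⟨?_, ?_, ?_, max_le h.4 hv, h.5, h.6⟩
  · rw [State.setReg_reg, if_neg (by omega), h.n]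
  · rw [State.setReg_reg, if_neg (by omega), h.m]
  · rw [State.setReg_reg, if_neg (by omega), h.r]

theorem setArr (h : Ctx p V s) {a i v : ℕ} (h2 : a ≠ 2) (h3 : a ≠ 3) (hv : v ≤ p.P) :
    Ctx p V (s.setArr a i v) := by
  refine ⟨h.1, h.2, h.3, max_le h.4 hv, ?_, ?_⟩
  · rw [State.setArr_arr_of_ne _ _ _ h2.symm]
    exact h.5
  · rw [State.setArr_arr_of_ne _ _ _ h3.symm]
    exact h.6

end Ctx

theorem Good.tick {p : Params} {V : ℕ → List ℕ} {s : State} (h : Good p V s) : Good p V s.tick :=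
  ⟨h.toCtx.tick, h.lists⟩

theorem Good.setReg {p : Params} {V : ℕ → List ℕ} {s : State} (h : Good p V s) {x v : ℕ}
    (hx : 5 < x) (hv : v ≤ p.P) : Good p V (s.setReg x v) :=
  ⟨h.toCtx.setReg hx hv, h.lists⟩

theorem Good.setArr {p : Params} {V : ℕ → List ℕ} {s : State} (h : Good p V s) {a i v : ℕ}
    (h2 : a ≠ 2) (h3 : a ≠ 3) (h4 : a ≠ 4) (h7 : a < 7) (hv : v ≤ p.P) :
    Good p V (s.setArr a i v) := by
  refine ⟨h.toCtx.setArr h2 h3 hv, ?_⟩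
  rw [State.setArr_arr_of_ne _ _ _ h4.symm]
  intro κ u hu
  rw [State.setArr_arr_of_ne _ _ _ (by omega), State.setArr_arr_of_ne _ _ _ (by omega),
    State.setArr_arr_of_ne _ _ _ (by omega)]
  exact h.lists κ u hu

/-! ## Moving hyperedges between the lists -/

/-- The index of the set of the hyperedges at the location `κ` which contain the vertex `u`. -/
def idE (κ u : Expr) : Expr := .add (.mul κ (.add (.reg 3) (.const 1))) u

/-- The address of the entry `q` in the part `i` of an array. -/
def adE (i q : Expr) : Expr := .add (.mul i (.reg 4)) q

/-- The vertex number `k` of the hyperedge `f`. -/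
def vtxE (k f : Expr) : Expr := .read 3 (adE k f)

/-- Count the register `x` up to the value of `e`. -/
def Cmd.upTo (x : ℕ) (e : Expr) (c : Cmd) : Cmd :=
  .while (.lt (.reg x) e) (.seq c (.set x (.add (.reg x) (.const 1))))

/-- Add the hyperedge `f` to the list of the location `κ` and the vertex `u`. -/
def linkAt (κ u f : Expr) : Cmd :=
  .seq (.write 8 (adE (idE κ u) (.read 7 (idE κ u))) f) <|
  .seq (.write 9 (adE (idE κ u) f) (.read 7 (idE κ u))) <|
  .write 7 (idE κ u) (.add (.read 7 (idE κ u)) (.const 1))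

/-- Remove the hyperedge `f` from the list of the location `κ` and the vertex `u`. -/
def unlinkAt (κ u f : Expr) : Cmd :=
  .seq (.write 7 (idE κ u) (.sub (.read 7 (idE κ u)) (.const 1))) <|
  .seq (.write 8 (adE (idE κ u) (.read 9 (adE (idE κ u) f)))
    (.read 8 (adE (idE κ u) (.read 7 (idE κ u))))) <|
  .write 9 (adE (idE κ u) (.read 8 (adE (idE κ u) (.read 7 (idE κ u)))))
    (.read 9 (adE (idE κ u) f))

/-- Put the hyperedge in register `40` at the location in register `41`. -/
def link : Cmd :=
  .seq (.set 50 (.const 0)) <|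
  .seq (.upTo 50 (.read 2 (.reg 40)) <|
    linkAt (.reg 41) (vtxE (.reg 50) (.reg 40)) (.reg 40)) <|
  .write 4 (.reg 40) (.reg 41)

/-- Take the hyperedge in register `40` away from its location. -/
def unlink : Cmd :=
  .seq (.set 50 (.const 0)) <|
  .upTo 50 (.read 2 (.reg 40)) <|
    unlinkAt (.read 4 (.reg 40)) (vtxE (.reg 50) (.reg 40)) (.reg 40)

section

variable {p : Params} {V : ℕ → List ℕ} {s : State} {X : ℕ → ℕ → Finset ℕ} {f κ u : ℕ}

theorem Params.bounds (p : Params) : p.n + 5 ≤ p.P ∧ 3 * p.m + 5 ≤ p.P ∧ p.r + 5 ≤ p.P := by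
  unfold Params.P
  refine ⟨?_, ?_, ?_⟩ <;> nlinarith [Nat.zero_le (24 * p.r * p.m)]

theorem id_eq_iff {p : Params} {κ κ' u u' : ℕ} (hu : u ≤ p.n) (hu' : u' ≤ p.n) :
    κ' * (p.n + 1) + u' = κ * (p.n + 1) + u ↔ κ' = κ ∧ u' = u :=
  mul_add_eq_iff (by omega) (by omega)

/-- The argument expressions are evaluated anew between the three writes. `hE` says that they depend
only on registers and on arrays below `7`, which these writes leave alone. -/
theorem linkAt_spec {κE uE fE : Expr} (hs : Ctx p V s) (hX : Lists p s X) (hf : f < p.m)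
    (hu : u ≤ p.n) (hfX : f ∉ X κ u)
    (hE : ∀ s' : State, s'.reg = s.reg → (∀ a < 7, s'.arr a = s.arr a) →
      κE.eval s' = κ ∧ uE.eval s' = u ∧ fE.eval s' = f) :
    (linkAt κE uE fE).Det s fun s' => Ctx p V s' ∧ s'.reg = s.reg ∧
      (∀ a < 7, s'.arr a = s.arr a) ∧ s'.time = s.time + 3 ∧
      Lists p s' fun κ' u' => if κ' = κ ∧ u' = u then insert f (X κ' u') else X κ' u' := by
  have hb := p.bounds
  have hS := hX κ u hu
  have hcard := hS.card_lt hfX hf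
  have hc := hS.card
  obtain ⟨e1, e2, e3⟩ := hE s rfl fun _ _ => rfl
  have hid : (idE κE uE).eval s = κ * (p.n + 1) + u := by simp [idE, Expr.eval, e1, e2, hs.n]
  refine .seq (.write (.seq (.write (.write ?_))))
  set s1 := s.setArr 8 _ _ with hs1
  obtain ⟨e1', e2', e3'⟩ := hE s1 rfl fun a ha => by
    rw [hs1, State.setArr_arr_of_ne _ _ _ (by omega)]
  have hid1 : (idE κE uE).eval s1 = κ * (p.n + 1) + u := by
    change κE.eval s1 * (s.reg 3 + 1) + uE.eval s1 = _
    rw [e1', e2', hs.n]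
  set s2 := s1.setArr 9 _ _ with hs2
  obtain ⟨e1'', e2'', e3''⟩ := hE s2 rfl fun a ha => by
    rw [hs2, State.setArr_arr_of_ne _ _ _ (by omega), hs1, State.setArr_arr_of_ne _ _ _ (by omega)]
  have hid2 : (idE κE uE).eval s2 = κ * (p.n + 1) + u := by
    change κE.eval s2 * (s.reg 3 + 1) + uE.eval s2 = _
    rw [e1'', e2'', hs.n]
  have hr : s2.reg = s.reg := rfl
  simp only [Expr.eval, adE, hid, hid1, hid2, e3, e3', hs.m] at hs1 hs2 ⊢
  have m1 : s1.arr 7 = s.arr 7 := by simp [hs1]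
  have m2 : s2.arr 7 = s.arr 7 := by simp [hs2, m1]
  have hm : s1.reg 4 = p.m := hs.m
  rw [m1, hm] at hs2
  rw [m2]
  have hcon : Ctx p V s2 := by
    rw [hs2, hs1]
    exact (hs.setArr (by omega) (by omega) (by omega)).setArr (by omega) (by omega) (by omega)
  refine ⟨hcon.setArr (by omega) (by omega) (by omega), rfl, ?_, rfl, ?_⟩
  · intro a ha
    rw [State.setArr_arr_of_ne _ _ _ (by omega), hs2, State.setArr_arr_of_ne _ _ _ (by omega), hs1,
      State.setArr_arr_of_ne _ _ _ (by omega)]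
  · have a8 : s2.arr 8 = Function.update (s.arr 8) ((κ * (p.n + 1) + u) * p.m +
        s.arr 7 (κ * (p.n + 1) + u)) f := by simp [hs2, hs1]
    have a9 : s2.arr 9 = Function.update (s.arr 9) ((κ * (p.n + 1) + u) * p.m + f)
        (s.arr 7 (κ * (p.n + 1) + u)) := by simp [hs2, hs1]
    clear_value s2
    intro κ' u' hu'
    simp only [State.setArr_arr, reduceIte, Nat.reduceEqDiff, m2, a8, a9]
    split_ifs with h
    · obtain ⟨rfl, rfl⟩ := h
      exact hS.insert hfX hf
    · exact hS.insert_of_ne hfX hf (fun e => h ((id_eq_iff hu hu').1 e)) (hX κ' u' hu')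

theorem unlinkAt_spec {κE uE fE : Expr} (hs : Ctx p V s) (hX : Lists p s X)
    (hu : u ≤ p.n) (hfX : f ∈ X κ u)
    (hE : ∀ s' : State, s'.reg = s.reg → (∀ a < 7, s'.arr a = s.arr a) →
      κE.eval s' = κ ∧ uE.eval s' = u ∧ fE.eval s' = f) :
    (unlinkAt κE uE fE).Det s fun s' => Ctx p V s' ∧ s'.reg = s.reg ∧
      (∀ a < 7, s'.arr a = s.arr a) ∧ s'.time = s.time + 3 ∧
      Lists p s' fun κ' u' => if κ' = κ ∧ u' = u then (X κ' u').erase f else X κ' u' := by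
  have hb := p.bounds
  have hS := hX κ u hu
  have hcard := hS.card_le
  have hc := hS.card
  have hpos : 0 < (X κ u).card := Finset.card_pos.2 ⟨f, hfX⟩
  obtain ⟨e1, e2, e3⟩ := hE s rfl fun _ _ => rfl
  have hid : (idE κE uE).eval s = κ * (p.n + 1) + u := by simp [idE, Expr.eval, e1, e2, hs.n]
  refine .seq (.write (.seq (.write (.write ?_))))
  set s1 := s.setArr 7 _ _ with hs1
  obtain ⟨e1', e2', e3'⟩ := hE s1 rfl fun a ha => by
    rw [hs1, State.setArr_arr_of_ne _ _ _ (by omega)]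
  have hid1 : (idE κE uE).eval s1 = κ * (p.n + 1) + u := by
    change κE.eval s1 * (s.reg 3 + 1) + uE.eval s1 = _
    rw [e1', e2', hs.n]
  set s2 := s1.setArr 8 _ _ with hs2
  obtain ⟨e1'', e2'', e3''⟩ := hE s2 rfl fun a ha => by
    rw [hs2, State.setArr_arr_of_ne _ _ _ (by omega), hs1, State.setArr_arr_of_ne _ _ _ (by omega)]
  have hid2 : (idE κE uE).eval s2 = κ * (p.n + 1) + u := by
    change κE.eval s2 * (s.reg 3 + 1) + uE.eval s2 = _
    rw [e1'', e2'', hs.n]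
  simp only [Expr.eval, adE, hid, hid1, hid2, e3', e3''] at hs1 hs2 ⊢
  have m1 : s1.arr 7 = Function.update (s.arr 7) (κ * (p.n + 1) + u)
      (s.arr 7 (κ * (p.n + 1) + u) - 1) := by simp [hs1]
  have m1' : s1.arr 8 = s.arr 8 := by simp [hs1]
  have m1'' : s1.arr 9 = s.arr 9 := by simp [hs1]
  have m2 : s2.arr 7 = s1.arr 7 := by simp [hs2]
  have m2'' : s2.arr 9 = s.arr 9 := by simp [hs2, m1'']
  have hm : s1.reg 4 = p.m := hs.m
  have hm2 : s2.reg 4 = p.m := hs.m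
  rw [m1, m1', m1'', hm, Function.update_self] at hs2
  rw [m2, m2'', hm2, m1, Function.update_self]
  have m2' : s2.arr 8 = Function.update (s.arr 8) ((κ * (p.n + 1) + u) * p.m +
      s.arr 9 ((κ * (p.n + 1) + u) * p.m + f)) (s.arr 8 ((κ * (p.n + 1) + u) * p.m +
        (s.arr 7 (κ * (p.n + 1) + u) - 1))) := by simp [hs2, m1']
  obtain ⟨f1, f2, f3⟩ := hS.pos f hfX
  obtain ⟨l1, l2⟩ := hS.item ((X κ u).card - 1) (by omega)
  rw [← hc] at l1
  have l3 := (hS.pos _ l1).1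
  have hcon : Ctx p V s2 := by
    rw [hs2, hs1]
    exact (hs.setArr (by omega) (by omega) (by omega)).setArr (by omega) (by omega) (by omega)
  refine ⟨hcon.setArr (by omega) (by omega) (by omega), rfl, ?_, rfl, ?_⟩
  · intro a ha
    rw [State.setArr_arr_of_ne _ _ _ (by omega), hs2, State.setArr_arr_of_ne _ _ _ (by omega), hs1,
      State.setArr_arr_of_ne _ _ _ (by omega)]
  · clear_value s2 s1
    intro κ' u' hu'
    simp only [State.setArr_arr, reduceIte, Nat.reduceEqDiff, m2, m1, m2'']
    split_ifs with h
    · obtain ⟨rfl, rfl⟩ := h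
      exact hS.erase hfX m2'
    · exact hS.erase_of_ne hfX m2' (fun e => h ((id_eq_iff hu hu').1 e)) (hX κ' u' hu')

theorem Lists.congr {Y : ℕ → ℕ → Finset ℕ} (h : Lists p s X) (hXY : ∀ κ u, X κ u = Y κ u) :
    Lists p s Y := fun κ u hu => hXY κ u ▸ h κ u hu

theorem mem_take_succ {l : List ℕ} {k x : ℕ} (hk : k < l.length) :
    x ∈ l.take (k + 1) ↔ x ∈ l.take k ∨ x = l[k] := by
  rw [← List.take_append_getElem hk]
  simp only [List.mem_append, List.mem_singleton]

theorem getElem_notMem_take {l : List ℕ} (hl : l.Nodup) {k : ℕ} (hk : k < l.length) :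
    l[k] ∉ l.take k := by
  rw [List.mem_take_iff_getElem]
  rintro ⟨j, hj, e⟩
  have := (List.Nodup.getElem_inj_iff hl).1 e
  omega

/-- The hypothesis speaks of the sets with `f` erased, so that it covers both a hyperedge just
unlinked and a new one; in both cases the location array may hold a stale entry for `f`. -/
theorem link_spec (hV : WF p V) (hs : Ctx p V s) (hf : s.reg 40 = f) (hfm : f < p.m)
    (hκ : s.reg 41 = κ) (hκP : κ ≤ p.P)
    (hX : Lists p s fun κ u => (lst p V (s.arr 4) κ u).erase f) :
    link.Det s fun s' => Good p V s' ∧ s'.arr 4 = Function.update (s.arr 4) f κ ∧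
      (∀ a < 7, a ≠ 4 → s'.arr a = s.arr a) ∧ Frame 50 s s' ∧
      s'.time ≤ s.time + 5 * p.r + 8 := by
  have hb := p.bounds
  have hlen := hV.length_le hfm
  set X := fun κ u => (lst p V (s.arr 4) κ u).erase f with hXdef
  refine .seq (.set (.seq ?_))
  simp only [Expr.eval]
  refine Cmd.Det.for_loop (V f).length (fun k s' => Ctx p V s' ∧ s'.reg 50 = k ∧ Frame 50 s s' ∧
    (∀ a < 7, s'.arr a = s.arr a) ∧ s'.time = s.time + 1 + 5 * k ∧ k ≤ (V f).length ∧
    Lists p s' fun κ' u' => if κ' = κ ∧ u' ∈ (V f).take k then insert f (X κ' u') else X κ' u')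
    (a := 0) (Nat.zero_le _) ?_ ?_ ?_ ?_
  · refine ⟨hs.setReg (by omega) (by omega), by simp, (Frame.refl _ _).setReg le_rfl,
      fun _ _ => rfl, rfl, Nat.zero_le _, ?_⟩
    refine Lists.congr (X := X) hX fun κ u => ?_
    simp
  · rintro k s' ⟨h1, h2, h3, h4, -⟩
    refine ⟨h2, ?_⟩
    simp only [Expr.eval]
    rw [h3 40 (by omega), hf, h1.deg f hfm]
  · rintro k s' - hk ⟨h1, h2, h3, h4, h5, -, h6⟩
    have hmem : (V f)[k] ∈ V f := List.getElem_mem hk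
    refine (linkAt_spec (κ := κ) (u := (V f)[k]) (f := f) h1.tick h6 hfm (hV.le hfm hmem) ?_
      ?_).mono ?_
    · rw [if_neg (fun h => getElem_notMem_take (hV.nodup hfm) hk h.2)]
      simp [hXdef]
    · intro s'' hr ha
      simp only [vtxE, adE, Expr.eval, hr, State.tick_reg, h2, h3 40 (by omega), hf,
        h3 41 (by omega), hκ, ha 3 (by omega), h1.m]
      exact ⟨trivial, h1.vtx f hfm k hk, trivial⟩
    · rintro s'' ⟨g1, g2, g3, g4, g5⟩
      refine ⟨by rw [g2]; exact h2, g1.setReg (by omega) (by omega), by simp, ?_, ?_, ?_, hk, ?_⟩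
      · refine Frame.setReg (fun x hx => ?_) le_rfl
        rw [g2]
        exact h3 x hx
      · intro a ha
        rw [State.setReg_arr, g3 a ha]
        exact h4 a ha
      · rw [State.setReg_time, g4, State.tick_time, h5]
        ring
      · refine Lists.congr (s := s'') g5 fun κ' u' => ?_
        simp only [mem_take_succ hk]
        by_cases e1 : κ' = κ <;> by_cases e2 : u' = (V f)[k] <;>
          by_cases e3 : u' ∈ (V f).take k <;> simp [e1, e2, e3] <;> grind
  · rintro s' ⟨h1, h2, h3, h4, h5, -, h6⟩
    have h41 : s'.reg 41 = κ := (h3 41 (by omega)).trans hκ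
    have h40 : s'.reg 40 = f := (h3 40 (by omega)).trans hf
    refine .write ?_
    simp only [Expr.eval, State.tick_reg, h41, h40]
    refine ⟨⟨h1.tick.setArr (by omega) (by omega) hκP, ?_⟩, ?_, ?_, ?_, ?_⟩
    · rw [State.setArr_arr_self, State.tick_arr, h4 4 (by omega)]
      intro κ' u' hu'
      rw [State.setArr_arr_of_ne _ _ _ (by omega), State.setArr_arr_of_ne _ _ _ (by omega),
        State.setArr_arr_of_ne _ _ _ (by omega)]
      suffices h : lst p V (Function.update (s.arr 4) f κ) κ' u' = if κ' = κ ∧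
          u' ∈ (V f).take (V f).length then insert f (X κ' u') else X κ' u' by
        rw [h]
        exact h6 κ' u' hu'
      ext g
      rw [List.take_of_length_le le_rfl, mem_lst]
      by_cases hg : g = f
      · subst hg
        split_ifs with h
        · simp [h, hfm]
        · simp only [Function.update_self, hXdef, Finset.notMem_erase, iff_false]
          exact fun h' => h ⟨h'.2.1.symm, h'.2.2⟩
      · rw [Function.update_of_ne hg]
        split_ifs <;> simp [hXdef, hg, mem_lst]
    · rw [State.setArr_arr_self, State.tick_arr, h4 4 (by omega)]
    · intro a ha ha4
      rw [State.setArr_arr_of_ne _ _ _ ha4]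
      exact h4 a ha
    · exact h3
    · rw [State.setArr_time, State.tick_time, h5]
      omega

/-- The location array keeps its entry for `f`, so `Good` may fail until `f` is linked again or its
vertex list is emptied. -/
theorem unlink_spec (hV : WF p V) (hs : Good p V s) (hf : s.reg 40 = f) (hfm : f < p.m) :
    unlink.Det s fun s' => Ctx p V s' ∧
      (Lists p s' fun κ u => (lst p V (s.arr 4) κ u).erase f) ∧
      (∀ a < 7, s'.arr a = s.arr a) ∧ Frame 50 s s' ∧
      s'.time ≤ s.time + 5 * p.r + 7 := by
  have hb := p.bounds
  have hlen := hV.length_le hfm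
  set X := lst p V (s.arr 4) with hXdef
  refine .seq (.set ?_)
  simp only [Expr.eval]
  refine Cmd.Det.for_loop (V f).length (fun k s' => Ctx p V s' ∧ s'.reg 50 = k ∧ Frame 50 s s' ∧
    (∀ a < 7, s'.arr a = s.arr a) ∧ s'.time = s.time + 1 + 5 * k ∧ k ≤ (V f).length ∧
    Lists p s' fun κ' u' => if κ' = s.arr 4 f ∧ u' ∈ (V f).take k then (X κ' u').erase f
      else X κ' u')
    (a := 0) (Nat.zero_le _) ?_ ?_ ?_ ?_
  · refine ⟨hs.toCtx.setReg (by omega) (by omega), by simp, (Frame.refl _ _).setReg le_rfl,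
      fun _ _ => rfl, rfl, Nat.zero_le _, ?_⟩
    refine Lists.congr (X := X) hs.lists fun κ u => ?_
    simp
  · rintro k s' ⟨h1, h2, h3, h4, -⟩
    refine ⟨h2, ?_⟩
    simp only [Expr.eval]
    rw [h3 40 (by omega), hf, h1.deg f hfm]
  · rintro k s' - hk ⟨h1, h2, h3, h4, h5, -, h6⟩
    have hmem : (V f)[k] ∈ V f := List.getElem_mem hk
    refine (unlinkAt_spec (κ := s.arr 4 f) (u := (V f)[k]) (f := f) h1.tick h6
      (hV.le hfm hmem) ?_ ?_).mono ?_
    · rw [if_neg (fun h => getElem_notMem_take (hV.nodup hfm) hk h.2), hXdef, mem_lst]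
      exact ⟨hfm, rfl, hmem⟩
    · intro s'' hr ha
      simp only [vtxE, adE, Expr.eval, hr, State.tick_reg, h2, h3 40 (by omega), hf,
        ha 4 (by omega), ha 3 (by omega), h1.m]
      exact ⟨by rw [State.tick_arr, h4 4 (by omega)], h1.vtx f hfm k hk, trivial⟩
    · rintro s'' ⟨g1, g2, g3, g4, g5⟩
      refine ⟨by rw [g2]; exact h2, g1.setReg (by omega) (by omega), by simp, ?_, ?_, ?_, hk, ?_⟩
      · refine Frame.setReg (fun x hx => ?_) le_rfl
        rw [g2]
        exact h3 x hx
      · intro a ha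
        rw [State.setReg_arr, g3 a ha]
        exact h4 a ha
      · rw [State.setReg_time, g4, State.tick_time, h5]
        ring
      · refine Lists.congr (s := s'') g5 fun κ' u' => ?_
        simp only [mem_take_succ hk]
        by_cases e1 : κ' = s.arr 4 f <;> by_cases e2 : u' = (V f)[k] <;>
          by_cases e3 : u' ∈ (V f).take k <;> simp [e1, e2, e3] <;> grind
  · rintro s' ⟨h1, h2, h3, h4, h5, -, h6⟩
    refine ⟨h1.tick, ?_, h4, h3, ?_⟩
    · refine Lists.congr (s := s'.tick) h6 fun κ' u' => ?_
      rw [List.take_of_length_le le_rfl]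
      split_ifs with h
      · rfl
      · rw [Finset.erase_eq_of_notMem]
        rw [hXdef, mem_lst]
        exact fun h' => h ⟨h'.2.1.symm, h'.2.2⟩
    · rw [State.tick_time, h5]
      omega

end

end DynMatch

namespace DynMatch

/-! ## Configurations -/

/-- The levels: `lvl r (k + 1)` is `8 r` times the size of the samples of that level. -/
def lvl (r : ℕ) : ℕ → ℕ
  | 0 => 0
  | k + 1 => 8 * r * (lvl r k + 1)

/-- Doubling is what bounds the sum of all lower levels in `evict_limbo`. -/
theorem lvl_succ_ge {r : ℕ} (hr : 1 < r) (k : ℕ) : 2 * lvl r k < lvl r (k + 1) := by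
  rw [lvl]
  nlinarith

theorem lvl_strictMono {r : ℕ} (hr : 1 < r) : StrictMono (lvl r) :=
  strictMono_nat_of_lt_succ fun k => by
    have := lvl_succ_ge hr k
    omega

/-- The locations of the hyperedges, the levels of the vertices, the matched hyperedges of the
vertices of positive level and the characteristic vector of the matching. -/
structure Conf where
  loc : ℕ → ℕ
  lev : ℕ → ℕ
  mate : ℕ → ℕ
  out : ℕ → ℕ

namespace Conf

variable (p : Params) (V : ℕ → List ℕ)

/-- Move all hyperedges from the location `κ` which contain `u` to the location `κ'`. -/
def moveAll (C : Conf) (κ u κ' : ℕ) : Conf :=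
  { C with loc := fun f => if f ∈ lst p V C.loc κ u then κ' else C.loc f }

/-- Lower the vertex `y` to level `0`. -/
def drop (C : Conf) (y : ℕ) : Conf :=
  { C.moveAll p V (3 * C.lev y) y 2 with lev := Function.update C.lev y 0 }

/-- Remove `e` from the matching. -/
def unmatch (C : Conf) (e : ℕ) : Conf :=
  { ((V e).tail.foldl (drop p V) C).moveAll p V (3 * e + 1) p.n 2 with
    out := Function.update C.out e 0 }

/-- Remove the hyperedge that covers `x` from the matching. -/
def kick (C : Conf) (x : ℕ) : Conf :=
  if C.lev x = 0 then C else C.unmatch p V (C.mate x)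

/-- Move all hyperedges at the lowest `k` levels which contain `x` to the limbo. -/
def evict (C : Conf) (x : ℕ) : ℕ → Conf
  | 0 => C
  | k + 1 => (evict C x k).moveAll p V (3 * lvl p.r k) x 2

/-- Raise `x` to level `k`, as a vertex of the matched hyperedge `e`. -/
def raise (k e : ℕ) (C : Conf) (x : ℕ) : Conf :=
  { C.evict p V x k with
    lev := Function.update C.lev x (lvl p.r k)
    mate := Function.update C.mate x e }

/-- Match `e` and freeze the hyperedges of level `k` which contain `w` in the sample of `e`. -/
def freeze (C : Conf) (w k e : ℕ) : Conf :=
  { C.moveAll p V (3 * lvl p.r k) w (3 * e + 1) with out := Function.update C.out e 1 }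

/-- Match `e` with all hyperedges of level `k` which contain `w` as its sample. -/
def fix (C : Conf) (w k e : ℕ) : Conf :=
  (V e).tail.foldl (raise p V (k + 1) e) ((V e).tail.foldl (kick p V) (C.freeze p V w k e))

/-- The number of hyperedges in the limbo. -/
def limbo (C : Conf) : ℕ := (lst p V C.loc 2 p.n).card

/-- The sum of the levels of the vertices. -/
def sumLev (C : Conf) : ℕ := ∑ x ∈ Finset.range p.n, C.lev x

/-- The hyperedges which are not in the sample of a hyperedge that is deleted later, where `d` gives
the time of deletion. -/
def lateSet (d : ℕ → ℕ) (C : Conf) : Finset ℕ :=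
  (Finset.range p.m).filter fun f => V f ≠ [] ∧ ¬ ∃ e < p.m, C.loc f = 3 * e + 1 ∧ d f ≤ d e

/-- The number of hyperedges which are not in the sample of a hyperedge that is deleted later. -/
def late (d : ℕ → ℕ) (C : Conf) : ℕ := (lateSet p V d C).card

/-- The invariant of the algorithm, except that the hyperedges in `Q` may be matched
incompletely. -/
structure Inv (Q : ℕ → Prop) (C : Conf) : Prop where
  loc : ∀ f < p.m, V f ≠ [] → C.loc f = 2 ∨
    (∃ k, C.loc f = 3 * lvl p.r k ∧ (∀ x ∈ (V f).tail, C.lev x ≤ lvl p.r k) ∧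
      ∃ x ∈ (V f).tail, C.lev x = lvl p.r k) ∨
    ∃ e < p.m, C.loc f = 3 * e + 1 ∧ C.out e ≠ 0 ∧ ∃ x ∈ (V f).tail, x ∈ (V e).tail
  -- The sample is at most the fraction `1 / (8 r)` of the level of each vertex of `e`. The bounds
  -- on `limbo` and `late` after unmatching use this ratio.
  out : ∀ e < p.m, C.out e ≠ 0 → V e ≠ [] ∧ (¬ Q e → C.loc e = 3 * e + 1 ∧
    ∃ k, (∀ x ∈ (V e).tail, C.lev x = lvl p.r (k + 1) ∧ C.mate x = e) ∧
      (lst p V C.loc (3 * e + 1) p.n).card ≤ lvl p.r k + 1)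
  mate : ∀ x < p.n, C.lev x ≠ 0 → C.mate x < p.m ∧ C.out (C.mate x) ≠ 0 ∧
    x ∈ (V (C.mate x)).tail
  lev : ∀ x < p.n, ∃ k, C.lev x = lvl p.r k

/-- No level contains too many hyperedges at a vertex, not counting the hyperedge `f`. -/
def CapExcept (f : ℕ) (C : Conf) : Prop :=
  ∀ x < p.n, ∀ k, ((lst p V C.loc (3 * lvl p.r k) x).erase f).card ≤ lvl p.r k

/-- No level contains too many hyperedges at a vertex. -/
def Cap (C : Conf) : Prop :=
  ∀ x < p.n, ∀ k, (lst p V C.loc (3 * lvl p.r k) x).card ≤ lvl p.r k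

variable {p V} {C : Conf} {κ κ' u e f : ℕ} {Q : ℕ → Prop} {d : ℕ → ℕ}

theorem mem_lateSet : f ∈ lateSet p V d C ↔
    f < p.m ∧ V f ≠ [] ∧ ¬ ∃ e < p.m, C.loc f = 3 * e + 1 ∧ d f ≤ d e := by
  rw [lateSet, Finset.mem_filter, Finset.mem_range]

/-! ### Moving hyperedges -/

theorem lst_moveAll_of_ne {κ₁ u₁ : ℕ} (h : κ₁ ≠ κ) (h' : κ₁ ≠ κ') :
    lst p V (C.moveAll p V κ u κ').loc κ₁ u₁ = lst p V C.loc κ₁ u₁ := by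
  ext f
  simp only [mem_lst, moveAll]
  split_ifs with hf <;> grind

theorem lst_moveAll_subset {κ₁ u₁ : ℕ} (h' : κ₁ ≠ κ') :
    lst p V (C.moveAll p V κ u κ').loc κ₁ u₁ ⊆ lst p V C.loc κ₁ u₁ := by
  intro f
  simp only [mem_lst, moveAll]
  split_ifs with hf <;> grind

theorem limbo_moveAll (hV : WF p V) (h : κ ≠ 2) :
    (C.moveAll p V κ u 2).limbo p V = C.limbo p V + (lst p V C.loc κ u).card := by
  rw [limbo, limbo, ← Finset.card_union_of_disjoint]
  · congr 1
    ext f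
    simp only [mem_lst, Finset.mem_union, moveAll]
    by_cases hf : f < p.m
    · have := hV.dummy_mem hf
      by_cases hu : u ∈ V f
      · have := this (List.ne_nil_of_mem hu)
        grind
      · grind
    · simp [hf]
  · rw [Finset.disjoint_left]
    intro f
    simp only [mem_lst]
    grind

theorem Cap.moveAll (hC : C.Cap p V) (h : ∀ c, κ' ≠ 3 * c) : (C.moveAll p V κ u κ').Cap p V :=
  fun x hx k => (Finset.card_le_card (lst_moveAll_subset (h _).symm)).trans (hC x hx k)

/-- Any hyperedge may go to the limbo, except a completely matched one, which has to stay in its own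
sample; `hκ` keeps the move away from such samples. -/
theorem Inv.moveAll (hC : C.Inv p V Q)
    (hκ : ∀ e < p.m, C.out e ≠ 0 → ¬ Q e → κ ≠ 3 * e + 1) : (C.moveAll p V κ u 2).Inv p V Q := by
  refine ⟨fun f hf hne => ?_, fun e he ho => ⟨(hC.out e he ho).1, fun hQ => ?_⟩, hC.mate, hC.lev⟩
  · by_cases h : f ∈ lst p V C.loc κ u
    · left
      simp [Conf.moveAll, h]
    · have e : (C.moveAll p V κ u 2).loc f = C.loc f := by simp [Conf.moveAll, h]
      rw [e]
      exact hC.loc f hf hne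
  · obtain ⟨h1, k, h2, h3⟩ := (hC.out e he ho).2 hQ
    have h := hκ e he ho hQ
    refine ⟨?_, k, h2, (Finset.card_le_card (lst_moveAll_subset (by omega))).trans h3⟩
    simp only [Conf.moveAll, mem_lst]
    rw [if_neg (by omega), h1]

theorem Inv.mono {Q' : ℕ → Prop} (hC : C.Inv p V Q) (h : ∀ e, Q e → Q' e) : C.Inv p V Q' :=
  ⟨hC.loc, fun e he ho => ⟨(hC.out e he ho).1, fun hQ => (hC.out e he ho).2 (mt (h e) hQ)⟩,
    hC.mate, hC.lev⟩

/-- Neither `3 * c` nor `2` is of the form `3 * e + 1`: hyperedges at a level and in the limbo are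
late alike. -/
theorem late_moveAll_cross (c : ℕ) : (C.moveAll p V (3 * c) u 2).late p V d = C.late p V d := by
  rw [late, late]
  congr 1
  ext f
  simp only [mem_lateSet, moveAll, mem_lst]
  split_ifs with h
  · refine and_congr_right fun _ => and_congr_right fun _ => not_congr ⟨?_, ?_⟩ <;>
      rintro ⟨e, he, h1, h2⟩ <;> omega
  · rfl

/-- A released hyperedge that is deleted after `e` was late already, so only those with `d f ≤ d e`
can be new. -/
theorem late_moveAll_frozen (e : ℕ) :
    (C.moveAll p V (3 * e + 1) u 2).late p V d ≤
      C.late p V d + ((lst p V C.loc (3 * e + 1) u).filter fun f => d f ≤ d e).card := by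
  rw [late, late]
  refine le_trans (Finset.card_le_card fun f hf => ?_) (Finset.card_union_le _ _)
  simp only [mem_lateSet, Finset.mem_filter, Finset.mem_union] at hf ⊢
  simp only [moveAll] at hf
  obtain ⟨h1, h2, h3⟩ := hf
  by_cases h : f ∈ lst p V C.loc (3 * e + 1) u
  · by_cases h' : d f ≤ d e
    · exact Or.inr ⟨h, h'⟩
    · refine Or.inl ⟨h1, h2, ?_⟩
      rintro ⟨e', he', h4, h5⟩
      have := (mem_lst.1 h).2.1
      obtain rfl : e' = e := by omega
      exact h' h5
  · rw [if_neg h] at h3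
    exact Or.inl ⟨h1, h2, h3⟩

theorem late_congr {C' : Conf} (h : C'.loc = C.loc) : C'.late p V d = C.late p V d := by
  rw [late, late, lateSet, lateSet, h]

/-! ### Lowering vertices -/

/-- A hyperedge can lose its maximum level only if it contains `y` and sits at the level of `y`;
exactly these are moved to the limbo. By `hQ`, no completely matched hyperedge contains `y`. -/
theorem Inv.drop (hC : C.Inv p V Q) {y : ℕ} (hy : y < p.n)
    (hQ : ∀ e < p.m, C.out e ≠ 0 → ¬ Q e → y ∉ (V e).tail) : (C.drop p V y).Inv p V Q := by
  have hM : (C.moveAll p V (3 * C.lev y) y 2).Inv p V Q := hC.moveAll (by omega)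
  refine ⟨fun f hf hne => ?_, fun e he ho => ⟨(hM.out e he ho).1, fun hQe => ?_⟩, ?_, ?_⟩
  · rcases hM.loc f hf hne with h | ⟨k, h1, h2, x, hx, h3⟩ | h
    · exact Or.inl h
    · refine Or.inr (Or.inl ⟨k, h1, fun z hz => ?_, x, hx, ?_⟩)
      · simp only [Conf.drop, Function.update_apply]
        split_ifs
        · exact Nat.zero_le _
        · exact h2 z hz
      · simp only [Conf.drop]
        rw [Function.update_of_ne, ← h3]
        · rfl
        -- If `y` attained the maximum, the hyperedge would have been moved.
        · rintro rfl
          simp only [Conf.moveAll, mem_lst] at h1 h3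
          split_ifs at h1 with h4
          · omega
          · exact h4 ⟨hf, by omega, List.mem_of_mem_tail hx⟩
    · exact Or.inr (Or.inr h)
  · obtain ⟨h1, k, h2, h3⟩ := (hM.out e he ho).2 hQe
    refine ⟨h1, k, fun x hx => ?_, h3⟩
    have : x ≠ y := fun h => hQ e he ho hQe (h ▸ hx)
    simp only [Conf.drop]
    rw [Function.update_of_ne this]
    exact h2 x hx
  · intro x hx hl
    simp only [Conf.drop, Function.update_apply] at hl
    split_ifs at hl
    · exact absurd rfl hl
    · exact hM.mate x hx hl
  · intro x hx
    simp only [Conf.drop, Function.update_apply]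
    split_ifs
    · exact ⟨0, rfl⟩
    · exact hC.lev x hx

theorem sumLev_update {y c : ℕ} (hy : y < p.n) {C' : Conf}
    (h : C'.lev = Function.update C.lev y c) :
    C'.sumLev p + C.lev y = C.sumLev p + c := by
  have hy' : y ∈ Finset.range p.n := Finset.mem_range.2 hy
  rw [sumLev, sumLev, h, Finset.sum_update_of_mem hy',
    ← Finset.add_sum_erase _ _ hy', Finset.sdiff_singleton_eq_erase]
  ring

theorem Cap.drop (hC : C.Cap p V) (y : ℕ) : (C.drop p V y).Cap p V :=
  Cap.moveAll (κ := 3 * C.lev y) (u := y) hC (κ' := 2) (by omega)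

/-- By `Cap`, at most `C.lev y` hyperedges enter the limbo, and the level sum falls by that very
amount. -/
theorem limbo_drop (hV : WF p V) (hcap : C.Cap p V) {y k : ℕ} (hy : y < p.n)
    (hk : C.lev y = lvl p.r k) :
    (C.drop p V y).limbo p V + (C.drop p V y).sumLev p ≤ C.limbo p V + C.sumLev p := by
  have h1 : (C.drop p V y).limbo p V = C.limbo p V + (lst p V C.loc (3 * C.lev y) y).card :=
    limbo_moveAll hV (by omega)
  have h2 := sumLev_update (p := p) (C := C) (C' := C.drop p V y) (c := 0) hy rfl
  have h3 := hcap y hy k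
  rw [← hk] at h3
  omega

theorem late_drop (y : ℕ) : (C.drop p V y).late p V d = C.late p V d :=
  (late_congr rfl).trans (late_moveAll_cross (C.lev y))

theorem lst_drop (y e : ℕ) :
    lst p V (C.drop p V y).loc (3 * e + 1) u = lst p V C.loc (3 * e + 1) u :=
  lst_moveAll_of_ne (by omega) (by omega)

section foldl

variable (l : List ℕ)

theorem foldl_drop_out : (l.foldl (drop p V) C).out = C.out := by
  induction l generalizing C with
  | nil => rfl
  | cons y l ih => rw [List.foldl_cons, ih]; rfl

theorem foldl_drop_mate : (l.foldl (drop p V) C).mate = C.mate := by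
  induction l generalizing C with
  | nil => rfl
  | cons y l ih => rw [List.foldl_cons, ih]; rfl

theorem foldl_drop_lev (x : ℕ) :
    (l.foldl (drop p V) C).lev x = if x ∈ l then 0 else C.lev x := by
  induction l generalizing C with
  | nil => simp
  | cons y l ih =>
    rw [List.foldl_cons, ih]
    simp only [drop, Function.update_apply, List.mem_cons]
    grind

theorem foldl_drop_late : (l.foldl (drop p V) C).late p V d = C.late p V d := by
  induction l generalizing C with
  | nil => rfl
  | cons y l ih => rw [List.foldl_cons, ih, late_drop]

theorem foldl_drop_lst (e : ℕ) :
    lst p V (l.foldl (drop p V) C).loc (3 * e + 1) u = lst p V C.loc (3 * e + 1) u := by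
  induction l generalizing C with
  | nil => rfl
  | cons y l ih => rw [List.foldl_cons, ih, lst_drop]

theorem Cap.foldl_drop (hC : C.Cap p V) : (l.foldl (Conf.drop p V) C).Cap p V := by
  induction l generalizing C with
  | nil => exact hC
  | cons y l ih => exact ih (hC.drop y)

theorem Inv.foldl_drop (hC : C.Inv p V Q) (hl : ∀ y ∈ l, y < p.n)
    (hQ : ∀ y ∈ l, ∀ e < p.m, C.out e ≠ 0 → ¬ Q e → y ∉ (V e).tail) :
    (l.foldl (Conf.drop p V) C).Inv p V Q := by
  induction l generalizing C with
  | nil => exact hC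
  | cons y l ih =>
    exact ih (hC.drop (hl y (by simp)) (hQ y (by simp))) (fun z hz => hl z (by simp [hz]))
      (fun z hz => hQ z (by simp [hz]))

theorem limbo_foldl_drop (hV : WF p V) (hcap : C.Cap p V) (hl : ∀ y ∈ l, y < p.n)
    (hk : ∀ y ∈ l, ∃ k, C.lev y = lvl p.r k) :
    (l.foldl (drop p V) C).limbo p V + (l.foldl (drop p V) C).sumLev p ≤
      C.limbo p V + C.sumLev p := by
  induction l generalizing C with
  | nil => rfl
  | cons y l ih =>
    obtain ⟨k, hky⟩ := hk y (by simp)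
    refine (ih (hcap.drop y) (fun z hz => hl z (by simp [hz])) fun z hz => ?_).trans
      (limbo_drop hV hcap (hl y (by simp)) hky)
    simp only [drop, Function.update_apply]
    split_ifs
    · exact ⟨0, rfl⟩
    · exact hk z (by simp [hz])

theorem sumLev_foldl_drop (hl : ∀ y ∈ l, y < p.n) (hn : l.Nodup) {b : ℕ}
    (hb : ∀ y ∈ l, C.lev y = b) :
    (l.foldl (drop p V) C).sumLev p + l.length * b = C.sumLev p := by
  induction l generalizing C with
  | nil => simp
  | cons y l ih =>
    rw [List.nodup_cons] at hn
    have h2 := sumLev_update (p := p) (C := C) (C' := C.drop p V y) (c := 0) (hl y (by simp)) rfl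
    have := ih (C := C.drop p V y) (fun z hz => hl z (by simp [hz])) hn.2 (fun z hz => by
      have : z ≠ y := fun h => hn.1 (h ▸ hz)
      simp only [drop]
      rw [Function.update_of_ne this]
      exact hb z (by simp [hz]))
    have hy := hb y (by simp)
    rw [List.foldl_cons, List.length_cons]
    linarith

end foldl

/-! ### Removing a hyperedge from the matching -/

section unmatch

variable (hV : WF p V) (hr : 1 < p.r) (hC : C.Inv p V Q) (he : e < p.m) (ho : C.out e ≠ 0)
  (hQ : ¬ Q e)

include hV hC he ho hQ

/-- While its vertices drop, `e` joins the exceptions `Q`; the exception disappears when `out e`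
becomes 0. No other completely matched hyperedge is hurt, because `mate` names only one hyperedge
per vertex. -/
theorem Inv.unmatch : (C.unmatch p V e).Inv p V Q := by
  obtain ⟨hne, hQ'⟩ := hC.out e he ho
  obtain ⟨h1, k, h2, h3⟩ := hQ' hQ
  have hD : ((V e).tail.foldl (Conf.drop p V) C).Inv p V (fun i => Q i ∨ i = e) := by
    refine (hC.mono fun i hi => Or.inl hi).foldl_drop _ (fun y hy => hV.tail_lt he hy) ?_
    rintro y hy i hi hoi hQi hyi
    rw [not_or] at hQi
    obtain ⟨-, k', h2', -⟩ := (hC.out i hi hoi).2 hQi.1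
    exact hQi.2 ((h2' y hyi).2.symm.trans (h2 y hy).2)
  set D := (V e).tail.foldl (Conf.drop p V) C with hDdef
  have hDo : D.out = C.out := foldl_drop_out _
  have hM : (D.moveAll p V (3 * e + 1) p.n 2).Inv p V (fun i => Q i ∨ i = e) := by
    refine hD.moveAll fun i _ _ hi => ?_
    rw [not_or] at hi
    omega
  have hout : ∀ i, i ≠ e → (C.unmatch p V e).out i = D.out i := fun i hi => by
    rw [hDo]
    exact Function.update_of_ne hi _ _
  have houte : (C.unmatch p V e).out e = 0 := Function.update_self _ _ _
  refine ⟨fun f hf hne' => ?_, fun i hi hoi => ?_, fun x hx hl => ?_, hM.lev⟩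
  · rcases hM.loc f hf hne' with h | h | ⟨i, hi, h4, h5, h6⟩
    · exact Or.inl h
    · exact Or.inr (Or.inl h)
    · refine Or.inr (Or.inr ⟨i, hi, h4, ?_, h6⟩)
      rw [hout]
      · exact h5
      · rintro rfl
        simp only [Conf.moveAll, mem_lst] at h4
        split_ifs at h4 with h7
        · omega
        -- The list of the dummy vertex contains the entire sample, so nothing stays frozen with
        -- `e`.
        · exact h7 ⟨hf, h4, hV.dummy_mem hf hne'⟩
  · have hie : i ≠ e := fun h => hoi (h ▸ houte)
    rw [hout i hie] at hoi
    obtain ⟨g1, g2⟩ := hM.out i hi hoi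
    exact ⟨g1, fun hQi => g2 (by tauto)⟩
  · obtain ⟨g1, g2, g3⟩ := hM.mate x hx hl
    refine ⟨g1, ?_, g3⟩
    have : D.mate x ≠ e := by
      intro hm
      have hx' : x ∈ (V e).tail := by
        change x ∈ (V (D.mate x)).tail at g3
        rwa [hm] at g3
      have : D.lev x = 0 := by rw [hDdef, foldl_drop_lev, if_pos hx']
      exact hl this
    change (C.unmatch p V e).out (D.mate x) ≠ 0
    rw [hout _ this]
    exact g2

omit hV hC he ho hQ in
theorem Cap.unmatch (hcap : C.Cap p V) (e : ℕ) : (C.unmatch p V e).Cap p V :=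
  Cap.moveAll (hcap.foldl_drop (V e).tail) (κ := 3 * e + 1) (u := p.n) (κ' := 2) (by omega)

omit hV hC he ho hQ in
theorem unmatch_lev (x : ℕ) :
    (C.unmatch p V e).lev x = if x ∈ (V e).tail then 0 else C.lev x :=
  foldl_drop_lev _ _

omit hV hC he ho hQ in
theorem unmatch_mate : (C.unmatch p V e).mate = C.mate := foldl_drop_mate _

omit hV hC he ho hQ in
theorem unmatch_lst {e' : ℕ} (h : e' ≠ e) :
    lst p V (C.unmatch p V e).loc (3 * e' + 1) u = lst p V C.loc (3 * e' + 1) u :=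
  (lst_moveAll_of_ne (by omega) (by omega)).trans (foldl_drop_lst _ _)

include hr in
-- The fall of the level sum is spent twice, whence the factor 2: once on the hyperedges sent away
-- from the levels (`limbo_foldl_drop`), and once on the sample, which is no larger than the level
-- of a single vertex of `e`.
theorem unmatch_potential (hcap : C.Cap p V) :
    (C.unmatch p V e).limbo p V + 2 * (C.unmatch p V e).sumLev p ≤
      C.limbo p V + 2 * C.sumLev p ∧ (C.unmatch p V e).sumLev p < C.sumLev p := by
  obtain ⟨hne, hQ'⟩ := hC.out e he ho
  obtain ⟨h1, k, h2, h3⟩ := hQ' hQ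
  have hlt : ∀ y ∈ (V e).tail, y < p.n := fun y hy => hV.tail_lt he hy
  have a1 := limbo_foldl_drop (C := C) (V e).tail hV hcap hlt fun y hy => ⟨_, (h2 y hy).1⟩
  have a2 := sumLev_foldl_drop (C := C) (p := p) (V := V) (V e).tail hlt (hV.tail_nodup he)
    fun y hy => (h2 y hy).1
  have a3 : (C.unmatch p V e).limbo p V = _ := limbo_moveAll (κ := 3 * e + 1) (u := p.n)
    (C := (V e).tail.foldl (drop p V) C) hV (by omega)
  rw [foldl_drop_lst] at a3
  have a4 : (C.unmatch p V e).sumLev p = ((V e).tail.foldl (drop p V) C).sumLev p := rfl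
  have a5 : 1 ≤ (V e).tail.length := List.length_pos_iff.2 (hV.tail_ne_nil he hne)
  have a6 : lvl p.r k + 1 ≤ lvl p.r (k + 1) := by
    have := lvl_succ_ge hr k
    omega
  have a7 : lvl p.r (k + 1) ≤ (V e).tail.length * lvl p.r (k + 1) := Nat.le_mul_of_pos_left _ a5
  omega

theorem unmatch_sumLev {b : ℕ} (hb : ∀ y ∈ (V e).tail, C.lev y ≤ b) :
    C.sumLev p ≤ (C.unmatch p V e).sumLev p + p.r * b := by
  obtain ⟨hne, hQ'⟩ := hC.out e he ho
  obtain ⟨h1, k, h2, h3⟩ := hQ' hQ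
  have a2 := sumLev_foldl_drop (C := C) (p := p) (V := V) (V e).tail
    (fun y hy => hV.tail_lt he hy) (hV.tail_nodup he) fun y hy => (h2 y hy).1
  have a4 : (C.unmatch p V e).sumLev p = ((V e).tail.foldl (drop p V) C).sumLev p := rfl
  obtain ⟨y, hy⟩ := List.exists_mem_of_ne_nil _ (hV.tail_ne_nil he hne)
  have := hb y hy
  rw [(h2 y hy).1] at this
  have := Nat.mul_le_mul (hV.length_tail_le he) this
  omega

omit hV hC he ho hQ in
theorem unmatch_late (e : ℕ) : (C.unmatch p V e).late p V d ≤
    C.late p V d + ((lst p V C.loc (3 * e + 1) p.n).filter fun f => d f ≤ d e).card := by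
  have := late_moveAll_frozen (p := p) (V := V) (d := d) (u := p.n)
    (C := (V e).tail.foldl (drop p V) C) e
  rw [foldl_drop_late, foldl_drop_lst] at this
  exact this

omit hV in
-- At worst the whole sample becomes late, and `8 r` times its size is at most the level of `x`.
theorem unmatch_late' {x : ℕ} (hx : x ∈ (V e).tail) : 8 * p.r * (C.unmatch p V e).late p V d ≤
    8 * p.r * C.late p V d + C.lev x := by
  obtain ⟨hne, hQ'⟩ := hC.out e he ho
  obtain ⟨h1, k, h2, h3⟩ := hQ' hQ
  have a1 := unmatch_late (p := p) (V := V) (d := d) (C := C) e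
  have a2 := (Finset.card_filter_le (lst p V C.loc (3 * e + 1) p.n) fun f => d f ≤ d e).trans h3
  rw [(h2 x hx).1, lvl, ← mul_add]
  exact Nat.mul_le_mul_left _ (a1.trans (by omega))

end unmatch

end Conf

end DynMatch

namespace DynMatch

namespace Conf

variable {p : Params} {V : ℕ → List ℕ} {C : Conf} {κ κ' u e f : ℕ} {Q : ℕ → Prop} {d : ℕ → ℕ}

/-! ### Kicking out hyperedges -/

theorem kick_eq {x : ℕ} (h : C.lev x ≠ 0) : C.kick p V x = C.unmatch p V (C.mate x) := if_neg h

theorem kick_eq_self {x : ℕ} (h : C.lev x = 0) : C.kick p V x = C := if_pos h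

/-- What holds while the hyperedges that meet `e` are kicked out. -/
structure Kicking (p : Params) (V : ℕ → List ℕ) (e : ℕ) (C : Conf) : Prop where
  inv : C.Inv p V (· = e)
  cap : C.Cap p V
  mate : ∀ x < p.n, C.lev x ≠ 0 → C.mate x ≠ e

section kick

variable {x : ℕ}

theorem Kicking.mate_spec (h : C.Kicking p V e) (hx : x < p.n) (hl : C.lev x ≠ 0) :
    C.mate x < p.m ∧ V (C.mate x) ≠ [] ∧ C.out (C.mate x) ≠ 0 ∧ C.mate x ≠ e ∧
      x ∈ (V (C.mate x)).tail :=
  have h1 := h.inv.mate x hx hl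
  ⟨h1.1, (h.inv.out _ h1.1 h1.2.1).1, h1.2.1, h.mate x hx hl, h1.2.2⟩

variable (hV : WF p V) (h : C.Kicking p V e) (hx : x < p.n)

include hV h hx

theorem Kicking.kick : (C.kick p V x).Kicking p V e := by
  by_cases hl : C.lev x = 0
  · rwa [kick_eq_self hl]
  · obtain ⟨h1, h2, h3, h4, h5⟩ := h.mate_spec hx hl
    rw [kick_eq hl]
    refine ⟨h.inv.unmatch hV h1 h3 h4, h.cap.unmatch _, fun y hy hly => ?_⟩
    rw [unmatch_mate]
    refine h.mate y hy fun h0 => hly ?_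
    rw [unmatch_lev, h0, ite_self]

omit hV h hx in
theorem kick_lev_le (y : ℕ) : (C.kick p V x).lev y ≤ C.lev y := by
  by_cases hl : C.lev x = 0
  · rw [kick_eq_self hl]
  · rw [kick_eq hl, unmatch_lev]
    split_ifs <;> omega

omit hV in
theorem kick_lev_self : (C.kick p V x).lev x = 0 := by
  by_cases hl : C.lev x = 0
  · rwa [kick_eq_self hl]
  · rw [kick_eq hl, unmatch_lev, if_pos (h.mate_spec hx hl).2.2.2.2]

omit hV in
theorem kick_lst : lst p V (C.kick p V x).loc (3 * e + 1) u = lst p V C.loc (3 * e + 1) u := by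
  by_cases hl : C.lev x = 0
  · rw [kick_eq_self hl]
  · rw [kick_eq hl, unmatch_lst (h.mate_spec hx hl).2.2.2.1.symm]

omit hV in
theorem kick_out : (C.kick p V x).out e = C.out e := by
  by_cases hl : C.lev x = 0
  · rw [kick_eq_self hl]
  · rw [kick_eq hl]
    exact Function.update_of_ne (h.mate_spec hx hl).2.2.2.1.symm _ _

theorem kick_potential (hr : 1 < p.r) :
    (C.kick p V x).limbo p V + 2 * (C.kick p V x).sumLev p ≤ C.limbo p V + 2 * C.sumLev p := by
  by_cases hl : C.lev x = 0
  · rw [kick_eq_self hl]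
  · obtain ⟨h1, h2, h3, h4, h5⟩ := h.mate_spec hx hl
    rw [kick_eq hl]
    exact (unmatch_potential hV hr h.inv h1 h3 h4 h.cap).1

/-- The at most `r` vertices of the kicked hyperedge all have the level of `x`. -/
theorem kick_sumLev : C.sumLev p ≤ (C.kick p V x).sumLev p + p.r * C.lev x := by
  by_cases hl : C.lev x = 0
  · rw [kick_eq_self hl]
    omega
  · obtain ⟨h1, h2, h3, h4, h5⟩ := h.mate_spec hx hl
    rw [kick_eq hl]
    refine unmatch_sumLev hV h.inv h1 h3 h4 fun y hy => ?_
    obtain ⟨-, k, h6, -⟩ := (h.inv.out _ h1 h3).2 h4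
    rw [(h6 y hy).1, (h6 x h5).1]

omit hV in
theorem kick_late : 8 * p.r * (C.kick p V x).late p V d ≤
    8 * p.r * C.late p V d + C.lev x := by
  by_cases hl : C.lev x = 0
  · rw [kick_eq_self hl]
    omega
  · obtain ⟨h1, h2, h3, h4, h5⟩ := h.mate_spec hx hl
    rw [kick_eq hl]
    exact unmatch_late' h.inv h1 h3 h4 h5

end kick

/-- Kicking never raises a level, so the bound `c` stays valid and the losses of the single kicks
add up. The sample of `e` itself is untouched, because no mate is `e` yet. -/
theorem Kicking.foldl_kick (hV : WF p V) (h : C.Kicking p V e) (hr : 1 < p.r) {l : List ℕ}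
    (hl : ∀ x ∈ l, x < p.n) {c : ℕ} (hc : ∀ x ∈ l, C.lev x ≤ c) :
    (l.foldl (Conf.kick p V) C).Kicking p V e ∧
    (∀ y, (l.foldl (Conf.kick p V) C).lev y ≤ C.lev y) ∧
    (∀ y ∈ l, (l.foldl (Conf.kick p V) C).lev y = 0) ∧
    (∀ u, lst p V (l.foldl (Conf.kick p V) C).loc (3 * e + 1) u = lst p V C.loc (3 * e + 1) u) ∧
    (l.foldl (Conf.kick p V) C).out e = C.out e ∧
    (l.foldl (Conf.kick p V) C).limbo p V + 2 * (l.foldl (Conf.kick p V) C).sumLev p ≤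
      C.limbo p V + 2 * C.sumLev p ∧
    C.sumLev p ≤ (l.foldl (Conf.kick p V) C).sumLev p + l.length * (p.r * c) ∧
    8 * p.r * (l.foldl (Conf.kick p V) C).late p V d ≤
      8 * p.r * C.late p V d + l.length * c := by
  induction l generalizing C with
  | nil => simpa using h
  | cons x l ih =>
    have hx := hl x (by simp)
    have hcx := hc x (by simp)
    obtain ⟨i1, i2, i3, i4, i5, i6, i7, i8⟩ := ih (h.kick hV hx) (fun y hy => hl y (by simp [hy]))
      fun y hy => (kick_lev_le y).trans (hc y (by simp [hy]))
    have k6 := kick_potential hV h hx hr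
    have k7 := kick_sumLev hV h hx
    have k8 := kick_late (d := d) h hx
    have k9 : p.r * C.lev x ≤ p.r * c := Nat.mul_le_mul_left _ hcx
    rw [List.foldl_cons, List.length_cons]
    refine ⟨i1, fun y => (i2 y).trans (kick_lev_le y), fun y hy => ?_,
      fun u => (i4 u).trans (kick_lst h hx), i5.trans (kick_out h hx), i6.trans k6, ?_, ?_⟩
    · rcases List.mem_cons.1 hy with rfl | hy
      · have := i2 y
        rw [kick_lev_self h hx] at this
        omega
      · exact i3 y hy
    · rw [add_mul, one_mul]
      omega
    · rw [add_mul, one_mul]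
      omega

/-! ### Raising vertices -/

section evict

variable {x : ℕ}

theorem Inv.evict (h : C.Inv p V Q) (k : ℕ) : (C.evict p V x k).Inv p V Q := by
  induction k with
  | zero => exact h
  | succ k ih => exact ih.moveAll (by omega)

theorem Cap.evict (h : C.Cap p V) (k : ℕ) : (C.evict p V x k).Cap p V := by
  induction k with
  | zero => exact h
  | succ k ih => exact ih.moveAll (by omega)

theorem evict_late (k : ℕ) : (C.evict p V x k).late p V d = C.late p V d := by
  induction k with
  | zero => rfl
  | succ k ih => exact (late_moveAll_cross _).trans ih

theorem evict_lst (k : ℕ) :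
    lst p V (C.evict p V x k).loc (3 * e + 1) u = lst p V C.loc (3 * e + 1) u := by
  induction k with
  | zero => rfl
  | succ k ih => exact (lst_moveAll_of_ne (by omega) (by omega)).trans ih

theorem evict_lev (k : ℕ) : (C.evict p V x k).lev = C.lev := by
  induction k with
  | zero => rfl
  | succ k ih => exact ih

theorem evict_mate (k : ℕ) : (C.evict p V x k).mate = C.mate := by
  induction k with
  | zero => rfl
  | succ k ih => exact ih

theorem evict_out (k : ℕ) : (C.evict p V x k).out = C.out := by
  induction k with
  | zero => rfl
  | succ k ih => exact ih

/-- A geometric sum: what was evicted before and the next list are each at most `lvl p.r k`. -/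
theorem evict_limbo (hV : WF p V) (hr : 1 < p.r) (h : C.Cap p V) (hx : x < p.n) (k : ℕ) :
    (C.evict p V x k).limbo p V ≤ C.limbo p V + lvl p.r k := by
  induction k with
  | zero => exact Nat.le_add_right _ _
  | succ k ih =>
    have h1 := h.evict (x := x) k x hx k
    have h2 := lvl_succ_ge hr k
    rw [evict, limbo_moveAll hV (by omega)]
    omega

theorem evict_lst_eq_empty (k : ℕ) {j : ℕ} (hj : j < k) :
    lst p V (C.evict p V x k).loc (3 * lvl p.r j) x = ∅ := by
  induction k with
  | zero => omega
  | succ k ih =>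
    by_cases h : j = k
    · subst h
      ext f
      simp only [mem_lst, Finset.notMem_empty, iff_false, evict, moveAll]
      split_ifs with h1
      · omega
      · rintro ⟨a, b, c⟩
        exact h1 ⟨a, b, c⟩
    · exact Finset.subset_empty.1 ((lst_moveAll_subset (by omega)).trans (ih (by omega)).subset)

end evict

section raise

variable {x k : ℕ}

/-- After the eviction, a hyperedge that contains `x` and sits at a level is at least at the new
level of `x`. Its maximum is attained at another vertex, since `x` had level 0. -/
theorem Inv.raise (hr : 1 < p.r) (hC : C.Inv p V (· = e)) (he : e < p.m) (ho : C.out e ≠ 0)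
    (hxe : x ∈ (V e).tail) (hl : C.lev x = 0) :
    (C.raise p V (k + 1) e x).Inv p V (· = e) := by
  have hE := hC.evict (x := x) (k + 1)
  have hlev : ∀ y, y ≠ x → (C.raise p V (k + 1) e x).lev y = C.lev y := fun y hy =>
    Function.update_of_ne hy _ _
  have hmate : ∀ y, y ≠ x → (C.raise p V (k + 1) e x).mate y = C.mate y := fun y hy =>
    Function.update_of_ne hy _ _
  have hlevx : (C.raise p V (k + 1) e x).lev x = lvl p.r (k + 1) := Function.update_self _ _ _
  have hmatex : (C.raise p V (k + 1) e x).mate x = e := Function.update_self _ _ _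
  have hout : (C.raise p V (k + 1) e x).out = C.out := evict_out _
  refine ⟨fun f hf hne => ?_, fun i hi hoi => ⟨(hE.out i hi (by rwa [evict_out, ← hout])).1,
    fun hie => ?_⟩, fun y hy hly => ?_, fun y hy => ?_⟩
  · rw [hout]
    rcases hE.loc f hf hne with h | ⟨j, h1, h2, y, hy, h3⟩ | h
    · exact Or.inl h
    · rw [evict_lev] at h2 h3
      by_cases hxf : x ∈ (V f).tail
      · have hjk : k + 1 ≤ j := by
          by_contra hcon
          have := evict_lst_eq_empty (C := C) (V := V) (p := p) (x := x) (k + 1) (j := j) (by omega)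
          have hf' : f ∈ lst p V (C.evict p V x (k + 1)).loc (3 * lvl p.r j) x :=
            mem_lst.2 ⟨hf, h1, List.mem_of_mem_tail hxf⟩
          rw [this] at hf'
          exact absurd hf' (Finset.notMem_empty _)
        have hjl := (lvl_strictMono hr).monotone hjk
        refine Or.inr (Or.inl ⟨j, h1, fun z hz => ?_, y, hy, ?_⟩)
        · by_cases hzx : z = x
          · rwa [hzx, hlevx]
          · rw [hlev z hzx]
            exact h2 z hz
        · rw [hlev, h3]
          rintro rfl
          have := lvl_succ_ge hr k
          omega
      · refine Or.inr (Or.inl ⟨j, h1, fun z hz => ?_, y, hy, ?_⟩)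
        · rw [hlev z fun h => hxf (h ▸ hz)]
          exact h2 z hz
        · rwa [hlev y fun h => hxf (h ▸ hy)]
    · rw [evict_out] at h
      exact Or.inr (Or.inr h)
  · rw [hout] at hoi
    obtain ⟨h1, j, h2, h3⟩ := (hE.out i hi (by rwa [evict_out])).2 hie
    rw [evict_lev, evict_mate] at h2
    refine ⟨h1, j, fun y hy => ?_, h3⟩
    have hyx : y ≠ x := by
      rintro rfl
      have := (h2 y hy).1
      have := lvl_succ_ge hr j
      omega
    rw [hlev y hyx, hmate y hyx]
    exact h2 y hy
  · rw [hout]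
    by_cases hyx : y = x
    · rw [hyx, hmatex]
      exact ⟨he, ho, hxe⟩
    · rw [hlev y hyx] at hly
      rw [hmate y hyx]
      exact hC.mate y hy hly
  · by_cases hyx : y = x
    · exact ⟨k + 1, hyx ▸ hlevx⟩
    · rw [hlev y hyx]
      exact hC.lev y hy

theorem Cap.raise (h : C.Cap p V) : (C.raise p V k e x).Cap p V := h.evict k

theorem foldl_raise (hV : WF p V) (hr : 1 < p.r) (hC : C.Inv p V (· = e)) (hcap : C.Cap p V)
    (he : e < p.m) (ho : C.out e ≠ 0) {l : List ℕ} (hle : ∀ x ∈ l, x ∈ (V e).tail) (hn : l.Nodup)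
    (hl : ∀ x ∈ l, C.lev x = 0) :
    (l.foldl (raise p V (k + 1) e) C).Inv p V (· = e) ∧
    (l.foldl (raise p V (k + 1) e) C).Cap p V ∧
    (∀ y, (l.foldl (raise p V (k + 1) e) C).lev y =
      if y ∈ l then lvl p.r (k + 1) else C.lev y) ∧
    (∀ y, (l.foldl (raise p V (k + 1) e) C).mate y = if y ∈ l then e else C.mate y) ∧
    (∀ u, lst p V (l.foldl (raise p V (k + 1) e) C).loc (3 * e + 1) u =
      lst p V C.loc (3 * e + 1) u) ∧
    (l.foldl (raise p V (k + 1) e) C).limbo p V ≤ C.limbo p V + l.length * lvl p.r (k + 1) ∧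
    (l.foldl (raise p V (k + 1) e) C).sumLev p = C.sumLev p + l.length * lvl p.r (k + 1) ∧
    (l.foldl (raise p V (k + 1) e) C).late p V d = C.late p V d := by
  induction l generalizing C with
  | nil => simpa using ⟨hC, hcap⟩
  | cons x l ih =>
    rw [List.nodup_cons] at hn
    have hx := hle x (by simp)
    have hxn := hV.tail_lt he hx
    have hlx := hl x (by simp)
    obtain ⟨i1, i2, i3, i4, i5, i6, i7, i8⟩ := ih (hC.raise hr he ho hx hlx (k := k)) hcap.raise
      (by rw [raise, evict_out]; exact ho) (fun y hy => hle y (by simp [hy])) hn.2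
      (fun y hy => by
        have : y ≠ x := fun h => hn.1 (h ▸ hy)
        rw [raise, ← hl y (by simp [hy])]
        exact Function.update_of_ne this _ _)
    have e1 := evict_limbo hV hr hcap hxn (k + 1)
    have e2 := sumLev_update (p := p) (C := C) (C' := C.raise p V (k + 1) e x)
      (c := lvl p.r (k + 1)) hxn rfl
    rw [List.foldl_cons, List.length_cons]
    refine ⟨i1, i2, fun y => ?_, fun y => ?_, fun u => (i5 u).trans (evict_lst _), ?_, ?_,
      i8.trans ((late_congr rfl).trans (evict_late (x := x) (k + 1)))⟩
    · rw [i3]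
      simp only [raise, Function.update_apply, List.mem_cons]
      grind
    · rw [i4]
      simp only [raise, Function.update_apply, List.mem_cons]
      grind
    · rw [add_mul, one_mul]
      change _ ≤ (C.evict p V x (k + 1)).limbo p V + _ at i6
      omega
    · rw [add_mul, one_mul]
      omega

end raise

/-! ### Matching a hyperedge -/

section fix

variable {w k : ℕ} (hV : WF p V) (hr : 1 < p.r) (hC : C.Inv p V fun _ => False)
  (hcap : C.CapExcept p V f) (hw : w < p.n) (hf : f ∈ lst p V C.loc (3 * lvl p.r k) w)
  (hS : (lst p V C.loc (3 * lvl p.r k) w).card = lvl p.r k + 1)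
  (he : e ∈ lst p V C.loc (3 * lvl p.r k) w)

include hC he in
theorem freeze_lev {x : ℕ} (hx : x ∈ (V e).tail) : C.lev x ≤ lvl p.r k := by
  obtain ⟨h1, h2, h3⟩ := mem_lst.1 he
  rcases hC.loc e h1 (List.ne_nil_of_mem h3) with h | ⟨j, h4, h5, -⟩ | ⟨i, -, h, -⟩
  · omega
  · have := h5 x hx
    omega
  · omega

include hC he in
theorem out_eq_zero : C.out e = 0 := by
  obtain ⟨h1, h2, h3⟩ := mem_lst.1 he
  by_contra ho
  have := ((hC.out e h1 ho).2 id).1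
  omega

include hC he in
-- Only matched hyperedges have frozen ones, and `e`, being at a level, is not matched. So the new
-- sample consists of nothing but the hyperedges frozen now.
theorem lst_frozen_eq_empty : lst p V C.loc (3 * e + 1) u = ∅ := by
  ext g
  simp only [Finset.notMem_empty, iff_false, mem_lst]
  rintro ⟨h1, h2, h3⟩
  rcases hC.loc g h1 (List.ne_nil_of_mem h3) with h | ⟨j, h4, -⟩ | ⟨i, -, h4, h5, -⟩
  · omega
  · omega
  · obtain rfl : e = i := by omega
    exact h5 (out_eq_zero hC he)

include hV hC he in
theorem lst_freeze : lst p V (C.freeze p V w k e).loc (3 * e + 1) p.n =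
    lst p V C.loc (3 * lvl p.r k) w := by
  have h0 := lst_frozen_eq_empty (u := p.n) hC he
  ext g
  simp only [mem_lst, freeze, moveAll]
  constructor
  · rintro ⟨h1, h2, h3⟩
    split_ifs at h2 with h4
    · exact h4
    · have : g ∈ lst p V C.loc (3 * e + 1) p.n := mem_lst.2 ⟨h1, h2, h3⟩
      rw [h0] at this
      exact absurd this (Finset.notMem_empty _)
  · rintro h
    rw [if_pos h]
    exact ⟨h.1, rfl, hV.dummy_mem h.1 (List.ne_nil_of_mem h.2.2)⟩

include hcap hf in
-- The only hyperedge that could violate the capacities is `f`, and it is frozen with the others.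
theorem Cap.freeze : (C.freeze p V w k e).Cap p V := by
  intro x hx j
  refine le_trans (Finset.card_le_card ?_) (hcap x hx j)
  intro g hg
  have hg' := lst_moveAll_subset (κ' := 3 * e + 1) (by omega) hg
  refine Finset.mem_erase.2 ⟨?_, hg'⟩
  rintro rfl
  simp only [mem_lst, Conf.freeze, Conf.moveAll] at hg
  rw [if_pos (mem_lst.1 hf)] at hg
  omega

include hV hC hw he hcap hf in
-- All frozen hyperedges meet `e` in `w`. No matched hyperedge is among them, since those lie in
-- their own samples and not at a level.
theorem Kicking.freeze : (C.freeze p V w k e).Kicking p V e := by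
  have h0 := out_eq_zero hC he
  have h1 := lst_frozen_eq_empty (u := p.n) hC he
  have hwe : w ∈ (V e).tail := hV.mem_tail (mem_lst.1 he).1 (mem_lst.1 he).2.2 hw
  have hout : ∀ i, i ≠ e → (C.freeze p V w k e).out i = C.out i := fun i hi =>
    Function.update_of_ne hi _ _
  have houte : (C.freeze p V w k e).out e = 1 := Function.update_self _ _ _
  have hne : ∀ {i}, C.out i ≠ 0 → i ≠ e := by
    rintro i hi rfl
    exact hi h0
  refine ⟨⟨fun g hg hgn => ?_, fun i hi hoi => ?_, fun x hx hl => ?_, hC.lev⟩,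
    Cap.freeze hcap hf, fun x hx hl => hne (hC.mate x hx hl).2.1⟩
  · by_cases hgw : g ∈ lst p V C.loc (3 * lvl p.r k) w
    · refine Or.inr (Or.inr ⟨e, (mem_lst.1 he).1, if_pos hgw, ?_, w, ?_, hwe⟩)
      · rw [houte]
        exact one_ne_zero
      · exact hV.mem_tail hg (mem_lst.1 hgw).2.2 hw
    · have e1 : (C.freeze p V w k e).loc g = C.loc g := if_neg hgw
      rw [e1]
      rcases hC.loc g hg hgn with h | h | ⟨i, h2, h3, h4, h5⟩
      · exact Or.inl h
      · exact Or.inr (Or.inl h)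
      · exact Or.inr (Or.inr ⟨i, h2, h3, by rwa [hout i (hne h4)], h5⟩)
  · by_cases hie : i = e
    · subst hie
      exact ⟨List.ne_nil_of_mem (mem_lst.1 he).2.2, fun h => absurd rfl h⟩
    · rw [hout i hie] at hoi
      obtain ⟨h2, h3⟩ := hC.out i hi hoi
      obtain ⟨h4, j, h5, h6⟩ := h3 id
      refine ⟨h2, fun _ => ⟨?_, j, h5, (Finset.card_le_card
        (lst_moveAll_subset (by omega))).trans h6⟩⟩
      simp only [Conf.freeze, Conf.moveAll, mem_lst]
      rw [if_neg (by omega), h4]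
  · obtain ⟨h2, h3, h4⟩ := hC.mate x hx hl
    exact ⟨h2, by rwa [← hout _ (hne h3)] at h3, h4⟩

theorem limbo_freeze : (C.freeze p V w k e).limbo p V = C.limbo p V := by
  rw [limbo, limbo]
  congr 1
  exact lst_moveAll_of_ne (by omega) (by omega)

/-- All of the sample was late before, being at a level; precisely those with `d g ≤ d e` cease to
be. -/
theorem late_freeze (he : e < p.m) : (C.freeze p V w k e).late p V d +
    ((lst p V C.loc (3 * lvl p.r k) w).filter fun g => d g ≤ d e).card = C.late p V d := by
  rw [late, late, ← Finset.card_union_of_disjoint]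
  · congr 1
    ext g
    simp only [Finset.mem_union, Finset.mem_filter, mem_lateSet, freeze, moveAll]
    by_cases hg : g ∈ lst p V C.loc (3 * lvl p.r k) w
    · obtain ⟨h1, h2, h3⟩ := mem_lst.1 hg
      have hgn := List.ne_nil_of_mem h3
      simp only [hg, if_true, h1, hgn, true_and, ne_eq, not_false_eq_true, h2]
      have e1 : (∃ i < p.m, 3 * e + 1 = 3 * i + 1 ∧ d g ≤ d i) ↔ d g ≤ d e := by
        constructor
        · rintro ⟨i, -, h4, h5⟩
          obtain rfl : e = i := by omega
          exact h5
        · exact fun h => ⟨e, he, rfl, h⟩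
      have e2 : ¬ ∃ i < p.m, 3 * lvl p.r k = 3 * i + 1 ∧ d g ≤ d i := by
        rintro ⟨i, -, h4, -⟩
        omega
      rw [e1]
      simp only [e2, not_false_eq_true, iff_true]
      exact (em _).symm
    · simp [hg]
  · rw [Finset.disjoint_left]
    intro g
    simp only [Finset.mem_filter, mem_lateSet, freeze, moveAll]
    rintro ⟨-, -, h1⟩ ⟨h2, h3⟩
    rw [if_pos h2] at h1
    exact h1 ⟨e, he, rfl, h3⟩

include hV hr hC hcap hw hf hS he

/-- Write `s = lvl r k + 1`. Raising adds at most `r * 8 r s` to the level sum and to the limbo.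
Kicking loses at most `r ^ 2 s` of the level sum, hence feeds at most `2 r ^ 2 s` into the limbo,
which makes `10 r ^ 2 s`. The level sum grows strictly because each vertex gains `8 r s`, more than
the `r * lvl r k` that its kick can cost; termination needs this. At most `r` kicks, each releasing
at most `lvl r k / (8 r)` hyperedges, account for the last term in the bound on `late`. -/
theorem fix_spec : (C.fix p V w k e).Inv p V (fun _ => False) ∧ (C.fix p V w k e).Cap p V ∧
    (C.fix p V w k e).limbo p V ≤ C.limbo p V + 10 * p.r ^ 2 * (lvl p.r k + 1) ∧
    C.sumLev p < (C.fix p V w k e).sumLev p ∧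
    (C.fix p V w k e).sumLev p ≤ C.sumLev p + 8 * p.r ^ 2 * (lvl p.r k + 1) ∧
    8 * ((C.fix p V w k e).late p V d +
      ((lst p V C.loc (3 * lvl p.r k) w).filter fun g => d g ≤ d e).card) ≤
        8 * C.late p V d + (lvl p.r k + 1) ∧
    (∀ x, (C.fix p V w k e).lev x ≤ max (C.lev x) (lvl p.r (k + 1))) ∧
    (∀ x, ((V e).tail.foldl (kick p V) (C.freeze p V w k e)).lev x ≤ C.lev x) := by
  obtain ⟨hem, hel, hew⟩ := mem_lst.1 he
  have hen := List.ne_nil_of_mem hew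
  have hlt : ∀ x ∈ (V e).tail, x < p.n := fun x hx => hV.tail_lt hem hx
  have hK := Kicking.freeze (e := e) hV hC hcap hw hf he
  obtain ⟨a1, a2, a3, a4, a5, a6, a7, a8⟩ := hK.foldl_kick (d := d) hV hr hlt (c := lvl p.r k)
    fun x hx => freeze_lev hC he hx
  set D := (V e).tail.foldl (kick p V) (C.freeze p V w k e) with hD
  have ho : D.out e ≠ 0 := by
    rw [a5]
    simp [freeze]
  obtain ⟨b1, b2, b3, b4, b5, b6, b7, b8⟩ := foldl_raise (d := d) (k := k) hV hr a1.inv a1.cap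
    hem ho (fun x hx => hx) (hV.tail_nodup hem) a3
  have hfix : C.fix p V w k e = (V e).tail.foldl (raise p V (k + 1) e) D := rfl
  rw [← hfix] at b1 b2 b3 b4 b5 b6 b7 b8
  have c1 := late_freeze (V := V) (C := C) (w := w) (k := k) (d := d) hem
  have c2 : (C.freeze p V w k e).sumLev p = C.sumLev p := rfl
  have c3 := limbo_freeze (p := p) (V := V) (C := C) (w := w) (k := k) (e := e)
  have hlen := hV.length_tail_le hem
  have hpos : 1 ≤ (V e).tail.length := List.length_pos_iff.2 (hV.tail_ne_nil hem hen)
  have hlst : lst p V (C.fix p V w k e).loc (3 * e + 1) p.n =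
      lst p V C.loc (3 * lvl p.r k) w := by
    rw [b5, a4, lst_freeze hV hC he]
  rw [c2] at a6 a7
  rw [c3] at a6
  have hlvl : lvl p.r (k + 1) = 8 * p.r * (lvl p.r k + 1) := rfl
  have m1 : (V e).tail.length * (p.r * lvl p.r k) ≤ p.r * (p.r * lvl p.r k) :=
    Nat.mul_le_mul_right _ hlen
  have m2 : (V e).tail.length * lvl p.r (k + 1) ≤ p.r * lvl p.r (k + 1) :=
    Nat.mul_le_mul_right _ hlen
  have m4 : p.r * lvl p.r (k + 1) = 8 * (p.r ^ 2 * (lvl p.r k + 1)) := by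
    rw [hlvl]
    ring
  have m5 : p.r * (p.r * lvl p.r k) ≤ p.r ^ 2 * (lvl p.r k + 1) := by
    rw [← mul_assoc, ← sq]
    exact Nat.mul_le_mul_left _ (Nat.le_succ _)
  have m6 : D.sumLev p ≤ C.sumLev p := Finset.sum_le_sum fun x _ => a2 x
  simp only [mul_assoc]
  refine ⟨⟨b1.loc, fun i hi hoi => ⟨(b1.out i hi hoi).1, fun _ => ?_⟩, b1.mate, b1.lev⟩, b2, ?_, ?_,
    ?_, ?_, ?_, a2⟩
  · by_cases hie : i = e
    · subst hie
      have : i ∈ lst p V (C.fix p V w k i).loc (3 * i + 1) p.n := by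
        rw [hlst]
        exact he
      refine ⟨(mem_lst.1 this).2.1, k, fun x hx => ?_, by rw [hlst, hS]⟩
      rw [b3, b4, if_pos hx, if_pos hx]
      exact ⟨rfl, rfl⟩
    · exact (b1.out i hi hoi).2 hie
  · omega
  · have : (V e).tail.length * (p.r * lvl p.r k) < (V e).tail.length * lvl p.r (k + 1) := by
      refine Nat.mul_lt_mul_of_pos_left ?_ hpos
      rw [hlvl, mul_assoc, mul_left_comm]
      exact Nat.mul_lt_mul_of_pos_left (by omega) (by omega)
    omega
  · omega
  · have m3 : (V e).tail.length * lvl p.r k ≤ p.r * lvl p.r k := Nat.mul_le_mul_right _ hlen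
    rw [b8]
    have h1 : p.r * (8 * D.late p V d) ≤
        p.r * (8 * (C.freeze p V w k e).late p V d + lvl p.r k) := by linarith
    have := Nat.le_of_mul_le_mul_left h1 (by omega)
    omega
  · intro x
    rw [b3]
    split_ifs
    · exact le_max_right _ _
    · exact (a2 x).trans (le_max_left _ _)

end fix

end Conf

end DynMatch

namespace DynMatch

/-- The configuration in the memory. -/
def State.conf (s : State) : Conf := ⟨s.arr 4, s.arr 5, s.arr 6, s.arr 0⟩

/-! ## The program for matching and unmatching hyperedges -/

/-- Move all hyperedges from the location in register `30` which contain the vertex in register `31`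
to the location in register `32`. -/
def moveAll : Cmd :=
  .while (.lt (.const 0) (.read 7 (idE (.reg 30) (.reg 31)))) <|
    .seq (.set 40 (.read 8 (adE (idE (.reg 30) (.reg 31)) (.const 0)))) <|
    .seq unlink <|
    .seq (.set 41 (.reg 32)) link

/-- Move all hyperedges from the location `κ` which contain the vertex `u` to the location `κ'`. -/
def moveTo (κ u κ' : Expr) : Cmd :=
  .seq (.set 30 κ) <| .seq (.set 31 u) <| .seq (.set 32 κ') moveAll

/-- Remove the hyperedge in register `20` from the matching. -/
def unmatch : Cmd :=
  .seq (.set 21 (.const 1)) <|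
  .seq (.upTo 21 (.read 2 (.reg 20)) <|
    .seq (.set 22 (vtxE (.reg 21) (.reg 20))) <|
    .seq (moveTo (.mul (.const 3) (.read 5 (.reg 22))) (.reg 22) (.const 2)) <|
    .write 5 (.reg 22) (.const 0)) <|
  .seq (moveTo (.add (.mul (.const 3) (.reg 20)) (.const 1)) (.reg 3) (.const 2)) <|
  .write 0 (.reg 20) (.const 0)

/-- The level above the one in register `11`. -/
def newLev : Expr := .mul (.mul (.const 8) (.reg 5)) (.add (.reg 11) (.const 1))

/-- Unmatch all hyperedges that meet the hyperedge in register `12`. -/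
def kickLoop : Cmd :=
  .upTo 14 (.read 2 (.reg 12)) <|
    .seq (.set 15 (vtxE (.reg 14) (.reg 12))) <|
    .ite (.read 5 (.reg 15)) (.seq (.set 20 (.read 6 (.reg 15))) unmatch) .skip

/-- Move the hyperedges below the new level which contain the vertex in register `15` to the
limbo. -/
def evictLoop : Cmd :=
  .while (.lt (.reg 16) newLev) <|
    .seq (moveTo (.mul (.const 3) (.reg 16)) (.reg 15) (.const 2)) <|
    .set 16 (.mul (.mul (.const 8) (.reg 5)) (.add (.reg 16) (.const 1)))

/-- Raise the vertices of the hyperedge in register `12` to the new level. -/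
def raiseLoop : Cmd :=
  .upTo 14 (.read 2 (.reg 12)) <|
    .seq (.set 15 (vtxE (.reg 14) (.reg 12))) <|
    .seq (.set 16 (.const 0)) <|
    .seq evictLoop <|
    .seq (.write 5 (.reg 15) newLev) <|
    .write 6 (.reg 15) (.reg 12)

/-- Match the hyperedge number (register `13`) of those at the level in register `11` which contain
the vertex in register `10`. -/
def fixWith : Cmd :=
  .seq (.set 12 (.read 8 (adE (idE (.mul (.const 3) (.reg 11)) (.reg 10)) (.reg 13)))) <|
  .seq (moveTo (.mul (.const 3) (.reg 11)) (.reg 10) (.add (.mul (.const 3) (.reg 12)) (.const 1))) <|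
  .seq (.write 0 (.reg 12) (.const 1)) <|
  .seq (.set 14 (.const 1)) <|
  .seq kickLoop <|
  .seq (.set 14 (.const 1)) raiseLoop

/-- The number of steps needed to move a hyperedge. -/
def moveCost (p : Params) : ℕ := 10 * p.r + 18

variable {p : Params} {V : ℕ → List ℕ} {s : State} {f κ u κ' e : ℕ}

/-- A loop over the vertices of the hyperedge `f`. -/
theorem vertex_loop {Q : State → Prop} {c : Cmd} {x : ℕ} {fE : Expr} (hf : f < p.m)
    (hne : V f ≠ []) (I : List ℕ → State → Prop) (h₀ : I [] s)
    (hI : ∀ l s, I l s → Ctx p V s ∧ s.reg x = l.length + 1 ∧ fE.eval s = f)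
    (h₁ : ∀ l y l', (V f).tail = l ++ y :: l' → ∀ s, I l s → (vtxE (.reg x) fE).eval s = y →
      l.length + 2 ≤ p.P →
      c.Det s.tick fun s' => s'.reg x = l.length + 1 ∧ I (l ++ [y]) (s'.setReg x (l.length + 2)))
    (hV : WF p V) (h₂ : ∀ s, I (V f).tail s → Q s.tick) :
    (Cmd.upTo x (.read 2 fE) c).Det s Q := by
  have hlen : (V f).tail.length + 1 = (V f).length := by
    rw [List.length_tail]
    have := List.length_pos_iff.2 hne
    omega
  have hb := p.bounds
  have hle := hV.length_le hf
  refine Cmd.Det.for_loop (V f).length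
    (fun k s => ∃ l l', (V f).tail = l ++ l' ∧ l.length + 1 = k ∧ I l s) (a := 1) (by omega)
    ⟨[], _, rfl, rfl, h₀⟩ ?_ ?_ ?_
  · rintro k s' ⟨l, l', hl, rfl, hs'⟩
    obtain ⟨h1, h2, h3⟩ := hI l s' hs'
    refine ⟨h2, ?_⟩
    simp only [Expr.eval, h3, h1.deg f hf]
  · rintro k s' - hk ⟨l, l', hl, rfl, hs'⟩
    obtain ⟨h1, h2, h3⟩ := hI l s' hs'
    have hll : (V f).tail.length = l.length + l'.length := by rw [hl, List.length_append]
    obtain ⟨y, l'', rfl⟩ : ∃ y l'', l' = y :: l'' := List.exists_cons_of_length_pos (by omega)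
    refine (h₁ l y l'' hl s' hs' ?_ (by omega)).mono ?_
    · simp only [vtxE, adE, Expr.eval, h2, h3, h1.m]
      rw [h1.vtx f hf _ hk, ← List.getElem_tail (l := V f) (h := by omega)]
      simp [hl]
    · rintro s'' ⟨g1, g2⟩
      exact ⟨g1, l ++ [y], l'', by simp [hl], by simp, g2⟩
  · rintro s' ⟨l, l', hl, hk, hs'⟩
    have hll : (V f).tail.length = l.length + l'.length := by rw [hl, List.length_append]
    have : l' = [] := List.length_eq_zero_iff.1 (by omega)
    rw [this, List.append_nil] at hl
    exact h₂ s' (hl ▸ hs')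

theorem Good.cnt (hs : Good p V s) (hu : u ≤ p.n) :
    s.arr 7 (κ * (p.n + 1) + u) = (lst p V s.conf.loc κ u).card := (hs.lists κ u hu).card

theorem Conf.ext' {C D : Conf} (h1 : C.loc = D.loc) (h2 : C.lev = D.lev) (h3 : C.mate = D.mate)
    (h4 : C.out = D.out) : C = D := by
  cases C
  cases D
  simp_all

/-- Each round moves the first item of the list. The invariant is that moving all that remains leads
to the same configuration as moving all at the start; as `κ ≠ κ'`, the list shrinks. -/
theorem moveAll_spec (hV : WF p V) (hs : Good p V s) (hκ : s.reg 30 = κ) (hu : s.reg 31 = u)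
    (hκ' : s.reg 32 = κ') (hne : κ ≠ κ') (hun : u ≤ p.n) (hP : κ' ≤ p.P) :
    moveAll.Det s fun s' => Good p V s' ∧ s'.conf = s.conf.moveAll p V κ u κ' ∧ Frame 40 s s' ∧
      s'.time ≤ s.time + moveCost p * (lst p V s.conf.loc κ u).card + 1 := by
  have hb := p.bounds
  refine Cmd.Det.while_inv (fun k s' => Good p V s' ∧ Frame 40 s s' ∧
    (lst p V s'.conf.loc κ u).card = k ∧ s'.conf.moveAll p V κ u κ' = s.conf.moveAll p V κ u κ' ∧
    s'.time + moveCost p * k ≤ s.time + moveCost p * (lst p V s.conf.loc κ u).card)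
    (lst p V s.conf.loc κ u).card ?_ ?_ ?_
  · exact ⟨hs, Frame.refl _ _, rfl, rfl, le_rfl⟩
  · rintro k s' ⟨h1, h2, h3, h4, h5⟩
    have e30 : s'.reg 30 = κ := (h2 30 (by omega)).trans hκ
    have e31 : s'.reg 31 = u := (h2 31 (by omega)).trans hu
    have e32 : s'.reg 32 = κ' := (h2 32 (by omega)).trans hκ'
    have hS := h1.lists κ u hun
    have hitem := (hS.item 0 (by
      change 0 < (lst p V s'.conf.loc κ u).card
      omega)).1
    set f := s'.arr 8 ((κ * (p.n + 1) + u) * p.m + 0) with hf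
    have hitem' : f ∈ lst p V s'.conf.loc κ u := hitem
    obtain ⟨hfm, hfκ, hfu⟩ := mem_lst.1 hitem
    refine ⟨?_, ?_⟩
    · simp only [Expr.eval, idE, e30, e31, h1.n]
      rw [h1.cnt hun, h3, if_pos (by omega)]
      exact one_ne_zero
    refine .seq (.set (.seq ?_))
    have hev : (Expr.read 8 (adE (idE (.reg 30) (.reg 31)) (.const 0))).eval s'.tick = f := by
      simp only [Expr.eval, adE, idE, State.tick_reg, State.tick_arr, e30, e31, h1.n, h1.m, hf]
    rw [hev]
    refine (unlink_spec (f := f) hV (h1.tick.setReg (by omega) (by omega)) (by simp) hfm).mono ?_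
    rintro s1 ⟨a1, a2, a3, a4, a5⟩
    refine .seq (.set ?_)
    have e32' : s1.reg 32 = κ' := by rw [a4 32 (by omega)]; simpa using e32
    have e40 : s1.reg 40 = f := by rw [a4 40 (by omega)]; simp
    have hev : (Expr.reg 32).eval s1 = κ' := e32'
    rw [hev]
    have ea4 : s1.arr 4 = s'.arr 4 := a3 4 (by omega)
    refine (link_spec (f := f) (κ := κ') hV (a1.setReg (by omega) hP) (by simp [e40]) hfm (by simp)
      hP ?_).mono ?_
    · rw [State.setReg_arr, ea4]
      exact a2
    rintro s2 ⟨b1, b2, b3, b4, b5⟩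
    rw [State.setReg_arr, ea4] at b2
    have hloc : s2.conf.loc = Function.update s'.conf.loc f κ' := b2
    have hlst : lst p V s2.conf.loc κ u = (lst p V s'.conf.loc κ u).erase f := by
      ext g
      rw [hloc, Finset.mem_erase, mem_lst, mem_lst]
      by_cases hg : g = f
      · subst hg
        simp [hne.symm]
      · simp [hg]
    refine ⟨b1, fun x hx => ?_, ?_, ?_, ?_⟩
    · rw [b4 x (by omega), State.setReg_reg, if_neg (by omega), a4 x (by omega), State.setReg_reg,
        if_neg (by omega)]
      exact h2 x hx
    · rw [hlst, Finset.card_erase_of_mem hitem']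
      omega
    · rw [← h4]
      have ha : ∀ a < 7, a ≠ 4 → s2.arr a = s'.arr a := fun a ha ha4 =>
        (b3 a ha ha4).trans (a3 a ha)
      refine Conf.ext' ?_ (ha 5 (by omega) (by omega)) (ha 6 (by omega) (by omega))
        (ha 0 (by omega) (by omega))
      funext g
      simp only [Conf.moveAll]
      rw [hlst, hloc]
      by_cases hg : g = f
      · rw [hg]
        simp [hitem']
      · simp [hg]
    · rw [State.setReg_time] at b5
      rw [State.setReg_time, State.tick_time] at a5
      have : moveCost p * (k + 1) = moveCost p * k + 10 * p.r + 18 := by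
        rw [moveCost]
        ring
      omega
  · rintro s' ⟨h1, h2, h3, h4, h5⟩
    have e30 : s'.reg 30 = κ := (h2 30 (by omega)).trans hκ
    have e31 : s'.reg 31 = u := (h2 31 (by omega)).trans hu
    refine ⟨?_, h1.tick, ?_, h2, ?_⟩
    · simp only [Expr.eval, idE, e30, e31, h1.n]
      rw [h1.cnt hun, h3, if_neg (by omega)]
    · rw [← h4]
      refine Conf.ext' ?_ rfl rfl rfl
      funext g
      simp only [Conf.moveAll]
      rw [Finset.card_eq_zero.1 h3]
      simp [State.conf]
    · rw [State.tick_time]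
      omega

theorem moveTo_spec {κE uE κE' : Expr} (hV : WF p V) (hs : Good p V s)
    (hE : ∀ s' : State, (∀ x < 30, s'.reg x = s.reg x) → s'.arr = s.arr →
      κE.eval s' = κ ∧ uE.eval s' = u ∧ κE'.eval s' = κ')
    (hne : κ ≠ κ') (hun : u ≤ p.n) (hP : κ ≤ p.P) (hP' : κ' ≤ p.P) :
    (moveTo κE uE κE').Det s fun s' => Good p V s' ∧ s'.conf = s.conf.moveAll p V κ u κ' ∧
      Frame 30 s s' ∧ s'.time ≤ s.time + moveCost p * (lst p V s.conf.loc κ u).card + 4 := by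
  have hb := p.bounds
  refine .seq (.set (.seq (.set (.seq (.set ?_)))))
  obtain ⟨e1, -, -⟩ := hE s (fun _ _ => rfl) rfl
  rw [e1]
  obtain ⟨-, e2, -⟩ := hE (s.setReg 30 κ) ((Frame.refl 30 s).setReg le_rfl) rfl
  rw [e2]
  obtain ⟨-, -, e3⟩ := hE ((s.setReg 30 κ).setReg 31 u)
    (((Frame.refl 30 s).setReg le_rfl).setReg (by omega)) rfl
  rw [e3]
  refine (moveAll_spec (κ := κ) (u := u) (κ' := κ') hV
    (((hs.setReg (by omega) hP).setReg (by omega) (by omega)).setReg (by omega) hP') (by simp)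
    (by simp) (by simp) hne hun hP').mono ?_
  rintro s' ⟨a1, a2, a3, a4⟩
  refine ⟨a1, a2, (((((Frame.refl 30 s).setReg le_rfl).setReg (by omega)).setReg
    (by omega))).trans (a3.mono (by omega)), ?_⟩
  · change s'.time ≤ s.time + 1 + 1 + 1 + moveCost p * (lst p V s.conf.loc κ u).card + 1 at a4
    omega

/-- Three times any level can be written. -/
def Conf.LevB (p : Params) (C : Conf) : Prop := ∀ x, 3 * C.lev x + 2 ≤ p.P

/-- The time is stated relative to the growth of the limbo, since each hyperedge that enters it
costs one `moveCost`. The potential can then absorb these moves. -/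
theorem unmatch_spec (hV : WF p V) (hs : Good p V s) (hL : s.conf.LevB p) (he : s.reg 20 = e)
    (hem : e < p.m) (hne : V e ≠ []) :
    unmatch.Det s fun s' => Good p V s' ∧ s'.conf = s.conf.unmatch p V e ∧ Frame 20 s s' ∧
      s'.time + moveCost p * s.conf.limbo p V ≤
        s.time + moveCost p * s'.conf.limbo p V + 8 * p.r + 7 := by
  have hb := p.bounds
  refine .seq (.set (.seq ?_))
  refine vertex_loop hem hne (fun l s' => Good p V s' ∧ s'.conf = l.foldl (Conf.drop p V) s.conf ∧
    s'.reg 21 = l.length + 1 ∧ Frame 21 s s' ∧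
    s'.time + moveCost p * s.conf.limbo p V ≤
      s.time + moveCost p * s'.conf.limbo p V + 8 * l.length + 1) ?_ ?_ ?_ hV ?_
  · refine ⟨hs.setReg (by omega) ?_, rfl, by simp [Expr.eval], (Frame.refl _ _).setReg le_rfl, ?_⟩
    · simp only [Expr.eval]
      omega
    · change s.time + 1 + _ ≤ s.time + moveCost p * s.conf.limbo p V + 0 + 1
      omega
  · rintro l s' ⟨h1, h2, h3, h4, h5⟩
    exact ⟨h1.toCtx, h3, (h4 20 (by omega)).trans he⟩
  · rintro l y l' hl s' ⟨h1, h2, h3, h4, h5⟩ hy hlP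
    have hyt : y ∈ (V e).tail := by simp [hl]
    have hyn := hV.tail_lt hem hyt
    refine .seq (.set (.seq ?_))
    have hy' : (vtxE (.reg 21) (.reg 20)).eval s'.tick = y := hy
    rw [hy']
    have hlev : ∀ x, s'.conf.lev x ≤ s.conf.lev x := fun x => by
      rw [h2, Conf.foldl_drop_lev]
      split_ifs <;> omega
    have hL3 := hL y
    have hle := hlev y
    refine (moveTo_spec (κ := 3 * s'.conf.lev y) (u := y) (κ' := 2) hV
      (h1.tick.setReg (by omega) (by omega)) ?_ (by omega) hyn.le (by omega) (by omega)).mono ?_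
    · intro s'' hr ha
      have e22 : s''.reg 22 = y := by
        rw [hr 22 (by omega)]
        simp
      simp only [Expr.eval, e22, ha]
      exact ⟨rfl, trivial, trivial⟩
    rintro s1 ⟨a1, a2, a3, a4⟩
    have e22 : s1.reg 22 = y := by
      rw [a3 22 (by omega)]
      simp
    refine .write ?_
    simp only [Expr.eval, e22]
    have e21 : s1.reg 21 = l.length + 1 := by
      rw [a3 21 (by omega)]
      simpa using h3
    have hc : (s1.setArr 5 y 0).conf = s'.conf.drop p V y := by
      have a2' : s1.conf = s'.conf.moveAll p V (3 * s'.conf.lev y) y 2 := a2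
      have : (s1.setArr 5 y 0).conf = { s1.conf with lev := Function.update s1.conf.lev y 0 } := by
        simp [State.conf]
      rw [this, a2']
      rfl
    refine ⟨by simpa using e21, (a1.setArr (by omega) (by omega) (by omega) (by omega)
      (by omega)).setReg (by omega) (by omega), ?_, by simp, ?_, ?_⟩
    · rw [List.foldl_append, ← h2]
      exact hc
    · refine Frame.setReg (fun x hx => ?_) le_rfl
      rw [State.setArr_reg, a3 x (by omega), State.setReg_reg, if_neg (by omega)]
      exact h4 x hx
    · have hlim : (s'.conf.drop p V y).limbo p V =
          s'.conf.limbo p V + (lst p V s'.conf.loc (3 * s'.conf.lev y) y).card :=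
        Conf.limbo_moveAll hV (by omega)
      change s1.time + 1 + 1 + _ ≤ s.time + moveCost p * ((s1.setArr 5 y 0).conf.limbo p V) + _ + 1
      change s1.time ≤ s'.time + 1 + 1 +
        moveCost p * (lst p V s'.conf.loc (3 * s'.conf.lev y) y).card + 4 at a4
      rw [hc, hlim, mul_add, List.length_append, List.length_singleton]
      omega
  · rintro s1 ⟨h1, h2, h3, h4, h5⟩
    have e20 : ∀ s' : State, (∀ x < 30, s'.reg x = s1.reg x) → s'.reg 20 = e := fun s' h => by
      rw [h 20 (by omega), h4 20 (by omega), he]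
    refine .seq ?_
    refine (moveTo_spec (κ := 3 * e + 1) (u := p.n) (κ' := 2) hV h1.tick ?_ (by omega) le_rfl
      (by omega) (by omega)).mono ?_
    · intro s' hr _
      simp only [Expr.eval]
      rw [e20 s' hr, hr 3 (by omega)]
      exact ⟨rfl, h1.n, trivial⟩
    rintro s2 ⟨a1, a2, a3, a4⟩
    refine .write ?_
    simp only [Expr.eval]
    rw [e20 s2 a3]
    have hc : (s2.setArr 0 e 0).conf = s.conf.unmatch p V e := by
      have a2' : s2.conf = ((V e).tail.foldl (Conf.drop p V) s.conf).moveAll p V (3 * e + 1) p.n 2 :=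
        by rw [← h2]; exact a2
      have : (s2.setArr 0 e 0).conf = { s2.conf with out := Function.update s2.conf.out e 0 } := by
        simp [State.conf]
      rw [this, a2']
      simp only [Conf.unmatch, Conf.moveAll, Conf.foldl_drop_out]
    refine ⟨a1.setArr (by omega) (by omega) (by omega) (by omega) (by omega), hc, fun x hx => ?_, ?_⟩
    · rw [State.setArr_reg, a3 x (by omega)]
      exact h4 x (by omega)
    · have hlim : (s.conf.unmatch p V e).limbo p V = _ := Conf.limbo_moveAll (κ := 3 * e + 1)
        (u := p.n) (C := (V e).tail.foldl (Conf.drop p V) s.conf) hV (by omega)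
      rw [hc, hlim, ← h2, mul_add, State.setArr_time]
      change s2.time ≤ s1.time + 1 + moveCost p * (lst p V s1.conf.loc (3 * e + 1) p.n).card + 4
        at a4
      have := hV.length_tail_le hem
      omega

end DynMatch

/-! ### The cost of kicking, evicting, raising and matching on the machine -/

namespace DynMatch

variable {p : Params} {V : ℕ → List ℕ} {s : State} {f κ u κ' e : ℕ} {C : Conf}

theorem kickLoop_spec (hV : WF p V) (hr : 1 < p.r) (hs : Good p V s) (hL : s.conf.LevB p)
    (he : s.reg 12 = e) (h14 : s.reg 14 = 1) (hem : e < p.m) (hne : V e ≠ [])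
    (hK : s.conf.Kicking p V e) :
    kickLoop.Det s fun s' => Good p V s' ∧ s'.conf = (V e).tail.foldl (Conf.kick p V) s.conf ∧
      Frame 14 s s' ∧
      s'.time + moveCost p * s.conf.limbo p V ≤
        s.time + moveCost p * s'.conf.limbo p V + (8 * p.r + 12) * (V e).tail.length + 1 := by
  have hb := p.bounds
  refine vertex_loop hem hne (fun l s' => Good p V s' ∧ s'.conf = l.foldl (Conf.kick p V) s.conf ∧
    s'.conf.Kicking p V e ∧ s'.conf.LevB p ∧ s'.reg 14 = l.length + 1 ∧ Frame 14 s s' ∧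
    s'.time + moveCost p * s.conf.limbo p V ≤
      s.time + moveCost p * s'.conf.limbo p V + (8 * p.r + 12) * l.length) ?_ ?_ ?_ hV ?_
  · exact ⟨hs, rfl, hK, hL, h14, Frame.refl _ _, by simp⟩
  · rintro l s' ⟨h1, -, -, -, h3, h4, -⟩
    exact ⟨h1.toCtx, h3, (h4 12 (by omega)).trans he⟩
  · rintro l y l' hl s' ⟨h1, h2, h3, h4, h5, h6, h7⟩ hy hlP
    have hyn := hV.tail_lt hem (x := y) (by simp [hl])
    have hy' : (vtxE (.reg 14) (.reg 12)).eval s'.tick = y := hy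
    have hfold : (l ++ [y]).foldl (Conf.kick p V) s.conf = s'.conf.kick p V y := by
      rw [List.foldl_append, ← h2]
      rfl
    have hLk : (s'.conf.kick p V y).LevB p := fun x => by
      have := h4 x
      have := Conf.kick_lev_le (p := p) (V := V) (C := s'.conf) (x := y) x
      omega
    rw [hfold, List.length_append, List.length_singleton, mul_add, mul_one]
    refine .seq (.set ?_)
    rw [hy']
    by_cases hl0 : s'.conf.lev y = 0
    · refine .ite_false (by simp [Expr.eval]; exact hl0) (.skip ?_)
      rw [Conf.kick_eq_self hl0] at hLk ⊢
      refine ⟨by simpa using h5, ((h1.tick.setReg (by omega) (by omega)).tick).setReg (by omega)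
        hlP, rfl, h3, h4, by simp, ?_, ?_⟩
      · refine Frame.setReg (fun x hx => ?_) le_rfl
        rw [State.tick_reg, State.setReg_reg, if_neg (by omega)]
        exact h6 x hx
      · change s'.time + 1 + 1 + 1 + 1 + _ ≤ s.time + moveCost p * s'.conf.limbo p V + _
        omega
    · obtain ⟨m1, m2, m3, m4, m5⟩ := h3.mate_spec hyn hl0
      have hKk := h3.kick hV hyn
      rw [Conf.kick_eq hl0] at hKk hLk ⊢
      have e6 : (Expr.read 6 (.reg 15)).eval (s'.tick.setReg 15 y).tick = s'.conf.mate y := by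
        simp [Expr.eval, State.conf]
      refine .ite_true (by simp [Expr.eval]; exact hl0) (.seq (.set ?_))
      rw [e6]
      refine (unmatch_spec (e := s'.conf.mate y) hV
        (((h1.tick.setReg (by omega) (by omega)).tick).setReg (by omega) (by omega))
        h4 (by simp) m1 m2).mono ?_
      rintro s1 ⟨a1, a2, a3, a4⟩
      have a2' : s1.conf = s'.conf.unmatch p V (s'.conf.mate y) := a2
      refine ⟨?_, a1.setReg (by omega) hlP, a2', ?_, ?_, by simp, ?_, ?_⟩
      · rw [a3 14 (by omega)]
        simpa using h5
      · exact a2'.symm ▸ hKk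
      · exact a2'.symm ▸ hLk
      · refine Frame.setReg (fun x hx => ?_) le_rfl
        rw [a3 x (by omega), State.setReg_reg, if_neg (by omega), State.tick_reg,
          State.setReg_reg, if_neg (by omega)]
        exact h6 x hx
      · change s1.time + moveCost p * s'.conf.limbo p V ≤ s'.time + 1 + 1 + 1 + 1 +
          moveCost p * s1.conf.limbo p V + 8 * p.r + 7 at a4
        change s1.time + 1 + _ ≤ s.time + moveCost p * s1.conf.limbo p V + _
        omega
  · rintro s1 ⟨h1, h2, h3, h4, h5, h6, h7⟩
    refine ⟨h1.tick, h2, h6, ?_⟩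
    change s1.time + 1 + _ ≤ s.time + moveCost p * s1.conf.limbo p V + _ + 1
    omega

theorem lvl_ge (r k : ℕ) (hr : 1 < r) : k ≤ lvl r k := (lvl_strictMono hr).le_apply

theorem newLev_eval {k : ℕ} (hs : Ctx p V s) (h11 : s.reg 11 = lvl p.r k) :
    newLev.eval s = lvl p.r (k + 1) := by
  simp [newLev, Expr.eval, hs.r, h11, lvl]

/-- The index of a level is never stored: register `16` runs through the levels by their recurrence
until it reaches the new one. -/
theorem evictLoop_spec (hV : WF p V) (hr : 1 < p.r) (hs : Good p V s) {k x : ℕ}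
    (h11 : s.reg 11 = lvl p.r k) (h15 : s.reg 15 = x) (h16 : s.reg 16 = 0) (hx : x < p.n)
    (hP : 3 * lvl p.r (k + 1) ≤ p.P) :
    evictLoop.Det s fun s' => Good p V s' ∧ s'.conf = s.conf.evict p V x (k + 1) ∧
      Frame 16 s s' ∧
      s'.time + moveCost p * s.conf.limbo p V ≤
        s.time + moveCost p * s'.conf.limbo p V + 6 * (k + 1) + 1 := by
  have hb := p.bounds
  have hmono := lvl_strictMono hr
  refine Cmd.Det.while_inv (fun j s' => j ≤ k + 1 ∧ Good p V s' ∧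
    s'.conf = s.conf.evict p V x (k + 1 - j) ∧ s'.reg 16 = lvl p.r (k + 1 - j) ∧ Frame 16 s s' ∧
    s'.time + moveCost p * s.conf.limbo p V ≤
      s.time + moveCost p * s'.conf.limbo p V + 6 * (k + 1 - j)) (k + 1) ?_ ?_ ?_
  · refine ⟨le_rfl, hs, by rw [Nat.sub_self]; rfl, by rw [Nat.sub_self]; exact h16,
      Frame.refl _ _, by omega⟩
  · rintro j s' ⟨hj, h1, h2, h3, h4, h5⟩
    have e11 : s'.reg 11 = lvl p.r k := (h4 11 (by omega)).trans h11
    obtain ⟨i, hi⟩ : ∃ i, i = k + 1 - (j + 1) := ⟨_, rfl⟩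
    have hi' : k + 1 - j = i + 1 := by omega
    rw [← hi] at h2 h3 h5
    rw [hi']
    have hlt : lvl p.r i < lvl p.r (k + 1) := hmono (by omega)
    have hle : lvl p.r (i + 1) ≤ lvl p.r (k + 1) := hmono.monotone (by omega)
    refine ⟨?_, .seq ?_⟩
    · have := newLev_eval h1.toCtx e11
      simp only [Expr.eval, this, h3]
      rw [if_pos hlt]
      exact one_ne_zero
    refine (moveTo_spec (κ := 3 * lvl p.r i) (u := x) (κ' := 2) hV h1.tick ?_ (by omega) hx.le
      (by omega) (by omega)).mono ?_
    · intro s'' hs'' _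
      simp only [Expr.eval]
      rw [hs'' 16 (by omega), hs'' 15 (by omega)]
      exact ⟨congrArg _ h3, (h4 15 (by omega)).trans h15, trivial⟩
    rintro s1 ⟨a1, a2, a3, a4⟩
    refine .set ?_
    have hev : (Expr.mul (.mul (.const 8) (.reg 5)) (.add (.reg 16) (.const 1))).eval s1 =
        lvl p.r (i + 1) := by
      simp only [Expr.eval]
      rw [a3 16 (by omega), a1.r]
      change 8 * p.r * (s'.reg 16 + 1) = _
      rw [h3]
      rfl
    rw [hev]
    have hc : s1.conf = s.conf.evict p V x (i + 1) := by
      rw [a2]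
      change s'.conf.moveAll p V _ x 2 = _
      rw [h2]
      rfl
    refine ⟨by omega, a1.setReg (by omega) (by omega), hc, by simp, ?_, ?_⟩
    · refine Frame.setReg (fun y hy => ?_) le_rfl
      rw [a3 y (by omega)]
      exact h4 y hy
    · have hlim : s1.conf.limbo p V = s'.conf.limbo p V +
          (lst p V s'.conf.loc (3 * lvl p.r i) x).card := by
        rw [a2]
        exact Conf.limbo_moveAll hV (by omega)
      change s1.time + 1 + _ ≤ s.time + moveCost p * s1.conf.limbo p V + _
      change s1.time ≤ s'.time + 1 + moveCost p * (lst p V s'.conf.loc (3 * lvl p.r i) x).card + 4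
        at a4
      rw [hlim, mul_add]
      omega
  · rintro s' ⟨hj, h1, h2, h3, h4, h5⟩
    have e11 : s'.reg 11 = lvl p.r k := (h4 11 (by omega)).trans h11
    refine ⟨?_, h1.tick, h2, h4, ?_⟩
    · have := newLev_eval h1.toCtx e11
      simp only [Expr.eval, this, h3, Nat.sub_zero, lt_irrefl, if_false]
    · change s'.time + 1 + _ ≤ s.time + moveCost p * s'.conf.limbo p V + _ + 1
      omega

theorem raiseLoop_spec (hV : WF p V) (hr : 1 < p.r) (hs : Good p V s)
    (he : s.reg 12 = e) {k : ℕ} (h11 : s.reg 11 = lvl p.r k) (h14 : s.reg 14 = 1) (hem : e < p.m)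
    (hne : V e ≠ []) (hP : 3 * lvl p.r (k + 1) ≤ p.P) :
    raiseLoop.Det s fun s' => Good p V s' ∧
      s'.conf = (V e).tail.foldl (Conf.raise p V (k + 1) e) s.conf ∧ Frame 14 s s' ∧
      s'.time + moveCost p * s.conf.limbo p V ≤
        s.time + moveCost p * s'.conf.limbo p V + (6 * k + 13) * (V e).tail.length + 1 := by
  have hb := p.bounds
  refine vertex_loop hem hne (fun l s' => Good p V s' ∧
    s'.conf = l.foldl (Conf.raise p V (k + 1) e) s.conf ∧ s'.reg 14 = l.length + 1 ∧ Frame 14 s s' ∧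
    s'.time + moveCost p * s.conf.limbo p V ≤
      s.time + moveCost p * s'.conf.limbo p V + (6 * k + 13) * l.length) ?_ ?_ ?_ hV ?_
  · exact ⟨hs, rfl, h14, Frame.refl _ _, by simp⟩
  · rintro l s' ⟨h1, -, h3, h4, -⟩
    exact ⟨h1.toCtx, h3, (h4 12 (by omega)).trans he⟩
  · rintro l y l' hl s' ⟨h1, h2, h3, h4, h5⟩ hy hlP
    have hyn := hV.tail_lt hem (x := y) (by simp [hl])
    have hy' : (vtxE (.reg 14) (.reg 12)).eval s'.tick = y := hy
    have hfold : (l ++ [y]).foldl (Conf.raise p V (k + 1) e) s.conf =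
        s'.conf.raise p V (k + 1) e y := by
      rw [List.foldl_append, ← h2]
      rfl
    rw [hfold, List.length_append, List.length_singleton, mul_add, mul_one]
    refine .seq (.set ?_)
    rw [hy']
    refine .seq (.set (.seq ?_))
    simp only [Expr.eval]
    have e11 : s'.reg 11 = lvl p.r k := (h4 11 (by omega)).trans h11
    refine (evictLoop_spec (k := k) (x := y) hV hr
      ((h1.tick.setReg (by omega) (by omega)).setReg (by omega) (by omega)) (by simpa using e11)
      (by simp) (by simp) hyn hP).mono ?_
    rintro s1 ⟨a1, a2, a3, a4⟩
    have a2' : s1.conf = s'.conf.evict p V y (k + 1) := a2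
    have b11 : s1.reg 11 = lvl p.r k := by
      rw [a3 11 (by omega)]
      simpa using e11
    have b12 : s1.reg 12 = e := by
      rw [a3 12 (by omega)]
      simpa using (h4 12 (by omega)).trans he
    have b15 : s1.reg 15 = y := by
      rw [a3 15 (by omega)]
      simp
    refine .seq (.write (.write ?_))
    rw [newLev_eval a1.toCtx b11]
    simp only [Expr.eval, b15, State.setArr_reg, b12]
    set s2 := (s1.setArr 5 y (lvl p.r (k + 1))).setArr 6 y e with hs2
    have hc : s2.conf = s'.conf.raise p V (k + 1) e y := by
      have : s2.conf = { s1.conf with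
          lev := Function.update s1.conf.lev y (lvl p.r (k + 1))
          mate := Function.update s1.conf.mate y e } := by
        simp [State.conf, hs2]
      rw [this, a2', Conf.raise, Conf.evict_lev, Conf.evict_mate]
    refine ⟨?_, ((a1.setArr (by omega) (by omega) (by omega) (by omega) (by omega)).setArr (by omega)
      (by omega) (by omega) (by omega) (by omega)).setReg (by omega) hlP, hc, by simp, ?_, ?_⟩
    · rw [a3 14 (by omega)]
      simpa using h3
    · refine Frame.setReg (fun x hx => ?_) le_rfl
      change s1.reg x = _
      rw [a3 x (by omega), State.setReg_reg, if_neg (by omega), State.setReg_reg,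
        if_neg (by omega)]
      exact h4 x hx
    · have hlim : s2.conf.limbo p V = s1.conf.limbo p V := by
        rw [hc, a2']
        rfl
      change s1.time + moveCost p * s'.conf.limbo p V ≤ s'.time + 1 + 1 + 1 +
          moveCost p * s1.conf.limbo p V + 6 * (k + 1) + 1 at a4
      change s1.time + 1 + 1 + 1 + _ ≤ s.time + moveCost p * s2.conf.limbo p V + _
      rw [hlim]
      omega
  · rintro s1 ⟨h1, h2, h3, h4, h5⟩
    refine ⟨h1.tick, h2, h4, ?_⟩
    change s1.time + 1 + _ ≤ s.time + moveCost p * s1.conf.limbo p V + _ + 1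
    omega

/-- The summands are the moves into the sample, the overhead of at most `r` kicks, and that of at
most `r` vertices raised past `k + 1` levels each. Since `k ≤ c`, the scan of the levels costs no
more than the rest. -/
theorem fix_cost_le {r c k : ℕ} (hr : 1 < r) (hk : k ≤ c) :
    (10 * r + 18) * (c + 1) + (8 * r + 12) * r + (6 * k + 13) * r + 10 ≤ 80 * r ^ 2 * (c + 1) := by
  have q1 : 2 * r ≤ r ^ 2 := by
    rw [sq]
    exact Nat.mul_le_mul_right _ hr
  have q2 : 2 * r * c ≤ r ^ 2 * c := Nat.mul_le_mul_right _ q1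
  have q3 : k * r ≤ c * r := Nat.mul_le_mul_right _ hk
  have q4 : 2 * c ≤ r * c := Nat.mul_le_mul_right _ hr
  have e1 : (10 * r + 18) * (c + 1) + (8 * r + 12) * r + (6 * k + 13) * r + 10 =
      10 * (r * c) + 18 * c + 35 * r + 8 * r ^ 2 + 6 * (k * r) + 28 := by ring
  have e2 : 80 * r ^ 2 * (c + 1) = 80 * (r ^ 2 * c) + 80 * r ^ 2 := by ring
  rw [e1, e2]
  linarith

/-- The hyperedge number `y` at the location `3 c` which contains the vertex `w`. -/
def State.pick (p : Params) (s : State) (w c y : ℕ) : ℕ :=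
  s.arr 8 ((3 * c * (p.n + 1) + w) * p.m + y)

/-- The moves into the sample do not enter the limbo, so they are charged directly to `80 r ^ 2 (lvl
r k + 1)`. -/
theorem fixWith_spec (hV : WF p V) (hr : 1 < p.r) (hs : Good p V s) (hL : s.conf.LevB p) {w k y : ℕ}
    (hC : s.conf.Inv p V fun _ => False) (hcap : s.conf.CapExcept p V f) (hw : w < p.n)
    (hf : f ∈ lst p V s.conf.loc (3 * lvl p.r k) w)
    (hS : (lst p V s.conf.loc (3 * lvl p.r k) w).card = lvl p.r k + 1)
    (h10 : s.reg 10 = w) (h11 : s.reg 11 = lvl p.r k) (h13 : s.reg 13 = y) (hy : y ≤ lvl p.r k) :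
    fixWith.Det s fun s' => Good p V s' ∧ s'.conf = s.conf.fix p V w k (s.pick p w (lvl p.r k) y) ∧
      s'.conf.LevB p ∧
      s'.time + moveCost p * s.conf.limbo p V ≤
        s.time + moveCost p * s'.conf.limbo p V + 80 * p.r ^ 2 * (lvl p.r k + 1) := by
  have hb := p.bounds
  set e := s.pick p w (lvl p.r k) y with he_def
  have he : e ∈ lst p V s.conf.loc (3 * lvl p.r k) w := by
    have := ((hs.lists (3 * lvl p.r k) w hw.le).item y (by
      change y < (lst p V s.conf.loc (3 * lvl p.r k) w).card
      omega)).1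
    exact this
  obtain ⟨hem, hel, hew⟩ := mem_lst.1 he
  have hne := List.ne_nil_of_mem hew
  have hcm : lvl p.r k + 1 ≤ p.m := by
    rw [← hS]
    exact (hs.lists (3 * lvl p.r k) w hw.le).card_le
  -- There are `lvl p.r k + 1` different names at `w`, so the new level is at most `8 r m`. This is
  -- why `Params.P` contains `24 r m`.
  have hP : 3 * lvl p.r (k + 1) + 2 ≤ p.P := by
    have : p.r * (lvl p.r k + 1) ≤ p.r * p.m := Nat.mul_le_mul_left _ hcm
    have h2 : lvl p.r (k + 1) = 8 * (p.r * (lvl p.r k + 1)) := by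
      rw [lvl]
      ring
    rw [Params.P, mul_assoc]
    omega
  have hKF := Conf.Kicking.freeze (e := e) hV hC hcap hw hf he
  obtain ⟨-, -, -, -, -, -, hfl, hkl⟩ := Conf.fix_spec (d := fun _ => 0) hV hr hC hcap hw hf hS he
  refine .seq (.set (.seq ?_))
  have hev : (Expr.read 8 (adE (idE (.mul (.const 3) (.reg 11)) (.reg 10)) (.reg 13))).eval s = e := by
    simp only [Expr.eval, adE, idE, h10, h11, h13, hs.n, hs.m, he_def, State.pick]
  rw [hev]
  refine (moveTo_spec (κ := 3 * lvl p.r k) (u := w) (κ' := 3 * e + 1) hV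
    (hs.setReg (by omega) (by omega)) ?_ (by omega) hw.le ?_ (by omega)).mono ?_
  · intro s' hs' _
    simp only [Expr.eval]
    rw [hs' 11 (by omega), hs' 10 (by omega), hs' 12 (by omega)]
    simp [h10, h11]
  · omega
  rintro s1 ⟨a1, a2, a3, a4⟩
  have b10 : ∀ x < 14, x ≠ 12 → s1.reg x = s.reg x := fun x hx h12 => by
    rw [a3 x (by omega), State.setReg_reg, if_neg h12]
  have b12 : s1.reg 12 = e := by
    rw [a3 12 (by omega)]
    simp
  refine .seq (.write (.seq (.set (.seq ?_))))
  simp only [Expr.eval, b12]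
  set s2 := (s1.setArr 0 e 1).setReg 14 1 with hs2
  have hc2 : s2.conf = s.conf.freeze p V w k e := by
    have : s2.conf = { s1.conf with out := Function.update s1.conf.out e 1 } := by
      simp [State.conf, hs2]
    rw [this, a2]
    rfl
  have hlim2 : s2.conf.limbo p V = s.conf.limbo p V := by rw [hc2, Conf.limbo_freeze]
  refine (kickLoop_spec (s := s2) (e := e) hV hr ((a1.setArr (by omega) (by omega) (by omega)
    (by omega) (by omega)).setReg (by omega) (by omega)) ?_ (by simp [hs2, b12]) (by simp [hs2]) hem
    hne (hc2 ▸ hKF)).mono ?_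
  · intro x
    rw [hc2]
    exact hL x
  rintro s3 ⟨c1, c2, c3, c4⟩
  refine .seq (.set ?_)
  simp only [Expr.eval]
  have d11 : s3.reg 11 = lvl p.r k := by
    rw [c3 11 (by omega), hs2, State.setReg_reg, if_neg (by omega), State.setArr_reg,
      b10 11 (by omega) (by omega), h11]
  have d12 : s3.reg 12 = e := by
    rw [c3 12 (by omega), hs2, State.setReg_reg, if_neg (by omega), State.setArr_reg, b12]
  refine (raiseLoop_spec (s := s3.setReg 14 1) (e := e) (k := k) hV hr
    (c1.setReg (by omega) (by omega)) (by simpa using d12) (by simpa using d11) (by simp) hem hne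
    (by omega)).mono ?_
  rintro s4 ⟨e1, e2, e3, e4⟩
  have hc4 : s4.conf = s.conf.fix p V w k e := by
    rw [e2]
    change (V e).tail.foldl _ s3.conf = _
    rw [c2, hc2]
    rfl
  refine ⟨e1, hc4, fun x => ?_, ?_⟩
  · have h1 := hfl x
    have h2 := hL x
    rw [← hc4] at h1
    omega
  · have hlen := hV.length_tail_le hem
    have hk := lvl_ge p.r k hr
    change s1.time ≤ s.time + 1 + moveCost p * (lst p V s.conf.loc (3 * lvl p.r k) w).card + 4 at a4
    change s3.time + _ ≤ s1.time + 1 + 1 + moveCost p * s3.conf.limbo p V + _ + 1 at c4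
    change s4.time + moveCost p * s3.conf.limbo p V ≤ s3.time + 1 + _ + _ + 1 at e4
    rw [hS] at a4
    rw [hlim2] at c4
    have m1 : (8 * p.r + 12) * (V e).tail.length ≤ (8 * p.r + 12) * p.r :=
      Nat.mul_le_mul_left _ hlen
    have m2 : (6 * k + 13) * (V e).tail.length ≤ (6 * k + 13) * p.r := Nat.mul_le_mul_left _ hlen
    have m3 : moveCost p * (lvl p.r k + 1) + (8 * p.r + 12) * p.r + (6 * k + 13) * p.r + 10 ≤
        80 * p.r ^ 2 * (lvl p.r k + 1) := by
      exact fix_cost_le hr hk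
    omega

end DynMatch

namespace DynMatch

/-! ## Placing the hyperedges of the limbo -/

/-- The level of the vertex number `k` of the hyperedge `f`. -/
def levE (k f : Expr) : Expr := .read 5 (vtxE k f)

/-- Take a hyperedge out of the limbo and put it at the highest level of its vertices. Register `9`
holds the hyperedge, register `11` the level, and register `10` a vertex at which that level now has
too many hyperedges, if there is one, and `n` otherwise. -/
def place : Cmd :=
  .seq (.set 9 (.read 8 (adE (idE (.const 2) (.reg 3)) (.const 0)))) <|
  .seq (.set 11 (.const 0)) <|
  .seq (.set 14 (.const 1)) <|
  .seq (.upTo 14 (.read 2 (.reg 9)) <|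
    .ite (.lt (.reg 11) (levE (.reg 14) (.reg 9))) (.set 11 (levE (.reg 14) (.reg 9))) .skip) <|
  .seq (.set 40 (.reg 9)) <|
  .seq unlink <|
  .seq (.set 41 (.mul (.const 3) (.reg 11))) <|
  .seq link <|
  .seq (.set 10 (.reg 3)) <|
  .seq (.set 14 (.const 1)) <|
  .upTo 14 (.read 2 (.reg 9)) <|
    .ite (.lt (.reg 11) (.read 7 (idE (.mul (.const 3) (.reg 11)) (vtxE (.reg 14) (.reg 9)))))
      (.set 10 (vtxE (.reg 14) (.reg 9))) .skip

variable {p : Params} {V : ℕ → List ℕ} {s : State} {f κ u κ' e : ℕ} {C : Conf}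

namespace Conf

/-- Put the hyperedge `f` at the location `κ`. -/
def put (C : Conf) (f κ : ℕ) : Conf := { C with loc := Function.update C.loc f κ }

variable {k : ℕ} {d : ℕ → ℕ}

section put

variable (hV : WF p V) (hf : f ∈ lst p V C.loc 2 p.n)

include hf

theorem lst_put_subset (h : κ ≠ κ') : lst p V (C.put f κ').loc κ u ⊆ lst p V C.loc κ u := by
  intro g
  simp only [mem_lst, put]
  by_cases hg : g = f
  · subst hg
    simp [h.symm]
  · simp [hg]

theorem Inv.put (hC : C.Inv p V fun _ => False)
    (hle : ∀ x ∈ (V f).tail, C.lev x ≤ lvl p.r k) (hk : ∃ x ∈ (V f).tail, C.lev x = lvl p.r k) :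
    (C.put f (3 * lvl p.r k)).Inv p V fun _ => False := by
  refine ⟨fun g hg hne => ?_, fun i hi hoi => ⟨(hC.out i hi hoi).1, fun hQ => ?_⟩, hC.mate, hC.lev⟩
  · by_cases hgf : g = f
    · subst hgf
      exact Or.inr (Or.inl ⟨k, Function.update_self _ _ _, hle, hk⟩)
    · have : (C.put f (3 * lvl p.r k)).loc g = C.loc g := Function.update_of_ne hgf _ _
      rw [this]
      exact hC.loc g hg hne
  · obtain ⟨h1, j, h2, h3⟩ := (hC.out i hi hoi).2 hQ
    have h4 := (mem_lst.1 hf).2.1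
    refine ⟨?_, j, h2, (Finset.card_le_card (lst_put_subset hf (by omega))).trans h3⟩
    rw [← h1]
    refine Function.update_of_ne ?_ _ _
    rintro rfl
    omega

omit hf in
theorem CapExcept.put (hC : C.Cap p V) : (C.put f κ).CapExcept p V f := by
  intro x hx j
  refine (Finset.card_le_card ?_).trans (hC x hx j)
  intro g hg
  obtain ⟨h1, h2⟩ := Finset.mem_erase.1 hg
  obtain ⟨h3, h4, h5⟩ := mem_lst.1 h2
  have : (C.put f κ).loc g = C.loc g := Function.update_of_ne h1 _ _
  exact mem_lst.2 ⟨h3, this ▸ h4, h5⟩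

theorem limbo_put (hκ : κ ≠ 2) : (C.put f κ).limbo p V + 1 = C.limbo p V := by
  rw [limbo, limbo, ← Finset.card_erase_add_one hf]
  congr 2
  ext g
  simp only [mem_lst, Finset.mem_erase, put]
  by_cases hg : g = f
  · subst hg
    simp [hκ]
  · simp [hg]

theorem late_put (c : ℕ) : (C.put f (3 * c)).late p V d = C.late p V d := by
  rw [late, late]
  congr 1
  ext g
  simp only [mem_lateSet, put]
  by_cases hg : g = f
  · subst hg
    have := (mem_lst.1 hf).2.1
    simp only [Function.update_self, this]
    refine and_congr_right fun _ => and_congr_right fun _ => not_congr ⟨?_, ?_⟩ <;>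
      rintro ⟨e, he, h1, h2⟩ <;> omega
  · simp [hg]

end put

end Conf

theorem searchStep_eval (hs : Ctx p V s) {y : ℕ} (hy : (vtxE (.reg 14) (.reg 9)).eval s = y)
    {c : ℕ} (h11 : s.reg 11 = c) :
    (Expr.lt (.reg 11) (.read 7 (idE (.mul (.const 3) (.reg 11))
      (vtxE (.reg 14) (.reg 9))))).eval s =
      if c < s.arr 7 (3 * c * (p.n + 1) + y) then 1 else 0 := by
  simp only [Expr.eval, idE, hy, h11, hs.n]

/-- The value `n` of `w` signals that no vertex is overloaded. Otherwise the excess is exactly one,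
because the capacities held before `f` was placed. -/
theorem place_spec (hV : WF p V) (hs : Good p V s) (hL : s.conf.LevB p)
    (hC : s.conf.Inv p V fun _ => False) (hcap : s.conf.Cap p V) (hpos : 0 < s.conf.limbo p V) :
    place.Det s fun s' => ∃ f k w, Good p V s' ∧ f ∈ lst p V s.conf.loc 2 p.n ∧
      s'.conf = s.conf.put f (3 * lvl p.r k) ∧ s'.conf.Inv p V (fun _ => False) ∧
      s'.time ≤ s.time + 18 * p.r + 24 ∧ s'.reg 11 = lvl p.r k ∧ s'.reg 10 = w ∧
      (w = p.n ∧ s'.conf.Cap p V ∨ w < p.n ∧ f ∈ lst p V s'.conf.loc (3 * lvl p.r k) w ∧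
        (lst p V s'.conf.loc (3 * lvl p.r k) w).card = lvl p.r k + 1) := by
  have hb := p.bounds
  have hitem := ((hs.lists 2 p.n le_rfl).item 0 hpos).1
  set f := s.arr 8 ((2 * (p.n + 1) + p.n) * p.m + 0) with hfdef
  have hf : f ∈ lst p V s.conf.loc 2 p.n := hitem
  obtain ⟨hfm, hf2, hfn⟩ := mem_lst.1 hf
  have hne := List.ne_nil_of_mem hfn
  have hlen := hV.length_tail_le hfm
  have hev : (Expr.read 8 (adE (idE (.const 2) (.reg 3)) (.const 0))).eval s = f := by
    simp only [Expr.eval, adE, idE, hs.n, hs.m, hfdef]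
  refine .seq (.set (.seq (.set (.seq (.set (.seq ?_))))))
  rw [hev]
  simp only [Expr.eval]
  set s1 := ((s.setReg 9 f).setReg 11 0).setReg 14 1 with hs1
  have g1 : Good p V s1 := ((hs.setReg (by omega) (by omega)).setReg (by omega) (by omega)).setReg
    (by omega) (by omega)
  refine vertex_loop hfm hne (fun l s' => Good p V s' ∧ s'.conf = s.conf ∧ s'.reg 9 = f ∧
    s'.reg 14 = l.length + 1 ∧ (∀ x ∈ l, s.conf.lev x ≤ s'.reg 11) ∧
    (s'.reg 11 = 0 ∨ ∃ x ∈ l, s.conf.lev x = s'.reg 11) ∧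
    s'.time ≤ s.time + 3 + 4 * l.length) ?_ ?_ ?_ hV ?_
  · refine ⟨g1, rfl, by simp [hs1], by simp [hs1], by simp, Or.inl (by simp [hs1]), le_rfl⟩
  · rintro l s' ⟨h1, -, h2, h3, -⟩
    exact ⟨h1.toCtx, h3, h2⟩
  · rintro l y l' hl s' ⟨h1, h2, h3, h4, h5, h6, h7⟩ hy hlP
    have e5 : (levE (.reg 14) (.reg 9)).eval s'.tick = s.conf.lev y := by
      have : (vtxE (.reg 14) (.reg 9)).eval s'.tick = y := hy
      rw [← h2, levE, Expr.eval, this]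
      rfl
    have e5' : (levE (.reg 14) (.reg 9)).eval s'.tick.tick = s.conf.lev y := e5
    have hLy := hL y
    rw [List.length_append, List.length_singleton]
    by_cases hlt : s'.reg 11 < s.conf.lev y
    · refine .ite_true ?_ (.set ?_)
      · rw [Expr.eval, e5, Expr.eval, State.tick_reg, if_pos hlt]
        exact one_ne_zero
      rw [e5']
      refine ⟨by simpa using h4, (h1.tick.tick.setReg (by omega) (by omega)).setReg (by omega) hlP,
        h2, by simpa using h3, by simp, ?_, Or.inr ⟨y, by simp, by simp⟩, ?_⟩
      · intro x hx
        rcases List.mem_append.1 hx with hx | hx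
        · have := h5 x hx
          simp
          omega
        · rw [List.mem_singleton.1 hx]
          simp
      · change s'.time + 1 + 1 + 1 + 1 ≤ _
        omega
    · refine .ite_false ?_ (.skip ?_)
      · rw [Expr.eval, e5, Expr.eval, State.tick_reg, if_neg hlt]
      refine ⟨by simpa using h4, h1.tick.tick.setReg (by omega) hlP, h2, by simpa using h3, by simp,
        ?_, ?_, ?_⟩
      · intro x hx
        rcases List.mem_append.1 hx with hx | hx
        · simpa using h5 x hx
        · rw [List.mem_singleton.1 hx]
          simpa using hlt
      · rcases h6 with h6 | ⟨x, hx, h6⟩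
        · exact Or.inl (by simpa using h6)
        · exact Or.inr ⟨x, by simp [hx], by simpa using h6⟩
      · change s'.time + 1 + 1 + 1 ≤ _
        omega
  rintro s2 ⟨h1, h2, h3, -, h5, h6, h7⟩
  obtain ⟨x0, hx0, hx0e⟩ : ∃ x ∈ (V f).tail, s.conf.lev x = s2.reg 11 := by
    -- If no comparison ever recorded a level, all levels are 0 and any vertex attains the maximum.
    rcases h6 with h6 | h6
    · obtain ⟨y, hy⟩ := List.exists_mem_of_ne_nil _ (hV.tail_ne_nil hfm hne)
      exact ⟨y, hy, by have := h5 y hy; omega⟩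
    · exact h6
  obtain ⟨k, hk⟩ := hC.lev x0 (hV.tail_lt hfm hx0)
  have h11 : s2.reg 11 = lvl p.r k := by rw [← hx0e, hk]
  rw [h11] at h5 hx0e
  have hLx := hL x0
  refine .seq (.set (.seq ?_))
  simp only [Expr.eval, State.tick_reg, h3]
  refine (unlink_spec (f := f) hV (h1.tick.setReg (by omega) (by omega)) (by simp) hfm).mono ?_
  rintro s3 ⟨a1, a2, a3, a4, a5⟩
  refine .seq (.set (.seq ?_))
  have e11 : s3.reg 11 = lvl p.r k := by rw [a4 11 (by omega)]; simpa using h11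
  have e40 : s3.reg 40 = f := by rw [a4 40 (by omega)]; simp
  have e9 : s3.reg 9 = f := by rw [a4 9 (by omega)]; simpa using h3
  simp only [Expr.eval, e11]
  have ea : ∀ a < 7, s3.arr a = s2.arr a := a3
  refine (link_spec (f := f) (κ := 3 * lvl p.r k) hV (a1.setReg (by omega) (by omega))
    (by simp [e40]) hfm (by simp) (by omega) ?_).mono ?_
  · rw [State.setReg_arr, ea 4 (by omega)]
    exact a2
  rintro s4 ⟨b1, b2, b3, b4, b5⟩
  rw [State.setReg_arr, ea 4 (by omega)] at b2
  have hc4 : s4.conf = s.conf.put f (3 * lvl p.r k) := by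
    have ha : ∀ a < 7, a ≠ 4 → s4.arr a = s2.arr a := fun a ha ha4 =>
      (b3 a ha ha4).trans (ea a ha)
    rw [← h2]
    exact Conf.ext' b2 (ha 5 (by omega) (by omega)) (ha 6 (by omega) (by omega))
      (ha 0 (by omega) (by omega))
  have hI4 : s4.conf.Inv p V fun _ => False := by
    rw [hc4]
    exact hC.put hf h5 ⟨x0, hx0, hx0e⟩
  have hcx : s4.conf.CapExcept p V f := hc4 ▸ Conf.CapExcept.put hcap
  have hmem : ∀ x ∈ (V f).tail, f ∈ lst p V s4.conf.loc (3 * lvl p.r k) x := fun x hx => by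
    rw [hc4]
    exact mem_lst.2 ⟨hfm, Function.update_self _ _ _, List.mem_of_mem_tail hx⟩
  have f11 : s4.reg 11 = lvl p.r k := by rw [b4 11 (by omega)]; simpa using e11
  have f9 : s4.reg 9 = f := by rw [b4 9 (by omega)]; simpa using e9
  refine .seq (.set (.seq (.set ?_)))
  simp only [Expr.eval, b1.n]
  set s5 := (s4.setReg 10 p.n).setReg 14 1 with hs5
  have g5 : Good p V s5 := (b1.setReg (by omega) (by omega)).setReg (by omega) (by omega)
  have t5 : s5.time ≤ s.time + 14 * p.r + 23 := by
    change s4.time + 1 + 1 ≤ _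
    change s4.time ≤ s3.time + 1 + _ + _ at b5
    change s3.time ≤ s2.time + 1 + 1 + _ + _ at a5
    omega
  refine vertex_loop hfm hne (fun l s' => Good p V s' ∧ s'.conf = s4.conf ∧ s'.reg 9 = f ∧
    s'.reg 14 = l.length + 1 ∧ s'.reg 11 = lvl p.r k ∧
    (s'.reg 10 = p.n ∧ (∀ x ∈ l, (lst p V s4.conf.loc (3 * lvl p.r k) x).card ≤ lvl p.r k) ∨
      s'.reg 10 ∈ (V f).tail ∧
        lvl p.r k < (lst p V s4.conf.loc (3 * lvl p.r k) (s'.reg 10)).card) ∧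
    s'.time ≤ s5.time + 4 * l.length) ?_ ?_ ?_ hV ?_
  · exact ⟨g5, rfl, by simpa [hs5] using f9, by simp [hs5], by simpa [hs5] using f11,
      Or.inl ⟨by simp [hs5], by simp⟩, le_rfl⟩
  · rintro l s' ⟨h1, -, h2, h3, -⟩
    exact ⟨h1.toCtx, h3, h2⟩
  · rintro l y l' hl s' ⟨h1, h2, h3, h4, h5, h6, h7⟩ hy hlP
    have hyt : y ∈ (V f).tail := by simp [hl]
    have hyn := hV.tail_lt hfm hyt
    have hy1 : (vtxE (.reg 14) (.reg 9)).eval s'.tick = y := hy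
    have hy2 : (vtxE (.reg 14) (.reg 9)).eval s'.tick.tick = y := hy
    have ev := searchStep_eval h1.tick.toCtx hy1 h5
    rw [State.tick_arr, h1.cnt hyn.le, h2] at ev
    rw [List.length_append, List.length_singleton]
    by_cases hlt : lvl p.r k < (lst p V s4.conf.loc (3 * lvl p.r k) y).card
    · refine .ite_true ?_ (.set ?_)
      · rw [ev, if_pos hlt]
        exact one_ne_zero
      rw [hy2]
      refine ⟨by simpa using h4, (h1.tick.tick.setReg (by omega) (by omega)).setReg (by omega) hlP,
        h2, by simpa using h3, by simp, by simpa using h5, Or.inr ⟨by simpa using hyt,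
          by simpa using hlt⟩, ?_⟩
      change s'.time + 1 + 1 + 1 + 1 ≤ _
      omega
    · refine .ite_false ?_ (.skip ?_)
      · rw [ev, if_neg hlt]
      refine ⟨by simpa using h4, h1.tick.tick.setReg (by omega) hlP, h2, by simpa using h3, by simp,
        by simpa using h5, ?_, ?_⟩
      · rcases h6 with ⟨h6, h8⟩ | h6
        · refine Or.inl ⟨by simpa using h6, fun x hx => ?_⟩
          rcases List.mem_append.1 hx with hx | hx
          · exact h8 x hx
          · rw [List.mem_singleton.1 hx]
            exact not_lt.1 hlt
        · exact Or.inr (by simpa using h6)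
      · change s'.time + 1 + 1 + 1 ≤ _
        omega
  rintro s6 ⟨h1, h2, h3, -, h5, h6, h7⟩
  refine ⟨f, k, s6.reg 10, h1.tick, hf, h2.trans hc4, ?_, ?_, h5, rfl, ?_⟩
  · change s6.conf.Inv p V _
    rw [h2]
    exact hI4
  · rw [State.tick_time]
    omega
  · change s6.reg 10 = p.n ∧ s6.conf.Cap p V ∨ s6.reg 10 < p.n ∧ f ∈ lst p V s6.conf.loc _ _ ∧
      (lst p V s6.conf.loc _ _).card = _
    rw [h2]
    rcases h6 with ⟨h6, h8⟩ | ⟨h6, h8⟩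
    · refine Or.inl ⟨h6, fun x hx j => ?_⟩
      -- Only lists that contain `f` can have grown, and the loop has inspected exactly these.
      by_cases hfx : f ∈ lst p V s4.conf.loc (3 * lvl p.r j) x
      · obtain ⟨-, i1, i2⟩ := mem_lst.1 hfx
        have i3 := (mem_lst.1 (hmem x0 hx0)).2.1
        have : lvl p.r j = lvl p.r k := by omega
        rw [this]
        exact h8 x (hV.mem_tail hfm i2 hx)
      · have := hcx x hx j
        rwa [Finset.erase_eq_of_notMem hfx] at this
    · have hw := hV.tail_lt hfm h6
      have := hcx _ hw k
      rw [Finset.card_erase_of_mem (hmem _ h6)] at this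
      exact Or.inr ⟨hw, hmem _ h6, by omega⟩

end DynMatch

namespace DynMatch

/-! ## Randomized runs -/

/-- The expected value of `F`. -/
noncomputable def mean {α : Type*} (μ : PMF α) (F : α → ℝ≥0∞) : ℝ≥0∞ := ∑' a, μ a * F a

section mean

variable {α β : Type*} {μ : PMF α} {F G : α → ℝ≥0∞}

theorem mean_mono (h : ∀ a ∈ μ.support, F a ≤ G a) : mean μ F ≤ mean μ G := by
  refine ENNReal.tsum_le_tsum fun a => ?_
  by_cases ha : a ∈ μ.support
  · exact mul_le_mul_right (h a ha) _
  · rw [(PMF.apply_eq_zero_iff μ a).2 ha, zero_mul, zero_mul]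

theorem mean_const (c : ℝ≥0∞) : mean μ (fun _ => c) = c := by
  rw [mean, ENNReal.tsum_mul_right, μ.tsum_coe, one_mul]

theorem mean_mul_const (c : ℝ≥0∞) : mean μ (fun a => F a * c) = mean μ F * c := by
  simp only [mean, ← mul_assoc, ENNReal.tsum_mul_right]

theorem mean_pure (a : α) : mean (PMF.pure a) F = F a := by
  rw [mean, tsum_eq_single a]
  · simp
  · intro b hb
    simp [hb]

theorem mean_bind (ν : α → PMF β) (F : β → ℝ≥0∞) :
    mean (μ.bind ν) F = mean μ fun a => mean (ν a) F := by
  simp only [mean, PMF.bind_apply, ← ENNReal.tsum_mul_left, ← ENNReal.tsum_mul_right]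
  rw [ENNReal.tsum_comm]
  simp only [mul_assoc]

theorem mean_map (f : α → β) (F : β → ℝ≥0∞) : mean (μ.map f) F = mean μ (F ∘ f) := by
  rw [PMF.map, mean_bind]
  simp only [Function.comp_def, mean_pure]

theorem mean_uniform (N : ℕ) (F : Fin (N + 1) → ℝ≥0∞) :
    mean (PMF.uniformOfFintype (Fin (N + 1))) F = ((N + 1 : ℕ) : ℝ≥0∞)⁻¹ * ∑ k, F k := by
  simp only [mean, PMF.uniformOfFintype_apply, Fintype.card_fin, tsum_fintype, ← Finset.mul_sum]

end mean

/-- The program terminates for all outcomes of the random draws, in a state that satisfies `Q`, and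
the expected value of `F` is at most `b`. -/
def Cmd.Exp (c : Cmd) (s : State) (F : State → ℝ≥0∞) (Q : State → Prop) (b : ℝ≥0∞) : Prop :=
  ∃ μ, c.Run s μ ∧ (∀ s' ∈ μ.support, Q s') ∧ mean μ F ≤ b

namespace Cmd.Exp

variable {c c₁ c₂ : Cmd} {s : State} {F G : State → ℝ≥0∞} {Q Q' : State → Prop} {b b' : ℝ≥0∞}

theorem of_det (h : c.Det s fun s' => Q s' ∧ F s' ≤ b) : c.Exp s F Q b := by
  obtain ⟨s', h₁, h₂, h₃⟩ := h
  refine ⟨_, h₁, fun t ht => ?_, by rwa [mean_pure]⟩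
  rw [PMF.support_pure, Set.mem_singleton_iff] at ht
  rwa [ht]

theorem mono (h : c.Exp s F Q b) (hQ : ∀ s', Q s' → Q' s') (hb : b ≤ b') : c.Exp s F Q' b' :=
  let ⟨μ, h₁, h₂, h₃⟩ := h
  ⟨μ, h₁, fun s' hs' => hQ _ (h₂ s' hs'), h₃.trans hb⟩

theorem mul_const (h : c.Exp s F Q b) (a : ℝ≥0∞) : c.Exp s (fun s' => F s' * a) Q (b * a) :=
  let ⟨μ, h₁, h₂, h₃⟩ := h
  ⟨μ, h₁, h₂, (mean_mul_const a).trans_le (mul_le_mul_left h₃ a)⟩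

/-- The tower property: the bound for the second command may depend on the intermediate state, and
the first command bounds its mean. -/
theorem seq (h : c₁.Exp s F (fun s' => c₂.Exp s' G Q (F s')) b) : (Cmd.seq c₁ c₂).Exp s G Q b := by
  obtain ⟨μ, h₁, h₂, h₃⟩ := h
  choose! ν k₁ k₂ k₃ using h₂
  refine ⟨μ.bind ν, .seq _ _ _ _ _ h₁ k₁, fun s' hs' => ?_, ?_⟩
  · obtain ⟨a, ha, hs'⟩ := (PMF.mem_support_bind_iff _ _ _).1 hs'
    exact k₂ a ha s' hs'
  · rw [mean_bind]
    exact (mean_mono k₃).trans h₃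

theorem det_seq (h : c₁.Det s fun s' => c₂.Exp s' F Q b) : (Cmd.seq c₁ c₂).Exp s F Q b :=
  seq (F := fun _ => b) (of_det (h.mono fun _ hs' => ⟨hs', le_rfl⟩))

theorem rand_seq {x N : ℕ} {e : Expr} (he : e.eval s = N) (B : ℕ → ℝ≥0∞)
    (h : ∀ k ≤ N, c.Exp (s.setReg x k) F Q (B k))
    (hB : ∑ k ∈ Finset.range (N + 1), B k ≤ ((N + 1 : ℕ) : ℝ≥0∞) * b) :
    (Cmd.seq (.rand x e) c).Exp s F Q b := by
  obtain ⟨ν, hν⟩ := Classical.axiomOfChoice (r := fun (k : Fin (N + 1)) (μ : PMF State) =>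
    c.Run (s.setReg x k) μ ∧ (∀ s' ∈ μ.support, Q s') ∧ mean μ F ≤ B k)
    fun k => h k (by omega)
  subst he
  -- The continuation has to be a function of the state, so the drawn number is recovered from
  -- register `x`.
  refine ⟨_, .seq _ _ _ _ (fun s' => ν (Fin.ofNat _ (s'.reg x))) (.rand x e s) fun s' hs' => ?_,
    fun s' hs' => ?_, ?_⟩
  · obtain ⟨k', hk', rfl⟩ := (PMF.mem_support_map_iff _ _ _).1 hs'
    obtain ⟨k, -, hk⟩ := (PMF.mem_support_bind_iff _ _ _).1 hk'
    have hk : k' ∈ (PMF.pure (k : ℕ)).support := hk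
    rw [PMF.support_pure, Set.mem_singleton_iff] at hk
    subst hk
    simpa using (hν k).1
  · obtain ⟨a, ha, hs'⟩ := (PMF.mem_support_bind_iff _ _ _).1 hs'
    exact (hν _).2.1 s' hs'
  · rw [mean_bind, mean_map]
    change mean ((PMF.uniformOfFintype (Fin (e.eval s + 1))).bind fun k => PMF.pure (k : ℕ)) _ ≤ _
    rw [mean_bind]
    refine (mean_mono (G := fun k : Fin (e.eval s + 1) => B k) fun k _ => ?_).trans ?_
    · rw [mean_pure]
      simpa using (hν k).2.2
    · rw [mean_uniform, Fin.sum_univ_eq_sum_range B]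
      refine (mul_le_mul_right hB _).trans ?_
      rw [← mul_assoc, ENNReal.inv_mul_cancel, one_mul]
      · simp
      · exact ENNReal.natCast_ne_top _

theorem ite_true {e : Expr} (he : e.eval s ≠ 0) (h : c₁.Exp s.tick F Q b) :
    (Cmd.ite e c₁ c₂).Exp s F Q b :=
  let ⟨μ, h₁, h₂⟩ := h
  ⟨μ, .ite_true e c₁ c₂ s _ he h₁, h₂⟩

theorem ite_false {e : Expr} (he : e.eval s = 0) (h : c₂.Exp s.tick F Q b) :
    (Cmd.ite e c₁ c₂).Exp s F Q b :=
  let ⟨μ, h₁, h₂⟩ := h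
  ⟨μ, .ite_false e c₁ c₂ s _ he h₁, h₂⟩

/-- A loop with an invariant `I`, a supermartingale `F` and a measure `M` that decreases. -/
theorem while_inv {e : Expr} (I : State → Prop) (M : State → ℕ) (h₀ : I s)
    (h₁ : ∀ s, I s → e.eval s ≠ 0 → c.Exp s.tick F (fun s' => I s' ∧ M s' < M s) (F s))
    (h₂ : ∀ s, I s → e.eval s = 0 → Q s.tick ∧ G s.tick ≤ F s) :
    (Cmd.while e c).Exp s G Q (F s) := by
  induction hM : M s using Nat.strong_induction_on generalizing s with
  | _ k ih =>
    by_cases he : e.eval s = 0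
    · obtain ⟨h3, h4⟩ := h₂ s h₀ he
      refine of_det (.while_false he ⟨h3, h4⟩)
    · obtain ⟨μ, k₁, k₂, k₃⟩ := h₁ s h₀ he
      have : ∀ s' ∈ μ.support, (Cmd.while e c).Exp s' G Q (F s') := fun s' hs' =>
        ih (M s') (hM ▸ (k₂ s' hs').2) (k₂ s' hs').1 rfl
      choose! ν l₁ l₂ l₃ using this
      refine ⟨μ.bind ν, .while_true _ _ _ _ _ he k₁ l₁, fun s' hs' => ?_, ?_⟩
      · obtain ⟨a, ha, hs'⟩ := (PMF.mem_support_bind_iff _ _ _).1 hs'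
        exact l₂ a ha s' hs'
      · rw [mean_bind]
        exact (mean_mono l₃).trans k₃

end Cmd.Exp

/-! ## The random choice of a hyperedge -/

/-- The number of pairs of elements in weakly increasing order. -/
theorem card_sq_le_sum_rank (S : Finset ℕ) (d : ℕ → ℕ) :
    S.card ^ 2 ≤ 2 * ∑ e ∈ S, (S.filter fun g => d g ≤ d e).card := by
  -- The same pairs are counted by either coordinate; each pair is comparable in at least one
  -- direction.
  have h1 : ∑ e ∈ S, (S.filter fun g => d g ≤ d e).card =
      ∑ e ∈ S, (S.filter fun g => d e ≤ d g).card := by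
    simp only [Finset.card_filter]
    exact Finset.sum_comm
  have h2 : ∀ e ∈ S, S.card ≤
      (S.filter fun g => d g ≤ d e).card + (S.filter fun g => d e ≤ d g).card := fun e _ => by
    rw [← Finset.card_union_add_card_inter]
    refine le_trans (Finset.card_le_card fun g hg => ?_) (Nat.le_add_right _ _)
    rw [Finset.mem_union, Finset.mem_filter, Finset.mem_filter]
    rcases le_total (d g) (d e) with h | h
    · exact Or.inl ⟨hg, h⟩
    · exact Or.inr ⟨hg, h⟩
  calc S.card ^ 2 = ∑ e ∈ S, S.card := by rw [Finset.sum_const, smul_eq_mul, sq]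
    _ ≤ _ := Finset.sum_le_sum h2
    _ = _ := by rw [Finset.sum_add_distrib, ← h1, two_mul]

/-- With `z = η (s / 4 - rank)`, use `exp z ≤ 1 + z + z ^ 2`; as `|z| ≤ η s ≤ 1 / 4`, the square is
at most `η s / 4`. The mean rank is at least `s / 2`, so the linear term averages at most `-η s / 4`
and cancels it. -/
theorem sum_exp_rank_le (S : Finset ℕ) (d : ℕ → ℕ) {η : ℝ} (h₀ : 0 ≤ η)
    (h₁ : η * S.card ≤ 1 / 4) :
    ∑ e ∈ S, Real.exp (η * (S.card / 4 - ((S.filter fun g => d g ≤ d e).card : ℝ))) ≤ S.card := by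
  set s : ℝ := (S.card : ℝ) with hs
  have hs0 : 0 ≤ s := Nat.cast_nonneg _
  have hrank : s ^ 2 ≤ 2 * ∑ e ∈ S, ((S.filter fun g => d g ≤ d e).card : ℝ) := by
    rw [hs]
    exact_mod_cast card_sq_le_sum_rank S d
  have key : ∀ e ∈ S, Real.exp (η * (s / 4 - ((S.filter fun g => d g ≤ d e).card : ℝ))) ≤
      1 + η * (s / 4 - ((S.filter fun g => d g ≤ d e).card : ℝ)) + η * s / 4 := fun e _ => by
    set R : ℝ := ((S.filter fun g => d g ≤ d e).card : ℝ) with hR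
    have hR0 : 0 ≤ R := Nat.cast_nonneg _
    have hRs : R ≤ s := Nat.cast_le.2 (Finset.card_filter_le _ _)
    have hz : |η * (s / 4 - R)| ≤ η * s := by
      rw [abs_mul, abs_of_nonneg h₀]
      refine mul_le_mul_of_nonneg_left ?_ h₀
      rw [abs_le]
      constructor <;> linarith
    have h2 := Real.abs_exp_sub_one_sub_id_le (hz.trans (by linarith))
    have h3 := (abs_le.1 h2).2
    have h4 : (η * (s / 4 - R)) ^ 2 ≤ (η * s) * (1 / 4) := by
      rw [← sq_abs, sq]
      exact mul_le_mul hz (hz.trans h₁) (abs_nonneg _) (by positivity)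
    linarith
  refine (Finset.sum_le_sum key).trans ?_
  simp only [Finset.sum_add_distrib, Finset.sum_const, nsmul_eq_mul, ← Finset.mul_sum,
    Finset.sum_sub_distrib, ← hs]
  nlinarith [mul_le_mul_of_nonneg_left hrank h₀]

end DynMatch

namespace DynMatch

/-! ## Emptying the limbo -/

/-- Take a hyperedge out of the limbo, and match a random hyperedge if a vertex has become
overloaded. -/
def pop : Cmd :=
  .seq place <| .ite (.lt (.reg 10) (.reg 3)) (.seq (.rand 13 (.reg 11)) fixWith) .skip

/-- Empty the limbo. -/
def settle : Cmd := .while (.lt (.const 0) (.read 7 (idE (.const 2) (.reg 3)))) pop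

variable {p : Params} {V : ℕ → List ℕ} {s : State} {d : ℕ → ℕ} {θ : ℝ}

/-- A uniform slot holds a uniform element of the set. -/
theorem SetRep.sum_item {M : Type*} [AddCommMonoid M] {m i : ℕ} {c it po : ℕ → ℕ} {X : Finset ℕ}
    (h : SetRep m c it po i X) (F : ℕ → M) :
    ∑ y ∈ Finset.range X.card, F (it (i * m + y)) = ∑ e ∈ X, F e := by
  refine Finset.sum_nbij' (fun y => it (i * m + y)) (fun f => po (i * m + f)) ?_ ?_ ?_ ?_ ?_
  · exact fun y hy => (h.item y (Finset.mem_range.1 hy)).1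
  · exact fun f hf => Finset.mem_range.2 (h.pos f hf).2.1
  · exact fun y hy => (h.item y (Finset.mem_range.1 hy)).2
  · exact fun f hf => (h.pos f hf).2.2
  · exact fun _ _ => rfl

namespace Conf

/-- The potential, where `d` gives the times of deletion. -/
def pot (p : Params) (V : ℕ → List ℕ) (d : ℕ → ℕ) (C : Conf) : ℕ :=
  -- `50 r` pays for taking a hyperedge out of the limbo. `150 r ≥ 2 (50 r + moveCost)`, so falling
  -- levels pay for what they send to the limbo. `16000 r ^ 3` makes the average gain of `s / 2`
  -- outweigh the cost `4000 r ^ 3 s` of a matching, with room for the second-order term of the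
  -- exponential.
  150 * p.r * C.sumLev p + 16000 * p.r ^ 3 * C.late p V d + 50 * p.r * C.limbo p V

theorem limbo_le (C : Conf) : C.limbo p V ≤ p.m :=
  (Finset.card_filter_le _ _).trans (Finset.card_range _).le

theorem LevB.sumLev_le {C : Conf} (h : C.LevB p) : C.sumLev p ≤ p.n * p.P := by
  refine (Finset.sum_le_card_nsmul _ _ p.P fun x _ => ?_).trans (by simp)
  have := h x
  omega

/-- A bound on the number of rounds. -/
def rounds (p : Params) (V : ℕ → List ℕ) (C : Conf) : ℕ :=
  (p.n * p.P - C.sumLev p) * (p.m + 1) + C.limbo p V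

end Conf

/-- The memory is in the state that is kept up between the rounds of the algorithm. -/
structure Tidy (p : Params) (V : ℕ → List ℕ) (s : State) : Prop extends Good p V s where
  levB : s.conf.LevB p
  inv : s.conf.Inv p V fun _ => False
  cap : s.conf.Cap p V

/-- The exponential of the time and the potential. -/
noncomputable def weight (p : Params) (V : ℕ → List ℕ) (d : ℕ → ℕ) (θ : ℝ) (s : State) : ℝ≥0∞ :=
  ENNReal.ofReal (Real.exp (θ * ((s.time + s.conf.pot p V d : ℕ) : ℝ)))

theorem weight_le_of_le {s' : State} {b : ℕ} {V' : ℕ → List ℕ} {d' : ℕ → ℕ} (hθ : 0 ≤ θ)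
    (h : s'.time + s'.conf.pot p V' d' ≤ s.time + s.conf.pot p V d + b) :
    weight p V' d' θ s' ≤ weight p V d θ s * ENNReal.ofReal (Real.exp (θ * b)) := by
  rw [weight, weight, ← ENNReal.ofReal_mul (Real.exp_pos _).le, ← Real.exp_add, ← mul_add]
  refine ENNReal.ofReal_le_ofReal (Real.exp_le_exp.2 (mul_le_mul_of_nonneg_left ?_ hθ))
  exact_mod_cast h

theorem weight_mono {s' : State} (hθ : 0 ≤ θ)
    (h : s'.time + s'.conf.pot p V d ≤ s.time + s.conf.pot p V d) :
    weight p V d θ s' ≤ weight p V d θ s := by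
  simpa using weight_le_of_le (b := 0) hθ h

/-- The number of hyperedges. -/
def present (p : Params) (V : ℕ → List ℕ) : ℕ :=
  ((Finset.range p.m).filter fun f => V f ≠ []).card

theorem lst_card_le_present {loc : ℕ → ℕ} {κ u : ℕ} : (lst p V loc κ u).card ≤ present p V := by
  refine Finset.card_le_card fun f hf => ?_
  obtain ⟨h1, -, h2⟩ := mem_lst.1 hf
  exact Finset.mem_filter.2 ⟨Finset.mem_range.2 h1, List.ne_nil_of_mem h2⟩

/-- In units of `r ^ 3 S`, using `2 ≤ r`: 40 for time, 690 for limbo entries with their moves, 1200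
for levels and 2000 for released samples, which is below 4000. `R` counts the sample elements that
cease to be late. -/
theorem fix_balance {r S t t' L L' B B' A A' R : ℕ} (hr : 1 < r)
    (ht : t' + (10 * r + 18) * B ≤ t + (10 * r + 18) * B' + 80 * r ^ 2 * S)
    (hB : B' ≤ B + 10 * r ^ 2 * S) (hL : L' ≤ L + 8 * r ^ 2 * S) (hA : 8 * (A' + R) ≤ 8 * A + S) :
    t' + (150 * r * L' + 16000 * r ^ 3 * A' + 50 * r * B') + 16000 * r ^ 3 * R ≤
      t + (150 * r * L + 16000 * r ^ 3 * A + 50 * r * B) + 4000 * r ^ 3 * S := by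
  have h1 : (60 * r + 18) * B' ≤ (60 * r + 18) * B + (60 * r + 18) * (10 * r ^ 2 * S) := by
    rw [← mul_add]
    exact Nat.mul_le_mul_left _ hB
  have h2 := Nat.mul_le_mul_left (150 * r) hL
  have h3 := Nat.mul_le_mul_left (2000 * r ^ 3) hA
  have h4 : 2 * (r ^ 2 * S) ≤ r * (r ^ 2 * S) := Nat.mul_le_mul_right _ hr
  have e1 : r ^ 3 = r * r ^ 2 := by ring
  simp only [e1] at h3 ⊢
  nlinarith [h1, h2, h3, h4, ht]

/-- The supermartingale step. Without overload, the freed `50 r` pays for the placement. Otherwise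
`fix_balance` leaves the factor `exp (η (s / 4 - rank))` with `η = 16000 r ^ 3 θ`, whose average
over the draw is at most 1; `hθ'` gives `η s ≤ 1 / 4`, since the sample consists of present
hyperedges. -/
theorem pop_spec (hV : WF p V) (hr : 1 < p.r) (hs : Tidy p V s) (hpos : 0 < s.conf.limbo p V)
    (hθ : 0 ≤ θ) (hθ' : θ * (64000 * p.r ^ 3 * present p V) ≤ 1) :
    pop.Exp s.tick (weight p V d θ)
      (fun s' => Tidy p V s' ∧ s'.conf.rounds p V < s.conf.rounds p V) (weight p V d θ s) := by
  have hm := hs.levB.sumLev_le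
  have hlm := s.conf.limbo_le (p := p) (V := V)
  refine .det_seq ((place_spec hV hs.tick hs.levB hs.inv hs.cap hpos).mono ?_)
  rintro s1 ⟨f, k, w, h1, h2, h3, h4, h5, h6, h7, h8⟩
  have ec : s.tick.conf = s.conf := rfl
  rw [ec] at h2 h3
  have b1 := Conf.limbo_put h2 (κ := 3 * lvl p.r k) (by omega)
  have b2 : s1.conf.late p V d = s.conf.late p V d := h3 ▸ Conf.late_put h2 _
  have b3 : s1.conf.sumLev p = s.conf.sumLev p := h3 ▸ rfl
  have b4 : s1.conf.LevB p := h3 ▸ hs.levB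
  rw [← h3] at b1
  rw [State.tick_time] at h5
  rcases h8 with ⟨rfl, h8⟩ | ⟨hw, hf, hS⟩
  · refine .ite_false (by simp [Expr.eval, h7, h1.n]) (.of_det (.skip
      ⟨⟨⟨h1.tick, b4, h4, h8⟩, ?_⟩, weight_mono hθ ?_⟩))
    · change s1.conf.rounds p V < _
      rw [Conf.rounds, Conf.rounds, b3, ← b1]
      omega
    · change s1.time + 1 + s1.conf.pot p V d ≤ _
      rw [Conf.pot, Conf.pot, b2, b3, ← b1, mul_add (50 * p.r)]
      omega
  · have hcx : s1.conf.CapExcept p V f := h3 ▸ Conf.CapExcept.put hs.cap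
    set S := lst p V s1.conf.loc (3 * lvl p.r k) w with hSdef
    have hrep : SetRep p.m (s1.arr 7) (s1.arr 8) (s1.arr 9) (3 * lvl p.r k * (p.n + 1) + w) S :=
      h1.lists _ _ hw.le
    refine .ite_true (by simp [Expr.eval, h7, h1.n, hw]) ?_
    set g : ℕ → ℝ := fun e =>
      Real.exp (θ * (16000 * p.r ^ 3) * (S.card / 4 - ((S.filter fun g => d g ≤ d e).card : ℝ)))
      with hg
    refine .rand_seq (N := lvl p.r k) h6
      (fun y => weight p V d θ s * ENNReal.ofReal (g (s1.pick p w (lvl p.r k) y))) ?_ ?_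
    · intro y hy
      have hlP : lvl p.r k ≤ p.P := by
        have := hrep.card_le
        have := p.bounds
        omega
      have he : s1.pick p w (lvl p.r k) y ∈ S := (hrep.item y (by omega)).1
      obtain ⟨c1, c2, c3, c4, c5, c6, -⟩ := Conf.fix_spec (d := d) hV hr h4 hcx hw hf hS he
      refine .of_det ((fixWith_spec (s := s1.tick.setReg 13 y) (f := f) (w := w) (k := k) (y := y)
        hV hr (h1.tick.setReg (by omega) (by omega)) b4 h4 hcx hw hf hS (by simpa using h7)
        (by simpa using h6) (by simp) hy).mono ?_)
      rintro s2 ⟨d1, d2, d3, d4⟩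
      have d2' : s2.conf = s1.conf.fix p V w k (s1.pick p w (lvl p.r k) y) := d2
      rw [← d2', ← hS] at c3 c5 c6
      rw [← d2'] at c1 c2 c4
      refine ⟨⟨⟨d1, d3, c1, c2⟩, ?_⟩, ?_⟩
      · have := d3.sumLev_le
        have hlm' := s2.conf.limbo_le (p := p) (V := V)
        rw [Conf.rounds, Conf.rounds, ← b3]
        -- One unit of level growth is worth `m + 1` rounds, more than the limbo can ever hold.
        have e1 : p.n * p.P - s1.conf.sumLev p =
          (p.n * p.P - s2.conf.sumLev p) + (s2.conf.sumLev p - s1.conf.sumLev p - 1) + 1 := by omega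
        rw [e1, add_mul, one_mul, add_mul]
        omega
      · rw [← hS] at d4
        have key := fix_balance hr d4 c3 c5 c6
        change s2.time + s2.conf.pot p V d + _ ≤ s1.time + 1 + 1 + s1.conf.pot p V d + _ at key
        have e2 : s1.time + 1 + 1 + s1.conf.pot p V d ≤ s.time + s.conf.pot p V d := by
          rw [Conf.pot, Conf.pot, b2, b3, ← b1, mul_add (50 * p.r)]
          omega
        rw [weight, weight, ← ENNReal.ofReal_mul (Real.exp_pos _).le, hg, ← Real.exp_add]
        refine ENNReal.ofReal_le_ofReal (Real.exp_le_exp.2 ?_)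
        rw [mul_assoc θ, ← mul_add]
        refine mul_le_mul_of_nonneg_left ?_ hθ
        have key' : ((s2.time + s2.conf.pot p V d : ℕ) : ℝ) + 16000 * p.r ^ 3 *
            ((S.filter fun g => d g ≤ d (s1.pick p w (lvl p.r k) y)).card : ℝ) ≤
            ((s.time + s.conf.pot p V d : ℕ) : ℝ) + 4000 * p.r ^ 3 * S.card := by
          exact_mod_cast key.trans (Nat.add_le_add_right e2 _)
        linarith
    · rw [← Finset.mul_sum, mul_comm _ (weight p V d θ s)]
      refine mul_le_mul_right ?_ _
      have hsum := hrep.sum_item fun e => ENNReal.ofReal (g e)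
      change ∑ y ∈ _, ENNReal.ofReal (g (s1.pick p w (lvl p.r k) y)) = _ at hsum
      rw [← hS, hsum,
        ← ENNReal.ofReal_sum_of_nonneg fun e _ => (Real.exp_pos _).le, ← ENNReal.ofReal_natCast]
      refine ENNReal.ofReal_le_ofReal (sum_exp_rank_le S d (by positivity) ?_)
      have hcard : (S.card : ℝ) ≤ present p V := Nat.cast_le.2 lst_card_le_present
      have : θ * (64000 * p.r ^ 3 * S.card) ≤ θ * (64000 * p.r ^ 3 * present p V) := by gcongr
      linarith

theorem settle_spec (hV : WF p V) (hr : 1 < p.r) (hs : Tidy p V s)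
    (hθ : 0 ≤ θ) (hθ' : θ * (64000 * p.r ^ 3 * present p V) ≤ 1) :
    settle.Exp s (weight p V d θ) (fun s' => Tidy p V s' ∧ s'.conf.limbo p V = 0)
      (weight p V d θ s * ENNReal.ofReal (Real.exp θ)) := by
  have hcount : ∀ s, Tidy p V s → (Expr.read 7 (idE (.const 2) (.reg 3))).eval s =
      s.conf.limbo p V := fun s hs => by
    simp only [Expr.eval, idE, hs.n]
    exact hs.cnt le_rfl
  refine .while_inv (F := fun s => weight p V d θ s * ENNReal.ofReal (Real.exp θ)) (Tidy p V)
    (fun s => s.conf.rounds p V) hs (fun s hs he => ?_) fun s hs he => ?_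
  · refine (pop_spec hV hr hs ?_ hθ hθ').mul_const _
    rw [Expr.eval, hcount s hs] at he
    by_contra h
    exact he (if_neg h)
  · refine ⟨⟨⟨hs.toGood.tick, hs.levB, hs.inv, hs.cap⟩, ?_⟩, ?_⟩
    · rw [Expr.eval, hcount s hs] at he
      by_contra h
      exact one_ne_zero ((if_pos (Nat.pos_of_ne_zero h)).symm.trans he)
    · have : s.tick.time + s.tick.conf.pot p V d ≤ s.time + s.conf.pot p V d + 1 := by
        change s.time + 1 + s.conf.pot p V d ≤ _
        omega
      simpa using weight_le_of_le hθ this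

end DynMatch

namespace DynMatch

/-! ## Changing the hypergraph -/

namespace Conf

variable {p : Params} {V : ℕ → List ℕ} {C : Conf} {κ u i : ℕ} {d d' : ℕ → ℕ} {l : List ℕ}

section insert

variable (hi : V i = [])

include hi

theorem lst_insert (h : κ ≠ 2) :
    lst p (Function.update V i l) (C.put i 2).loc κ u = lst p V C.loc κ u := by
  ext f
  simp only [mem_lst, put]
  by_cases hf : f = i
  · subst hf
    simp [hi, h.symm]
  · simp [hf]

omit hi in
theorem limbo_insert :
    (C.put i 2).limbo p (Function.update V i l) ≤ C.limbo p V + 1 := by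
  refine le_trans (Finset.card_le_card fun f hf => ?_) (Finset.card_insert_le i _)
  simp only [mem_lst, put, Finset.mem_insert] at hf ⊢
  by_cases hfi : f = i
  · exact Or.inl hfi
  · rw [Function.update_of_ne hfi, Function.update_of_ne hfi] at hf
    exact Or.inr hf

theorem Cap.insert (hC : C.Cap p V) : (C.put i 2).Cap p (Function.update V i l) := by
  intro x hx k
  rw [lst_insert hi (by omega)]
  exact hC x hx k

theorem Inv.insert (hC : C.Inv p V fun _ => False) :
    (C.put i 2).Inv p (Function.update V i l) fun _ => False := by
  have hout : ∀ e < p.m, C.out e ≠ 0 → Function.update V i l e = V e := fun e he ho =>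
    Function.update_of_ne (by rintro rfl; exact (hC.out e he ho).1 hi) _ _
  refine ⟨fun f hf hne => ?_, fun e he ho => ?_, fun x hx hl => ?_, hC.lev⟩
  · by_cases hfi : f = i
    · left
      simp [Conf.put, hfi]
    · rw [Function.update_of_ne hfi] at hne ⊢
      have : (C.put i 2).loc f = C.loc f := Function.update_of_ne hfi _ _
      rw [this]
      rcases hC.loc f hf hne with h | h | ⟨e, he, h1, h2, h3⟩
      · exact Or.inl h
      · exact Or.inr (Or.inl h)
      · exact Or.inr (Or.inr ⟨e, he, h1, h2, by rwa [hout e he h2]⟩)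
  · obtain ⟨h1, h2⟩ := hC.out e he ho
    rw [hout e he ho, lst_insert hi (by omega)]
    refine ⟨h1, fun _ => ?_⟩
    have : (C.put i 2).loc e = C.loc e := Function.update_of_ne (by rintro rfl; exact h1 hi) _ _
    rw [this]
    exact h2 id
  · obtain ⟨h1, h2, h3⟩ := hC.mate x hx hl
    exact ⟨h1, h2, (hout _ h1 h2).symm ▸ h3⟩

omit hi in
-- All deletion times shift alike, so comparisons persist and only the new hyperedge can be added.
theorem late_insert (hd : ∀ f, d f = d' f + 1) :
    (C.put i 2).late p (Function.update V i l) d' ≤ C.late p V d + 1 := by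
  refine le_trans (Finset.card_le_card fun f hf => ?_) (Finset.card_insert_le i _)
  rw [Finset.mem_insert]
  by_cases hfi : f = i
  · exact Or.inl hfi
  · simp only [mem_lateSet, put, Function.update_of_ne hfi] at hf
    simp only [mem_lateSet, hd, add_le_add_iff_right]
    exact Or.inr hf

end insert

section delete

theorem lst_delete : lst p (Function.update V i []) C.loc κ u = (lst p V C.loc κ u).erase i := by
  ext f
  simp only [mem_lst, Finset.mem_erase]
  by_cases hf : f = i
  · simp [hf]
  · simp [hf]

theorem limbo_delete : C.limbo p (Function.update V i []) ≤ C.limbo p V := by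
  rw [limbo, lst_delete]
  exact Finset.card_erase_le

theorem Cap.delete (hC : C.Cap p V) : C.Cap p (Function.update V i []) := by
  intro x hx k
  rw [lst_delete]
  exact Finset.card_erase_le.trans (hC x hx k)

theorem Inv.delete (hC : C.Inv p V fun _ => False) (ho : C.out i = 0) :
    C.Inv p (Function.update V i []) fun _ => False := by
  have hout : ∀ e, C.out e ≠ 0 → Function.update V i [] e = V e := fun e he =>
    Function.update_of_ne (by rintro rfl; exact he ho) _ _
  refine ⟨fun f hf hne => ?_, fun e he hoe => ?_, fun x hx hl => ?_, hC.lev⟩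
  · have hfi : f ≠ i := by
      rintro rfl
      exact hne (Function.update_self _ _ _)
    rw [Function.update_of_ne hfi] at hne ⊢
    rcases hC.loc f hf hne with h | h | ⟨e, he, h1, h2, h3⟩
    · exact Or.inl h
    · exact Or.inr (Or.inl h)
    · exact Or.inr (Or.inr ⟨e, he, h1, h2, by rwa [hout e h2]⟩)
  · obtain ⟨h1, h2⟩ := hC.out e he hoe
    obtain ⟨h3, k, h4, h5⟩ := h2 id
    rw [hout e hoe, lst_delete]
    exact ⟨h1, fun _ => ⟨h3, k, h4, Finset.card_erase_le.trans h5⟩⟩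
  · obtain ⟨h1, h2, h3⟩ := hC.mate x hx hl
    exact ⟨h1, h2, (hout _ h2).symm ▸ h3⟩

/-- No other hyperedge owed it to `i` that it is not late, since `i` is the first to be deleted. -/
theorem late_delete (hi : d i = 0) (hd : ∀ f, f ≠ i → d f = d' f + 1) :
    C.late p (Function.update V i []) d' ≤ C.late p V d := by
  refine Finset.card_le_card fun f hf => ?_
  rw [mem_lateSet] at hf ⊢
  obtain ⟨h1, h2, h3⟩ := hf
  have hfi : f ≠ i := by
    rintro rfl
    exact h2 (Function.update_self _ _ _)
  rw [Function.update_of_ne hfi] at h2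
  refine ⟨h1, h2, ?_⟩
  rintro ⟨e, he, h4, h5⟩
  have hei : e ≠ i := by
    rintro rfl
    rw [hi, hd f hfi] at h5
    omega
  rw [hd f hfi, hd e hei] at h5
  exact h3 ⟨e, he, h4, by omega⟩

/-- The benefit of fixed deletion times: when `i` is deleted, every other member of its sample has a
larger deletion time and was counted as late already. -/
theorem unmatch_late_first (hi : d i = 0) (hd : ∀ f, f ≠ i → d f = d' f + 1) :
    (C.unmatch p V i).late p V d ≤ C.late p V d + 1 := by
  refine (unmatch_late i).trans (Nat.add_le_add_left ?_ _)
  refine (Finset.card_le_card (t := {i}) fun f hf => ?_).trans (by simp)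
  rw [Finset.mem_filter, hi] at hf
  rw [Finset.mem_singleton]
  by_contra hfi
  rw [hd f hfi] at hf
  omega

end delete

end Conf

/-! ## The main program -/

/-- Append a vertex to the vertex list of the hyperedge in register `1`. -/
def push (e : Expr) : Cmd :=
  .seq (.write 3 (adE (.read 2 (.reg 1)) (.reg 1)) e) <|
  .write 2 (.reg 1) (.add (.read 2 (.reg 1)) (.const 1))

/-- Store the hyperedge in register `1` and put it into the limbo. -/
def insertCmd : Cmd :=
  .seq (push (.reg 3)) <|
  .seq (.set 14 (.const 0)) <|
  .seq (.upTo 14 (.reg 2) (push (.read 1 (.reg 14)))) <|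
  .seq (.set 40 (.reg 1)) <| .seq (.set 41 (.const 2)) link

/-- Remove the hyperedge in register `1`. -/
def deleteCmd : Cmd :=
  .seq (.ite (.read 0 (.reg 1)) (.seq (.set 20 (.reg 1)) unmatch) .skip) <|
  .seq (.set 40 (.reg 1)) <|
  .seq unlink <|
  .write 2 (.reg 1) (.const 0)

/-- The algorithm. -/
def program : Cmd := .seq (.ite (.reg 0) insertCmd deleteCmd) settle

variable {p : Params} {V : ℕ → List ℕ} {s : State} {d d' : ℕ → ℕ} {i x : ℕ} {l t : List ℕ}

theorem Ctx.push (hs : Ctx p (Function.update V i l) s) (hi : i < p.m) (h1 : s.reg 1 = i)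
    {e : Expr} (he : e.eval s = x) (hx : x ≤ p.P) (hl : l.length < p.P) :
    (push e).Det s fun s' => Ctx p (Function.update V i (l ++ [x])) s' ∧ s'.reg = s.reg ∧
      (∀ a, a ≠ 2 → a ≠ 3 → s'.arr a = s.arr a) ∧ s'.time = s.time + 2 := by
  have hdeg := hs.deg i hi
  rw [Function.update_self] at hdeg
  refine .seq (.write (.write ?_))
  have e1 : (adE (.read 2 (.reg 1)) (.reg 1)).eval s = l.length * p.m + i := by
    simp only [adE, Expr.eval, h1, hdeg, hs.m]
  rw [e1, he]
  have e2 : (Expr.add (.read 2 (.reg 1)) (.const 1)).eval (s.setArr 3 (l.length * p.m + i) x) =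
      l.length + 1 := by
    simp [Expr.eval, h1, hdeg]
  rw [e2]
  have e3 : (Expr.reg 1).eval (s.setArr 3 (l.length * p.m + i) x) = i := h1
  rw [e3]
  refine ⟨⟨hs.n, hs.m, hs.r, ?_, ?_, ?_⟩, rfl, ?_, rfl⟩
  · exact max_le (max_le hs.peak hx) hl
  · intro f hf
    have := hs.deg f hf
    by_cases hfi : f = i
    · simp [hfi]
    · simpa [hfi] using this
  · intro f hf k hk
    have ha : ((s.setArr 3 (l.length * p.m + i) x).setArr 2 i (l.length + 1)).arr 3 =
        Function.update (s.arr 3) (l.length * p.m + i) x := by simp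
    rw [ha]
    by_cases hfi : f = i
    · subst hfi
      simp only [Function.update_self, List.length_append, List.length_singleton] at hk ⊢
      by_cases hkl : k = l.length
      · subst hkl
        simp
      · have hk' : k < l.length := by omega
        rw [Function.update_of_ne, List.getElem_append_left hk']
        · have := hs.vtx f hf k (by simpa using hk')
          simpa using this
        · exact fun h => hkl ((mul_add_eq_iff hf hf).1 h).1
    · have := hs.vtx f hf k (by simpa [hfi] using hk)
      rw [Function.update_of_ne fun h => hfi ((mul_add_eq_iff hf hi).1 h).2]
      simpa [hfi] using this
  · intro a h2 h3
    simp [h2, h3]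

theorem insertCmd_spec (hV : WF p (Function.update V i (p.n :: t))) (hs : Good p V s) (hi : i < p.m)
    (hVi : V i = []) (h1 : s.reg 1 = i) (h2 : s.reg 2 = t.length)
    (ht : ∀ j (h : j < t.length), s.arr 1 j = t[j]) :
    insertCmd.Det s fun s' => Good p (Function.update V i (p.n :: t)) s' ∧
      s'.conf = s.conf.put i 2 ∧ s'.time ≤ s.time + 9 * p.r + 14 := by
  have hb := p.bounds
  have hlen := hV.length_le hi
  have hmem : ∀ x ∈ t, x ≤ p.n := fun x hx => hV.le hi (by simp [hx])
  rw [Function.update_self, List.length_cons] at hlen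
  have h0 : Ctx p (Function.update V i []) s := by
    rw [← hVi, Function.update_eq_self]
    exact hs.toCtx
  refine .seq ((h0.push (e := .reg 3) hi h1 hs.n (by omega) (by simp; omega)).mono ?_)
  rintro s1 ⟨a1, a2, a3, a4⟩
  refine .seq (.set (.seq ?_))
  simp only [Expr.eval]
  refine Cmd.Det.for_loop t.length (fun k s' => Ctx p (Function.update V i (p.n :: t.take k)) s' ∧
    s'.reg 14 = k ∧ s'.reg 1 = i ∧ s'.reg 2 = t.length ∧ s'.time = s.time + 3 + 4 * k ∧
    ∀ a, a ≠ 2 → a ≠ 3 → s'.arr a = s.arr a) (a := 0) (Nat.zero_le _) ?_ ?_ ?_ ?_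
  · refine ⟨a1.setReg (by omega) (by omega), by simp, by simp [a2, h1], by simp [a2, h2], ?_, a3⟩
    rw [State.setReg_time, a4]
  · rintro k s' ⟨b1, b2, b3, b4, b5, b6⟩
    exact ⟨b2, b4⟩
  · rintro k s' - hk ⟨b1, b2, b3, b4, b5, b6⟩
    refine (b1.tick.push (e := .read 1 (.reg 14)) (x := t[k]) hi b3 ?_ ?_ ?_).mono ?_
    · simp only [Expr.eval, State.tick_arr, State.tick_reg, b2]
      rw [b6 1 (by omega) (by omega), ht k hk]
    · have := hmem _ (List.getElem_mem hk)
      omega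
    · simp only [List.length_cons, List.length_take]
      omega
    · rintro s'' ⟨c1, c2, c3, c4⟩
      refine ⟨by rw [c2]; exact b2, ?_, by simp, by simp [c2, b3], by simp [c2, b4], ?_, ?_⟩
      · rw [List.cons_append, List.take_append_getElem hk] at c1
        exact c1.setReg (by omega) (by omega)
      · rw [State.setReg_time, c4, State.tick_time, b5]
        omega
      · intro a ha ha'
        rw [State.setReg_arr, c3 a ha ha', State.tick_arr, b6 a ha ha']
  rintro s2 ⟨b1, b2, b3, b4, b5, b6⟩
  rw [List.take_length] at b1
  refine .seq (.set (.seq (.set ?_)))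
  simp only [Expr.eval, State.tick_reg, b3]
  have harr : ∀ a, a ≠ 2 → a ≠ 3 → ((s2.tick.setReg 40 i).setReg 41 2).arr a = s.arr a := b6
  refine (link_spec (f := i) (κ := 2) hV ((b1.tick.setReg (by omega) (by omega)).setReg (by omega)
    (by omega)) (by simp) hi (by simp) (by omega) ?_).mono ?_
  · intro κ u hu
    rw [harr 7 (by omega) (by omega), harr 8 (by omega) (by omega), harr 9 (by omega) (by omega),
      harr 4 (by omega) (by omega)]
    have h3 : (lst p (Function.update V i (p.n :: t)) (s.arr 4) κ u).erase i =
        lst p V (s.arr 4) κ u := by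
      ext f
      simp only [mem_lst, Finset.mem_erase]
      by_cases hf : f = i
      · simp [hf, hVi]
      · simp [hf]
    beta_reduce
    rw [h3]
    exact hs.lists κ u hu
  · rintro s3 ⟨c1, c2, c3, c4, c5⟩
    rw [harr 4 (by omega) (by omega)] at c2
    refine ⟨c1, Conf.ext' c2 ?_ ?_ ?_, ?_⟩
    · exact (c3 5 (by omega) (by omega)).trans (harr 5 (by omega) (by omega))
    · exact (c3 6 (by omega) (by omega)).trans (harr 6 (by omega) (by omega))
    · exact (c3 0 (by omega) (by omega)).trans (harr 0 (by omega) (by omega))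
    · change s3.time ≤ s2.time + 1 + 1 + 1 + _ + _ at c5
      omega

/-- The configuration after the hyperedge `i` has been removed from the matching. -/
def Conf.release (p : Params) (V : ℕ → List ℕ) (C : Conf) (i : ℕ) : Conf :=
  if C.out i = 0 then C else C.unmatch p V i

theorem deleteCmd_spec (hV : WF p V) (hs : Good p V s) (hL : s.conf.LevB p) (hi : i < p.m)
    (hVi : V i ≠ []) (h1 : s.reg 1 = i) :
    deleteCmd.Det s fun s' => Good p (Function.update V i []) s' ∧
      s'.conf = s.conf.release p V i ∧
      s'.time + moveCost p * s.conf.limbo p V ≤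
        s.time + moveCost p * (s.conf.release p V i).limbo p V + 13 * p.r + 18 := by
  have hb := p.bounds
  have hfirst : (Cmd.ite (.read 0 (.reg 1)) (.seq (.set 20 (.reg 1)) unmatch) .skip).Det s
      fun s' => Good p V s' ∧ s'.conf = s.conf.release p V i ∧ s'.reg 1 = i ∧
        s'.time + moveCost p * s.conf.limbo p V ≤
          s.time + moveCost p * (s.conf.release p V i).limbo p V + 8 * p.r + 9 := by
    have he : (Expr.read 0 (.reg 1)).eval s = s.conf.out i := by
      simp only [Expr.eval, h1]
      rfl
    by_cases ho : s.conf.out i = 0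
    · refine .ite_false (he.trans ho) (.skip ⟨hs.tick, ?_, h1, ?_⟩)
      · rw [Conf.release, if_pos ho]
        rfl
      · rw [Conf.release, if_pos ho, State.tick_time]
        omega
    · refine .ite_true (by rwa [he]) (.seq (.set ?_))
      have e1 : (Expr.reg 1).eval s.tick = i := h1
      rw [e1]
      refine (unmatch_spec (e := i) hV (hs.tick.setReg (by omega) (by omega)) hL (by simp) hi
        hVi).mono ?_
      rintro s' ⟨a1, a2, a3, a4⟩
      have a2' : s'.conf = s.conf.unmatch p V i := a2
      rw [Conf.release, if_neg ho]
      refine ⟨a1, a2, ?_, ?_⟩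
      · rw [a3 1 (by omega)]
        simpa using h1
      · change s'.time + _ ≤ s.time + 1 + 1 + _ + _ + _ at a4
        rw [a2'] at a4
        change s'.time + moveCost p * s.conf.limbo p V ≤ _ at a4
        omega
  refine .seq (hfirst.mono ?_)
  rintro s1 ⟨a1, a2, a3, a4⟩
  refine .seq (.set (.seq ?_))
  simp only [Expr.eval, a3]
  refine (unlink_spec (f := i) hV (a1.setReg (by omega) (by omega)) (by simp) hi).mono ?_
  rintro s2 ⟨b1, b2, b3, b4, b5⟩
  have e1 : s2.reg 1 = i := by
    rw [b4 1 (by omega)]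
    simpa using a3
  refine .write ?_
  simp only [Expr.eval, e1]
  have harr : ∀ a < 7, a ≠ 2 → (s2.setArr 2 i 0).arr a = s1.arr a := fun a ha h2 =>
    (State.setArr_arr_of_ne _ _ _ h2).trans (b3 a ha)
  refine ⟨⟨⟨b1.n, b1.m, b1.r, max_le b1.peak (by omega), ?_, ?_⟩, ?_⟩, ?_, ?_⟩
  · intro f hf
    have := b1.deg f hf
    by_cases hfi : f = i
    · simp [hfi]
    · simpa [hfi] using this
  · intro f hf k hk
    have hfi : f ≠ i := by
      rintro rfl
      simp at hk
    have := b1.vtx f hf k (by simpa [hfi] using hk)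
    simpa [hfi] using this
  · intro κ u hu
    rw [harr 4 (by omega) (by omega), ← show s1.conf.loc = s1.arr 4 from rfl, Conf.lst_delete]
    rw [State.setArr_arr_of_ne _ _ _ (by omega), State.setArr_arr_of_ne _ _ _ (by omega),
      State.setArr_arr_of_ne _ _ _ (by omega)]
    exact b2 κ u hu
  · rw [← a2]
    exact Conf.ext' (harr 4 (by omega) (by omega)) (harr 5 (by omega) (by omega))
      (harr 6 (by omega) (by omega)) (harr 0 (by omega) (by omega))
  · rw [State.setArr_time]
    change s2.time ≤ s1.time + 1 + _ + _ at b5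
    omega

end DynMatch

namespace DynMatch

/-! ## Serving an update -/

variable {n m r : ℕ}

/-- The vertex list of the hyperedge named `f`, starting with the dummy vertex `n`. -/
def Hypergraph.vlist (G : Hypergraph n m) (f : ℕ) : List ℕ :=
  if h : f < m then
    (G ⟨f, h⟩).elim [] fun e => n :: (e.sort (· ≤ ·)).map fun v : Fin n => (v : ℕ)
  else []

/-- All hyperedges have at least one and at most `r` vertices. -/
def Hypergraph.HasRank (r : ℕ) (G : Hypergraph n m) : Prop :=
  ∀ i e, G i = some e → e.Nonempty ∧ e.card ≤ r

/-- The number of updates before the hyperedge `j` is deleted. -/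
def delTime : List (Update n m) → ℕ → ℕ
  -- A hyperedge that is never deleted gets the number of remaining updates, which exceeds every
  -- actual deletion time.
  | [], _ => 0
  | .insert _ _ :: us, j => delTime us j + 1
  | .delete i :: us, j => if j = i then 0 else delTime us j + 1

namespace Hypergraph

variable {G : Hypergraph n m}

theorem vlist_update (i : Fin m) (o : Option (Finset (Fin n))) :
    vlist (Function.update G i o) = Function.update G.vlist i
      (o.elim [] fun e => n :: (e.sort (· ≤ ·)).map fun v : Fin n => (v : ℕ)) := by
  funext f
  by_cases hf : f = i
  · subst hf
    simp [vlist]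
  · rw [Function.update_of_ne hf, vlist, vlist]
    split_ifs with h
    · rw [Function.update_of_ne]
      rintro rfl
      exact hf rfl
    · rfl

theorem vlist_eq (i : Fin m) :
    G.vlist i = (G i).elim [] fun e => n :: (e.sort (· ≤ ·)).map fun v : Fin n => (v : ℕ) := by
  simp [vlist]

theorem vlist_ne_nil {i : Fin m} : G.vlist i ≠ [] ↔ G i ≠ none := by
  rw [vlist_eq]
  cases G i <;> simp

theorem mem_vlist_tail {i : Fin m} {e : Finset (Fin n)} (h : G i = some e) {x : ℕ} :
    x ∈ (G.vlist i).tail ↔ ∃ v ∈ e, (v : ℕ) = x := by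
  rw [vlist_eq, h]
  simp

theorem HasRank.wf (h : G.HasRank r) : WF ⟨n, m, r⟩ G.vlist := by
  intro f hf
  change f < m at hf
  obtain ⟨i, rfl⟩ : ∃ i : Fin m, (i : ℕ) = f := ⟨⟨f, hf⟩, rfl⟩
  rw [vlist_eq]
  cases hG : G i with
  | none => exact Or.inl rfl
  | some e =>
    obtain ⟨h1, h2⟩ := h i e hG
    refine Or.inr ⟨_, rfl, ?_, ?_, ?_, ?_⟩
    · rw [← List.length_pos_iff]
      simpa using h1
    · exact (Finset.sort_nodup _ _).map Fin.val_injective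
    · simp
    · simpa using h2

theorem HasRank.apply (h : G.HasRank r) {u : Update n m} (hu : G.Legal r u) :
    (G.apply u).HasRank r := by
  intro j e he
  cases u with
  | insert i f =>
    by_cases hj : j = i
    · subst hj
      simp only [Hypergraph.apply, Function.update_self, Option.some.injEq] at he
      exact he ▸ hu.2
    · simp only [Hypergraph.apply, Function.update_of_ne hj] at he
      exact h j e he
  | delete i =>
    by_cases hj : j = i
    · subst hj
      simp [Hypergraph.apply] at he
    · simp only [Hypergraph.apply, Function.update_of_ne hj] at he
      exact h j e he

theorem present_vlist_le : present ⟨n, m, r⟩ G.vlist ≤ G.numEdges := by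
  rw [present, numEdges, ← Finset.card_image_of_injective _ Fin.val_injective]
  refine Finset.card_le_card fun f hf => ?_
  obtain ⟨h1, h2⟩ := Finset.mem_filter.1 hf
  have h1 : f < m := Finset.mem_range.1 h1
  have h3 := (vlist_ne_nil (G := G) (i := ⟨f, h1⟩)).1 h2
  refine Finset.mem_image.2 ⟨⟨f, h1⟩, ?_, rfl⟩
  simpa [Option.isSome_iff_ne_none] using h3

end Hypergraph

open DynMatch.Hypergraph

variable {G : Hypergraph n m} {s : State} {θ : ℝ}

theorem Tidy.load {p : Params} {V : ℕ → List ℕ} (hs : Tidy p V s) (u : Update n m) :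
    Tidy p V (s.load u) := by
  cases u <;>
    exact ⟨⟨⟨hs.n, hs.m, hs.r, hs.peak, hs.deg, hs.vtx⟩, hs.lists⟩, hs.levB, hs.inv, hs.cap⟩

/-- One late hyperedge and one in the limbo cost `16000 r ^ 3 + 50 r`; storing and linking take the
remaining `9 r + 15`. -/
theorem insert_step {i : Fin m} {e : Finset (Fin n)} {us : List (Update n m)}
    (hG : G.HasRank r) (hu : G.Legal r (.insert i e)) (hs : Tidy ⟨n, m, r⟩ G.vlist s) :
    insertCmd.Det (s.load (.insert i e)).tick fun s' =>
      Tidy ⟨n, m, r⟩ (G.apply (.insert i e)).vlist s' ∧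
      s'.time + s'.conf.pot ⟨n, m, r⟩ (G.apply (.insert i e)).vlist (delTime us) ≤
        s.time + s.conf.pot ⟨n, m, r⟩ G.vlist (delTime (.insert i e :: us)) +
          (16000 * r ^ 3 + 59 * r + 15) := by
  have hV := (hG.apply hu).wf
  have hnil : G.vlist i = [] := by
    rw [vlist_eq, hu.1]
    rfl
  rw [show (G.apply (.insert i e)).vlist = Function.update G.vlist i
    (n :: (e.sort (· ≤ ·)).map fun v : Fin n => (v : ℕ)) from vlist_update i (some e)] at hV ⊢
  have hg : Good ⟨n, m, r⟩ G.vlist (s.load (.insert i e)).tick := (hs.load _).toGood.tick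
  refine (insertCmd_spec hV hg i.2 hnil ?_ ?_ ?_).mono ?_
  · simp [State.load]
  · simp [State.load]
  · intro j hj
    simp only [State.load, State.tick_arr, Function.update_self]
    rw [List.getD_eq_getElem]
  · rintro s' ⟨h1, h2, h3⟩
    have h2 : s'.conf = s.conf.put i 2 := h2
    refine ⟨⟨h1, h2 ▸ hs.levB, h2 ▸ hs.inv.insert hnil, h2 ▸ hs.cap.insert hnil⟩, ?_⟩
    change s'.time ≤ s.time + 1 + _ + _ at h3
    set V' := Function.update G.vlist i (n :: (e.sort (· ≤ ·)).map fun v : Fin n => (v : ℕ))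
    have a1 : s'.conf.late ⟨n, m, r⟩ V' (delTime us) ≤ s.conf.late ⟨n, m, r⟩ G.vlist
      (delTime (.insert i e :: us)) + 1 := h2 ▸ Conf.late_insert fun f => rfl
    have a2 : s'.conf.limbo ⟨n, m, r⟩ V' ≤ s.conf.limbo ⟨n, m, r⟩ G.vlist + 1 :=
      h2 ▸ Conf.limbo_insert
    have a3 : s'.conf.sumLev ⟨n, m, r⟩ = s.conf.sumLev ⟨n, m, r⟩ := h2 ▸ rfl
    have b1 := Nat.mul_le_mul_left (16000 * r ^ 3) a1
    have b2 := Nat.mul_le_mul_left (50 * r) a2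
    rw [mul_add, mul_one] at b1 b2
    rw [Conf.pot, Conf.pot, a3]
    dsimp only at h3 ⊢
    omega

theorem delete_step {i : Fin m} {us : List (Update n m)} (hr : 1 < r)
    (hG : G.HasRank r) (hu : G.Legal r (.delete i)) (hs : Tidy ⟨n, m, r⟩ G.vlist s) :
    deleteCmd.Det (s.load (Update.delete (n := n) i)).tick fun s' =>
      Tidy ⟨n, m, r⟩ (G.apply (.delete i)).vlist s' ∧
      s'.time + s'.conf.pot ⟨n, m, r⟩ (G.apply (.delete i)).vlist (delTime us) ≤
        s.time + s.conf.pot ⟨n, m, r⟩ G.vlist (delTime (.delete i :: us)) +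
          (16000 * r ^ 3 + 13 * r + 19) := by
  have hnil : G.vlist i ≠ [] := vlist_ne_nil.2 hu
  have hV := hG.wf
  rw [show (G.apply (.delete i)).vlist = Function.update G.vlist i [] from vlist_update i none]
  have hg : Good ⟨n, m, r⟩ G.vlist (s.load (Update.delete (n := n) i)).tick := (hs.load _).toGood.tick
  refine (deleteCmd_spec hV hg hs.levB i.2 hnil (by simp [State.load])).mono ?_
  rintro s' ⟨h1, h2, h3⟩
  change s'.conf = s.conf.release ⟨n, m, r⟩ G.vlist i at h2
  change s'.time + moveCost _ * s.conf.limbo ⟨n, m, r⟩ G.vlist ≤ s.time + 1 + moveCost _ *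
    (s.conf.release ⟨n, m, r⟩ G.vlist i).limbo ⟨n, m, r⟩ G.vlist + _ + _ at h3
  have hd : ∀ f : ℕ, f ≠ i → delTime (.delete i :: us) f = delTime us f + 1 := fun f hf => if_neg hf
  have hdi : delTime (.delete i :: us) i = 0 := if_pos rfl
  set d := delTime (.delete i :: us)
  have key : (s.conf.release ⟨n, m, r⟩ G.vlist i).LevB ⟨n, m, r⟩ ∧
      (s.conf.release ⟨n, m, r⟩ G.vlist i).Inv ⟨n, m, r⟩ G.vlist (fun _ => False) ∧
      (s.conf.release ⟨n, m, r⟩ G.vlist i).Cap ⟨n, m, r⟩ G.vlist ∧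
      (s.conf.release ⟨n, m, r⟩ G.vlist i).out i = 0 ∧
      (s.conf.release ⟨n, m, r⟩ G.vlist i).late ⟨n, m, r⟩ G.vlist d ≤
        s.conf.late ⟨n, m, r⟩ G.vlist d + 1 ∧
      (s.conf.release ⟨n, m, r⟩ G.vlist i).limbo ⟨n, m, r⟩ G.vlist +
        2 * (s.conf.release ⟨n, m, r⟩ G.vlist i).sumLev ⟨n, m, r⟩ ≤
        s.conf.limbo ⟨n, m, r⟩ G.vlist + 2 * s.conf.sumLev ⟨n, m, r⟩ ∧
      (s.conf.release ⟨n, m, r⟩ G.vlist i).sumLev ⟨n, m, r⟩ ≤ s.conf.sumLev ⟨n, m, r⟩ := by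
    rw [Conf.release]
    split_ifs with ho
    · exact ⟨hs.levB, hs.inv, hs.cap, ho, Nat.le_succ _, le_rfl, le_rfl⟩
    · obtain ⟨c1, c2⟩ := Conf.unmatch_potential hV hr hs.inv i.2 ho id hs.cap
      refine ⟨fun x => ?_, hs.inv.unmatch hV i.2 ho id, hs.cap.unmatch _,
        Function.update_self _ _ _, Conf.unmatch_late_first hdi hd, c1, c2.le⟩
      rw [Conf.unmatch_lev]
      have := hs.levB x
      split_ifs
      · omega
      · exact this
  obtain ⟨k1, k2, k3, k4, k5, k6, k7⟩ := key
  rw [← h2] at k1 k2 k3 k4 k5 k6 k7 h3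
  refine ⟨⟨h1, k1, k2.delete k4, k3.delete⟩, ?_⟩
  have a1 := (Conf.late_delete (p := ⟨n, m, r⟩) (V := G.vlist) (C := s'.conf) hdi hd).trans k5
  have a2 := Conf.limbo_delete (p := ⟨n, m, r⟩) (V := G.vlist) (C := s'.conf) (i := i)
  rw [moveCost] at h3
  rw [Conf.pot, Conf.pot]
  dsimp only at h3 ⊢
  have b1 := Nat.mul_le_mul_left (16000 * r ^ 3) a1
  have b2 := Nat.mul_le_mul_left (50 * r) a2
  have b3 := Nat.mul_le_mul_left (60 * r + 18) k6
  have b4 := Nat.mul_le_mul_left (30 * r - 36) k7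
  -- A new hyperedge in the limbo costs `moveCost + 50 r = 60 r + 18`, and `k6` trades it against
  -- twice the level sum. The remainder only needs that the level sum does not grow; the subtraction
  -- is exact as `2 ≤ r`.
  have e1 : 150 * r = 2 * (60 * r + 18) + (30 * r - 36) := by omega
  rw [e1]
  linarith

theorem program_step {u : Update n m} {us : List (Update n m)} {H : ℕ} (hr : 1 < r)
    (hG : G.HasRank r) (hu : G.Legal r u) (hs : Tidy ⟨n, m, r⟩ G.vlist s)
    (hH : (G.apply u).numEdges ≤ H) (hθ : 0 ≤ θ) (hθ' : θ * (64000 * r ^ 3 * H) ≤ 1) :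
    program.Exp (s.load u) (weight ⟨n, m, r⟩ (G.apply u).vlist (delTime us) θ)
      (fun s' => Tidy ⟨n, m, r⟩ (G.apply u).vlist s' ∧
        s'.conf.limbo ⟨n, m, r⟩ (G.apply u).vlist = 0)
      (weight ⟨n, m, r⟩ G.vlist (delTime (u :: us)) θ s *
        ENNReal.ofReal (Real.exp (θ * (17000 * r ^ 3)))) := by
  have hfirst : (Cmd.ite (.reg 0) insertCmd deleteCmd).Det (s.load u) fun s' =>
      Tidy ⟨n, m, r⟩ (G.apply u).vlist s' ∧
      s'.time + s'.conf.pot ⟨n, m, r⟩ (G.apply u).vlist (delTime us) ≤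
        s.time + s.conf.pot ⟨n, m, r⟩ G.vlist (delTime (u :: us)) +
          (16000 * r ^ 3 + 59 * r + 19) := by
    cases u with
    | insert i e =>
      refine .ite_true (by simp [Expr.eval, State.load]) ((insert_step (us := us) hG hu hs).mono ?_)
      rintro s' ⟨h1, h2⟩
      exact ⟨h1, by omega⟩
    | delete i =>
      refine .ite_false (by simp [Expr.eval, State.load]) ((delete_step (us := us) hr hG hu hs).mono ?_)
      rintro s' ⟨h1, h2⟩
      exact ⟨h1, by omega⟩
  refine .det_seq (hfirst.mono ?_)
  rintro s1 ⟨h1, h2⟩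
  refine (settle_spec (hG.apply hu).wf hr h1 hθ (hθ'.trans' ?_)).mono (fun _ h => h) ?_
  · have : (present ⟨n, m, r⟩ (G.apply u).vlist : ℝ) ≤ H :=
      Nat.cast_le.2 (present_vlist_le.trans hH)
    dsimp only
    gcongr
  · refine (mul_le_mul_left (weight_le_of_le hθ h2) _).trans ?_
    rw [mul_assoc, ← ENNReal.ofReal_mul (Real.exp_pos _).le, ← Real.exp_add]
    refine mul_le_mul_right (ENNReal.ofReal_le_ofReal (Real.exp_le_exp.2 ?_)) _
    rw [← mul_add_one]
    refine mul_le_mul_of_nonneg_left ?_ hθ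
    have h3 : 16000 * r ^ 3 + 59 * r + 19 + 1 ≤ 17000 * r ^ 3 := by
      have h4 : 2 * 2 ≤ r * r := Nat.mul_le_mul hr hr
      have h5 : 4 * r ≤ r ^ 3 := by
        rw [pow_succ, sq]
        exact Nat.mul_le_mul_right _ h4
      omega
    exact_mod_cast h3

/-- One `θ` serves all updates, so the exponential bounds multiply. At the end the potential is
dropped, being nonnegative. -/
theorem serves_spec {us : List (Update n m)} {H : ℕ} (hr : 1 < r) (hG : G.HasRank r)
    (hus : LegalSeq r G us) (hs : Tidy ⟨n, m, r⟩ G.vlist s)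
    (hlim : s.conf.limbo ⟨n, m, r⟩ G.vlist = 0)
    (hH : ∀ k ≤ us.length, ((us.take k).foldl apply G).numEdges ≤ H)
    (hθ : 0 ≤ θ) (hθ' : θ * (64000 * r ^ 3 * H) ≤ 1) :
    ∃ μ, Serves program us s μ ∧
      (∀ s' ∈ μ.support, (us.foldl apply G).HasRank r ∧
        Tidy ⟨n, m, r⟩ (us.foldl apply G).vlist s' ∧
        s'.conf.limbo ⟨n, m, r⟩ (us.foldl apply G).vlist = 0) ∧
      mean μ (fun s' => ENNReal.ofReal (Real.exp (θ * s'.time))) ≤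
        weight ⟨n, m, r⟩ G.vlist (delTime us) θ s *
          ENNReal.ofReal (Real.exp (θ * (17000 * r ^ 3 * us.length))) := by
  induction us generalizing G s with
  | nil =>
    refine ⟨_, .nil s, fun s' hs' => ?_, ?_⟩
    · rw [PMF.support_pure, Set.mem_singleton_iff] at hs'
      exact hs' ▸ ⟨hG, hs, hlim⟩
    · rw [mean_pure, weight]
      simp only [List.length_nil, Nat.cast_zero, mul_zero, Real.exp_zero, ENNReal.ofReal_one,
        mul_one]
      refine ENNReal.ofReal_le_ofReal (Real.exp_le_exp.2 (mul_le_mul_of_nonneg_left ?_ hθ))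
      exact_mod_cast Nat.le_add_right _ _
  | cons u us ih =>
    obtain ⟨hu, hus⟩ := hus
    obtain ⟨μ, h1, h2, h3⟩ := program_step (us := us) hr hG hu hs (hH 1 (by simp)) hθ hθ'
    have : ∀ s' ∈ μ.support, _ := fun s' hs' => ih (s := s') (hG.apply hu) hus (h2 s' hs').1
      (h2 s' hs').2 fun k hk => hH (k + 1) (by simpa using hk)
    choose! ν k1 k2 k3 using this
    refine ⟨_, .cons u us s μ ν h1 k1, fun s' hs' => ?_, ?_⟩
    · obtain ⟨a, ha, hs'⟩ := (PMF.mem_support_bind_iff _ _ _).1 hs'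
      exact k2 a ha s' hs'
    · rw [mean_bind]
      refine (mean_mono k3).trans ?_
      rw [mean_mul_const]
      refine (mul_le_mul_left h3 _).trans_eq ?_
      rw [mul_assoc, ← ENNReal.ofReal_mul (Real.exp_pos _).le, ← Real.exp_add, ← mul_add,
        List.length_cons]
      push_cast
      ring_nf

end DynMatch

namespace DynMatch

open DynMatch.Hypergraph

variable {n m r : ℕ} {G : Hypergraph n m} {s : State}

/-! ## The output and the size of the numbers -/

/-- A vertex common to two matched hyperedges would have both as its mate. With an empty limbo, a
hyperedge is frozen with a matched one that it meets, or sits at a level attained by one of its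
vertices. -/
theorem Tidy.isMaximalMatching (hG : G.HasRank r) (hs : Tidy ⟨n, m, r⟩ G.vlist s)
    (hlim : s.conf.limbo ⟨n, m, r⟩ G.vlist = 0) : G.IsMaximalMatching (s.output m) := by
  have hV := hG.wf
  have hinv := hs.inv
  have hmeet : ∀ {i j : Fin m} {e f : Finset (Fin n)} {x : ℕ}, G i = some e → G j = some f →
      x ∈ (G.vlist i).tail → x ∈ (G.vlist j).tail → ¬ Disjoint e f := by
    intro i j e f x hi hj hx hx'
    obtain ⟨v, hv, rfl⟩ := (mem_vlist_tail hi).1 hx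
    obtain ⟨v', hv', h⟩ := (mem_vlist_tail hj).1 hx'
    rw [Fin.val_inj] at h
    exact Finset.not_disjoint_iff.2 ⟨v, hv, h ▸ hv'⟩
  have hsome : ∀ i : Fin m, s.conf.out i ≠ 0 → ∃ e, G i = some e := fun i hi =>
    Option.ne_none_iff_exists'.1 (vlist_ne_nil.1 (hinv.out i i.2 hi).1)
  refine ⟨fun i hi => vlist_ne_nil.1 (hinv.out i i.2 hi).1, ?_, ?_⟩
  · intro i hi j hj hij e f he hf
    by_contra hd
    obtain ⟨v, hv, hv'⟩ := Finset.not_disjoint_iff.1 hd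
    obtain ⟨-, k, h1, -⟩ := (hinv.out i i.2 hi).2 id
    obtain ⟨-, k', h2, -⟩ := (hinv.out j j.2 hj).2 id
    have h3 := (h1 v ((mem_vlist_tail he).2 ⟨v, hv, rfl⟩)).2
    have h4 := (h2 v ((mem_vlist_tail hf).2 ⟨v, hv', rfl⟩)).2
    exact hij (Fin.ext (h3.symm.trans h4))
  · intro j _ f hf
    have hne : G.vlist j ≠ [] := vlist_ne_nil.2 (by simp [hf])
    have hjn := hV.dummy_mem (f := j) j.2 hne
    rcases hinv.loc j j.2 hne with h | ⟨k, h1, h2, x, hx, h3⟩ | ⟨e, he, -, h1, x, hx, hx'⟩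
    · have : (j : ℕ) ∈ lst ⟨n, m, r⟩ G.vlist s.conf.loc 2 n := mem_lst.2 ⟨j.2, h, hjn⟩
      rw [Finset.card_eq_zero.1 hlim] at this
      exact absurd this (Finset.notMem_empty _)
    · have hxn := hV.tail_lt (f := j) j.2 hx
      -- The capacity of level 0 is 0, so no hyperedge can sit there, and `x` is matched.
      have hl : s.conf.lev x ≠ 0 := by
        intro h0
        have hc := hs.cap x hxn k
        rw [← h3, h0, Nat.le_zero, Finset.card_eq_zero] at hc
        have : (j : ℕ) ∈ lst ⟨n, m, r⟩ G.vlist s.conf.loc (3 * 0) x :=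
          mem_lst.2 ⟨j.2, by rw [h1, ← h3, h0], List.mem_of_mem_tail hx⟩
        rw [hc] at this
        exact absurd this (Finset.notMem_empty _)
      obtain ⟨g1, g2, g3⟩ := hinv.mate x hxn hl
      obtain ⟨e, he⟩ := hsome ⟨_, g1⟩ g2
      exact ⟨⟨_, g1⟩, g2, e, he, hmeet he hf g3 hx⟩
    · obtain ⟨e', he'⟩ := hsome ⟨e, he⟩ h1
      exact ⟨⟨e, he⟩, h1, e', he', hmeet he' hf hx' hx⟩

theorem bound_le {C t : ℕ} (hr : 1 < r) (hC : 35 ≤ C) :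
    (⟨n, m, r⟩ : Params).P ≤ C * (n + m + r + t) ^ C := by
  have h1 : (n + m + r + t) ^ 2 ≤ (n + m + r + t) ^ C := Nat.pow_le_pow_right (by omega) (by omega)
  refine le_trans ?_ (Nat.mul_le_mul hC h1)
  rw [Params.P]
  dsimp only
  set N := n + m + r + t with hN
  have h2 : r * m ≤ N ^ 2 := by
    rw [sq]
    exact Nat.mul_le_mul (by omega) (by omega)
  have h3 : N * 2 ≤ N ^ 2 := by
    rw [sq]
    exact Nat.mul_le_mul_left _ (by omega)
  have h4 : 24 * r * m = 24 * (r * m) := mul_assoc _ _ _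
  omega

/-! ## The running time -/

theorem vlist_empty (f : ℕ) : (Hypergraph.empty n m).vlist f = [] := by
  rw [vlist]
  split_ifs <;> rfl

theorem hasRank_empty : (Hypergraph.empty n m).HasRank r := fun _ _ h => nomatch h

theorem tidy_initState : Tidy ⟨n, m, r⟩ (Hypergraph.empty n m).vlist (initState n m r) := by
  have hlst : ∀ loc κ u, lst ⟨n, m, r⟩ (Hypergraph.empty n m).vlist loc κ u = ∅ := by
    intro loc κ u
    refine Finset.filter_eq_empty_iff.2 fun f _ h => ?_
    rw [vlist_empty] at h
    exact List.not_mem_nil h.2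
  refine ⟨⟨⟨rfl, rfl, rfl, Nat.zero_le _, ?_, ?_⟩, ?_⟩, ?_, ⟨?_, ?_, ?_, ?_⟩, ?_⟩
  · intro f _
    rw [vlist_empty]
    rfl
  · intro f _ k hk
    simp [vlist_empty] at hk
  · intro κ u _
    rw [hlst]
    exact ⟨rfl, by simp, by simp⟩
  · intro x
    change 3 * 0 + 2 ≤ Params.P _
    have := (⟨n, m, r⟩ : Params).bounds
    omega
  · exact fun f _ h => absurd (vlist_empty f) h
  · exact fun e _ h => absurd rfl h
  · exact fun x _ h => absurd rfl h
  · exact fun x _ => ⟨0, rfl⟩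
  · intro x _ k
    rw [hlst]
    exact Nat.zero_le _

theorem limbo_initState :
    (initState n m r).conf.limbo ⟨n, m, r⟩ (Hypergraph.empty n m).vlist = 0 := by
  refine Finset.card_eq_zero.2 (Finset.filter_eq_empty_iff.2 fun f _ h => ?_)
  rw [vlist_empty] at h
  exact List.not_mem_nil h.2

theorem weight_initState (d : ℕ → ℕ) (θ : ℝ) :
    weight ⟨n, m, r⟩ (Hypergraph.empty n m).vlist d θ (initState n m r) = 1 := by
  have h1 : (initState n m r).conf.late ⟨n, m, r⟩ (Hypergraph.empty n m).vlist d = 0 :=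
    Finset.card_eq_zero.2 (Finset.filter_eq_empty_iff.2 fun f _ h => h.1 (vlist_empty f))
  have h2 : (initState n m r).conf.sumLev ⟨n, m, r⟩ = 0 := Finset.sum_eq_zero fun _ _ => rfl
  have h3 : (initState n m r).time = 0 := rfl
  rw [weight, Conf.pot, h1, h2, limbo_initState, h3]
  simp

section tail

variable {μ : PMF State} {θ A : ℝ}

/-- Markov's inequality for `exp (θ T)`. -/
theorem probTimeGT_le (hθ : 0 ≤ θ)
    (h : mean μ (fun s => ENNReal.ofReal (Real.exp (θ * s.time))) ≤ ENNReal.ofReal (Real.exp A))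
    (b : ℝ) : probTimeGT μ b ≤ ENNReal.ofReal (Real.exp (A - θ * b)) := by
  rw [probTimeGT, PMF.toOuterMeasure_apply, sub_eq_add_neg, Real.exp_add,
    ENNReal.ofReal_mul (Real.exp_pos _).le]
  refine le_trans ?_ (mul_le_mul_left h _)
  rw [← mean_mul_const]
  refine ENNReal.tsum_le_tsum fun s => ?_
  rw [Set.indicator_apply]
  split_ifs with hs
  · beta_reduce
    rw [← ENNReal.ofReal_mul (Real.exp_pos _).le, ← Real.exp_add]
    refine le_mul_of_one_le_right zero_le ?_
    rw [← ENNReal.ofReal_one]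
    refine ENNReal.ofReal_le_ofReal (Real.one_le_exp ?_)
    have := mul_le_mul_of_nonneg_left (le_of_lt hs) hθ
    linarith
  · exact zero_le

/-- Take the mean of `1 + x ≤ exp x` at `x = θ T - A`, with `A` moved to the right because `ℝ≥0∞`
truncates subtraction. -/
theorem expectedTime_le (hθ : 0 < θ) (hA : 0 ≤ A)
    (h : mean μ (fun s => ENNReal.ofReal (Real.exp (θ * s.time))) ≤ ENNReal.ofReal (Real.exp A)) :
    expectedTime μ ≤ ENNReal.ofReal (A / θ) := by
  have key : ∀ s : State, ENNReal.ofReal θ * (s.time : ℝ≥0∞) + 1 ≤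
      ENNReal.ofReal (Real.exp (θ * s.time)) * ENNReal.ofReal (Real.exp (-A)) +
        ENNReal.ofReal A := fun s => by
    rw [← ENNReal.ofReal_natCast, ← ENNReal.ofReal_mul hθ.le, ← ENNReal.ofReal_one,
      ← ENNReal.ofReal_add (by positivity) zero_le_one, ← ENNReal.ofReal_mul (Real.exp_pos _).le,
      ← ENNReal.ofReal_add (by positivity) hA, ← Real.exp_add]
    refine ENNReal.ofReal_le_ofReal ?_
    have := Real.add_one_le_exp (θ * s.time + -A)
    linarith
  have h1 := mean_mono (μ := μ) fun s _ => key s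
  have hadd : ∀ F G : State → ℝ≥0∞, mean μ (fun s => F s + G s) = mean μ F + mean μ G :=
    fun F G => by simp only [mean, mul_add, ENNReal.tsum_add]
  rw [hadd, hadd, mean_const, mean_const, mean_mul_const] at h1
  have h2 := h1.trans (add_le_add_left (mul_le_mul_left h _) _)
  rw [← ENNReal.ofReal_mul (Real.exp_pos _).le, ← Real.exp_add, add_neg_cancel, Real.exp_zero,
    ENNReal.ofReal_one, add_comm 1 (ENNReal.ofReal A)] at h2
  have h3 := ENNReal.le_of_add_le_add_right ENNReal.one_ne_top h2
  rw [ENNReal.ofReal_div_of_pos hθ, ENNReal.le_div_iff_mul_le (Or.inl (by simpa using hθ))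
    (Or.inl ENNReal.ofReal_ne_top)]
  refine le_trans (le_of_eq ?_) h3
  simp only [mul_comm (ENNReal.ofReal θ), mean_mul_const]
  rfl

end tail

/-- The first legal update of the empty hypergraph is an insertion. -/
theorem maxEdges_pos {us : List (Update n m)} (hus : LegalSeq r (Hypergraph.empty n m) us)
    (hne : us ≠ []) : 0 < maxEdges us := by
  obtain ⟨u, us, rfl⟩ := List.exists_cons_of_ne_nil hne
  refine lt_of_lt_of_le ?_ (Finset.le_sup (f := fun k => (after ((u :: us).take k)).numEdges)
    (Finset.mem_range.2 (show 1 < (u :: us).length + 1 by simp)))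
  cases u with
  | insert i e =>
    refine Finset.card_pos.2 ⟨i, ?_⟩
    exact Finset.mem_filter.2 ⟨Finset.mem_univ i,
      congrArg Option.isSome (Function.update_self (β := fun _ => Option (Finset (Fin n))) i (some e) (Hypergraph.empty n m))⟩
  | delete i => exact absurd rfl hus.1

theorem program_spec {C : ℕ} (hC : 100000 ≤ C) (hr : 1 < r) {us : List (Update n m)}
    (hus : LegalSeq r (Hypergraph.empty n m) us) :
    ∃ μ : PMF State, Serves program us (initState n m r) μ ∧
      (∀ s ∈ μ.support, (after us).IsMaximalMatching (s.output m) ∧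
        s.peak ≤ C * (n + m + r + us.length) ^ C) ∧
      expectedTime μ ≤ ((C * us.length * r ^ 3 : ℕ) : ℝ≥0∞) ∧
      probTimeGT μ (C * us.length * r ^ 3) ≤
        ENNReal.ofReal (Real.exp (-((us.length : ℝ) / maxEdges us))) ∧
      ∀ b : ℝ, 0 ≤ b → probTimeGT μ (C * (us.length + b * maxEdges us) * r ^ 3) ≤
        ENNReal.ofReal (Real.exp (-b)) := by
  -- Without updates `H` is 0 and the choice of `θ` below is impossible.
  by_cases hne : us = []
  · subst hne
    have hP : ∀ b : ℝ, 0 ≤ b → probTimeGT (PMF.pure (initState n m r)) b = 0 := fun b hb => by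
      rw [probTimeGT, PMF.toOuterMeasure_pure_apply, if_neg]
      exact not_lt.2 (by simpa [initState] using hb : ((initState n m r).time : ℝ) ≤ b)
    refine ⟨_, .nil _, fun s hs => ?_, ?_, ?_, fun b hb => ?_⟩
    · rw [PMF.support_pure, Set.mem_singleton_iff] at hs
      subst hs
      refine ⟨?_, Nat.zero_le _⟩
      exact tidy_initState.isMaximalMatching (r := r) hasRank_empty
        limbo_initState
    · rw [← show mean _ _ = expectedTime _ from rfl, mean_pure]
      simp [initState]
    · rw [hP _ (by positivity)]
      exact zero_le
    · rw [hP _ (by positivity)]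
      exact zero_le
  · have hH : (0 : ℝ) < maxEdges us := Nat.cast_pos.2 (maxEdges_pos hus hne)
    set H := maxEdges us with hHdef
    have hr0 : (0 : ℝ) < (r : ℝ) ^ 3 := by positivity
    -- The largest `θ` that `serves_spec` allows. An excess of `64000 r ^ 3 b H` steps then has
    -- exponent `-b`. The bound at `C t r ^ 3` needs `C ≥ 17000 + 64000`.
    obtain ⟨θ, hθdef⟩ : ∃ θ : ℝ, θ * (64000 * r ^ 3 * H) = 1 :=
      ⟨(64000 * r ^ 3 * H)⁻¹, inv_mul_cancel₀ (by positivity)⟩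
    have hθ : 0 < θ := by
      by_contra hneg
      have : θ * (64000 * r ^ 3 * H) ≤ 0 :=
        mul_nonpos_of_nonpos_of_nonneg (not_lt.1 hneg) (by positivity)
      linarith
    have hCr : (100000 : ℝ) ≤ C := by exact_mod_cast hC
    have ht : (0 : ℝ) ≤ us.length := Nat.cast_nonneg _
    obtain ⟨μ, h1, h2, h3⟩ := serves_spec (H := H) hr
      hasRank_empty hus tidy_initState limbo_initState
      (fun k hk => Finset.le_sup (f := fun k => (after (us.take k)).numEdges)
        (Finset.mem_range.2 (by omega))) hθ.le hθdef.le
    rw [weight_initState, one_mul] at h3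
    have htail : ∀ b : ℝ, 0 ≤ b → probTimeGT μ (C * (us.length + b * H) * r ^ 3) ≤
        ENNReal.ofReal (Real.exp (-b)) := fun b hb => by
      refine (probTimeGT_le hθ.le h3 _).trans
        (ENNReal.ofReal_le_ofReal (Real.exp_le_exp.2 ?_))
      have e1 : 64000 * (us.length + b * H) ≤ C * (us.length + b * H) :=
        mul_le_mul_of_nonneg_right (by linarith) (by positivity)
      have e2 : 17000 * r ^ 3 * us.length - C * (us.length + b * H) * r ^ 3 ≤
          -(b * (64000 * r ^ 3 * H)) := by
        nlinarith [mul_le_mul_of_nonneg_right e1 hr0.le, mul_nonneg hr0.le ht]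
      have e3 := mul_le_mul_of_nonneg_left e2 hθ.le
      have e4 : θ * -(b * (64000 * r ^ 3 * H)) = -b := by
        rw [mul_neg, mul_left_comm, hθdef, mul_one]
      linarith
    refine ⟨μ, h1, fun s hs => ?_, ?_, ?_, htail⟩
    · obtain ⟨g1, g2, g3⟩ := h2 s hs
      exact ⟨g2.isMaximalMatching g1 g3, g2.peak.trans (bound_le hr (by omega))⟩
    · refine (expectedTime_le hθ (by positivity) h3).trans ?_
      rw [mul_div_cancel_left₀ _ hθ.ne', ← ENNReal.ofReal_natCast]
      refine ENNReal.ofReal_le_ofReal ?_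
      push_cast
      nlinarith [mul_nonneg hr0.le ht]
    · refine (probTimeGT_le hθ.le h3 _).trans
        (ENNReal.ofReal_le_ofReal (Real.exp_le_exp.2 ?_))
      have e1 : 17000 * r ^ 3 * us.length - C * us.length * r ^ 3 ≤
          -(64000 * r ^ 3 * us.length : ℝ) := by
        nlinarith [mul_nonneg hr0.le ht]
      have e2 := mul_le_mul_of_nonneg_left e1 hθ.le
      have e3 : (us.length : ℝ) / H = θ * (64000 * r ^ 3 * us.length) := by
        rw [div_eq_iff hH.ne', mul_assoc θ, mul_right_comm (64000 * (r : ℝ) ^ 3), ← mul_assoc θ,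
          hθdef, one_mul]
      rw [e3]
      linarith

end DynMatch

theorem mainTheorem3 :
    ∃ (P : DynMatch.Cmd) (C : ℕ), ∀ (r n m : ℕ), 1 < r →
      ∀ us : List (DynMatch.Update n m),
        DynMatch.Hypergraph.LegalSeq r (DynMatch.Hypergraph.empty n m) us →
        ∃ μ : PMF DynMatch.State,
          DynMatch.Serves P us (DynMatch.initState n m r) μ ∧
          (∀ s ∈ μ.support,
            (DynMatch.Hypergraph.after us).IsMaximalMatching (s.output m) ∧
            s.peak ≤ C * (n + m + r + us.length) ^ C) ∧
          DynMatch.expectedTime μ ≤ ((C * us.length * r ^ 3 : ℕ) : ℝ≥0∞) ∧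
          DynMatch.probTimeGT μ (C * us.length * r ^ 3) ≤
            ENNReal.ofReal
              (Real.exp (-((us.length : ℝ) / DynMatch.Hypergraph.maxEdges us))) ∧
          (∀ b : ℝ, 0 ≤ b →
            DynMatch.probTimeGT μ
                (C * (us.length + b * DynMatch.Hypergraph.maxEdges us) * r ^ 3) ≤
              ENNReal.ofReal (Real.exp (-b))) := by
  refine ⟨DynMatch.program, 100000, fun r n m hr us hus => ?_⟩
  exact DynMatch.program_spec le_rfl hr hus
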